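/- Let $\Lambda=\Lambda_{\mathbb C}(\xi_1,\dots,\xi_r)$ ($r\ge 0$) be an exterior $\mathbb C$-algebra of constants. Let $M=(|M|,\mathcal O_M)$ be a complex supermanifold over $\Lambda$ in the following sense: $\mathcal O_M$ is a sheaf of supercommutative $\Lambda$-superalgebras which is locally isomorphic to $\mathcal O_{\mathbb C^m}[[y_1,\dots,y_p]]\otimes\Lambda_{\mathbb C}(\theta_1,\dots,\theta_n)\otimes\Lambda$ on open subsets of $\mathbb C^m$, where $\mathcal O_{\mathbb C^m}$ is the sheaf of holomorphic functions. (For $p=0$, $M$ is an analytic supermanifold; for $r=p=0$ it is an analytic supermanifold over $\mathbb C$; the case $p>0$ includes formal completions of analytic supermanifolds along embedded closed submanifolds.) Let $\mathcal T_M$ be the tangent sheaf, i.e. the sheaf of $\Lambda$-linear superderivations of $\mathcal O_M$, with its Lie superbracket $[\,,]$. In signs, $(-1)^{XY}$ stands for $(-1)^{\widetilde X\widetilde Y}$, where $\widetilde X$ is the parity of $X$; formulas containing such signs are for homogeneous $X,Y$. Let $\nabla_0$ be a connection on $\mathcal T_M$, i.e. covariant derivatives $\nabla_{0,X}Y$,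 biadditive, compatible with restriction and parity-preserving in $(X,Y)$, with $\nabla_{0,fX}Y=f\,\nabla_{0,X}Y$ and $\nabla_{0,X}(fY)=X(f)Y+(-1)^{Xf}f\,\nabla_{0,X}Y$. Assume that $\nabla_0$ is torsionless, $\nabla_{0,X}Y-(-1)^{XY}\nabla_{0,Y}X=[X,Y]$, and flat, i.e. its curvature vanishes, where the curvature of a connection $\nabla$ is $$\nabla^2(X,Y)Z=\nabla_X\nabla_YZ-(-1)^{XY}\nabla_Y\nabla_XZ-\nabla_{[X,Y]}Z .$$ Let $A$ be an odd global section of $\Omega^1_M\otimes_{\mathcal O_M}\mathcal End(\mathcal T_M)$ ($1$-forms $df$ of even functions $f$ being odd), so that the contraction $i_X(A)$ is an endomorphism of $\mathcal T_M$ of the parity of $X$, $\mathcal O_M$-linear in $X$. Put $$X\circ Y:=i_X(A)(Y),\qquad \nabla_\lambda:=\nabla_0+\lambda A,\quad\text{i.e. } \nabla_{\lambda,X}Y=\nabla_{0,X}Y+\lambda\,X\circ Y,$$ for every even constant $\lambda\in\Lambda$. Then the curvature of $\nabla_\lambda$ has the form $\nabla_\lambda^2=\lambda R_1+\lambda^2R_2$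 for all even $\lambda$, where $$R_1(X,Y)Z=\nabla_{0,X}(Y\circ Z)+X\circ\nabla_{0,Y}Z-(-1)^{XY}\bigl(\nabla_{0,Y}(X\circ Z)+Y\circ\nabla_{0,X}Z\bigr)-[X,Y]\circ Z,$$ $$R_2(X,Y)Z=X\circ(Y\circ Z)-(-1)^{XY}\,Y\circ(X\circ Z),$$ and: (a) $\circ$ is supercommutative, $X\circ Y=(-1)^{XY}Y\circ X$, if and only if all connections $\nabla_\lambda$ are torsionless. (b) Assume that $\circ$ is supercommutative. Then $\circ$ has local vector potentials, i.e. every point has an open neighbourhood $W$ and a vector field $C$ on $W$ such that $X\circ Y=[X,[Y,C]]$ for all $\nabla_0$-flat vector fields $X,Y$ on open subsets of $W$, if and only if $R_1=0$. (c) Assume that $\circ$ is supercommutative. Then $\circ$ is associative if and only if $R_2=0$. -/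

import Mathlib

open TopologicalSpace CategoryTheory Opposite

universe u

noncomputable section

/-! ### Signs and exterior algebras -/

/-- The Koszul sign `(-1)^{pq}` attached to two parities. -/
def koszul (p q : ZMod 2) : ℤ := (-1) ^ (p.val * q.val)

theorem koszul_add_left (p q s : ZMod 2) : koszul (p + q) s = koszul p s * koszul q s := by
  revert p q s; decide

theorem koszul_comm (p q : ZMod 2) : koszul p q = koszul q p := by
  revert p q; decide

theorem koszul_sq (p q : ZMod 2) : koszul p q * koszul p q = 1 := by
  revert p q; decide

theorem koszul_zero_left (q : ZMod 2) : koszul 0 q = 1 := by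
  revert q; decide

/-- The exterior `ℂ`-algebra on `r` odd generators. -/
abbrev OddConstants (r : ℕ) : Type := ExteriorAlgebra ℂ (Fin r → ℂ)

/-- The exterior `ℂ`-algebra on `r` odd constants and `n` odd coordinates. -/
abbrev ModelExterior (r n : ℕ) : Type := ExteriorAlgebra ℂ ((Fin r → ℂ) × (Fin n → ℂ))

/-- The part of parity `i` of an exterior algebra. -/
abbrev extParity (V : Type) [AddCommGroup V] [Module ℂ V] (i : ZMod 2) :
    Submodule ℂ (ExteriorAlgebra ℂ V) :=
  CliffordAlgebra.evenOdd (0 : QuadraticForm ℂ V) i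

/-! ### Superspaces and supermanifolds -/

/-- A topological space with a sheaf of supercommutative `ℂ`-superalgebras, over the exterior
algebra of `r` odd constants. -/
structure Superspace (r : ℕ) where
  /-- the underlying space -/
  X : TopCat.{u}
  /-- the structure sheaf -/
  O : TopCat.Sheaf (AlgCat.{u} ℂ) X
  /-- the even (`0`) and odd (`1`) sections -/
  gr : ∀ V : Opens X, ZMod 2 → Submodule ℂ (O.presheaf.obj (op V))
  graded : ∀ V : Opens X, GradedAlgebra (gr V)
  gr_res : ∀ {V W : Opens X} (h : W ≤ V) (i : ZMod 2) (f : O.presheaf.obj (op V)),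
    f ∈ gr V i → (O.presheaf.map (homOfLE h).op).hom f ∈ gr W i
  supercomm : ∀ (V : Opens X) (i j : ZMod 2) (f g : O.presheaf.obj (op V)),
    f ∈ gr V i → g ∈ gr V j → f * g = koszul i j • (g * f)
  /-- the structure map from the constants -/
  const : OddConstants r →ₐ[ℂ] O.presheaf.obj (op ⊤)
  const_gr : ∀ (i : ZMod 2) (c : OddConstants r), c ∈ extParity (Fin r → ℂ) i → const c ∈ gr ⊤ i

namespace Superspace

variable {r : ℕ} (M : Superspace.{u} r)

attribute [instance] Superspace.graded

/-- The superalgebra of functions on an open set. -/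
abbrev Fn (V : Opens M.X) : Type u := M.O.presheaf.obj (op V)

/-- Restriction of functions. -/
def res {V W : Opens M.X} (h : W ≤ V) : M.Fn V →ₐ[ℂ] M.Fn W :=
  (M.O.presheaf.map (homOfLE h).op).hom

/-- A constant, as a function on an open set. -/
def cst (V : Opens M.X) : OddConstants r →ₐ[ℂ] M.Fn V :=
  (M.res (le_top : V ≤ ⊤)).comp M.const

/-- A chart, with even coordinates `coord`, an additional `p` formal even coordinates, and `n` odd
coordinates: an isomorphism of sheaves of superalgebras over the odd constants, from the structure
sheaf over the domain of `coord` to the sheaf of holomorphic functions on an open subset of `ℂ^m`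
tensored (in the completed sense) with `ℂ[[y₁, …, y_p]] ⊗ Λ(θ₁, …, θ_n) ⊗ Λ_r`.  A section of the
latter is a function with values in power series over the exterior algebra, all of whose
coefficients are holomorphic. -/
structure Chart (m p n : ℕ) where
  coord : OpenPartialHomeomorph M.X (Fin m → ℂ)
  /-- the value of a function in the chart -/
  expand : ∀ V : Opens M.X, (V : Set M.X) ⊆ coord.source →
    (M.Fn V →ₐ[ℂ] (V → MvPowerSeries (Fin p) (ModelExterior r n)))
  injective : ∀ (V : Opens M.X) hV, Function.Injective (expand V hV)
  mem_range : ∀ (V : Opens M.X) hV (F : V → MvPowerSeries (Fin p) (ModelExterior r n)),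
    F ∈ Set.range (expand V hV) ↔
      ∀ (d : Fin p →₀ ℕ) (l : Module.Dual ℂ (ModelExterior r n)),
        ∃ g : (Fin m → ℂ) → ℂ, DifferentiableOn ℂ g (coord '' V) ∧
          ∀ x : V, g (coord x) = l (MvPowerSeries.coeff d (F x))
  expand_res : ∀ (V W : Opens M.X) hV hW (h : W ≤ V) (f : M.Fn V) (x : W),
    expand W hW (M.res h f) x = expand V hV f ⟨x, h x.2⟩
  expand_gr : ∀ (V : Opens M.X) hV (i : ZMod 2) (f : M.Fn V), f ∈ M.gr V i → ∀ (x : V) (d : Fin p →₀ ℕ),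
    MvPowerSeries.coeff d (expand V hV f x) ∈ extParity ((Fin r → ℂ) × (Fin n → ℂ)) i
  expand_cst : ∀ (V : Opens M.X) hV (c : OddConstants r) (x : V),
    expand V hV (M.cst V c) x =
      MvPowerSeries.C (ExteriorAlgebra.map (LinearMap.inl ℂ (Fin r → ℂ) (Fin n → ℂ)) c)

end Superspace

/-- A complex supermanifold over the exterior algebra of `r` odd constants, modelled on `m` analytic
even, `p` formal even and `n` odd coordinates.  For `p = 0` this is an analytic supermanifold of
dimension `m|n` (over `ℂ` if also `r = 0`); completions of analytic supermanifolds along embedded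
closed submanifolds of even codimension `p` are of the general form. -/
structure Supermanifold (r m p n : ℕ) extends Superspace.{u} r where
  exists_chart : ∀ x : X, ∃ c : toSuperspace.Chart m p n, x ∈ c.coord.source

namespace Superspace

variable {r : ℕ} (M : Superspace.{u} r)

theorem res_refl (V : Opens M.X) (f : M.Fn V) : M.res (le_refl V) f = f := by
  simp [res]

theorem res_res {U V W : Opens M.X} (h : V ≤ U) (h' : W ≤ V) (f : M.Fn U) :
    M.res h' (M.res h f) = M.res (h'.trans h) f := by
  have : (homOfLE (h'.trans h)).op = (homOfLE h).op ≫ (homOfLE h').op := rfl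
  simp [res, this]

theorem res_gr {V W : Opens M.X} (h : W ≤ V) {i : ZMod 2} {f : M.Fn V} (hf : f ∈ M.gr V i) :
    M.res h f ∈ M.gr W i := M.gr_res h i f hf

/-- The component of parity `i` of a function. -/
def part (V : Opens M.X) (i : ZMod 2) : M.Fn V →ₗ[ℂ] M.Fn V :=
  GradedAlgebra.proj (M.gr V) i

theorem part_mem (V : Opens M.X) (i : ZMod 2) (f : M.Fn V) : M.part V i f ∈ M.gr V i := by
  simp [part, GradedAlgebra.proj_apply]

theorem sum_part (V : Opens M.X) (f : M.Fn V) : ∑ i, M.part V i f = f := by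
  classical
  simp only [part, GradedAlgebra.proj_apply]
  conv_rhs => rw [← DirectSum.sum_support_decompose (M.gr V) f]
  symm
  apply Finset.sum_subset (Finset.subset_univ _)
  intro i _ hi
  simpa using hi

/-! ### Vector fields -/

/-- Families of `ℂ`-linear operators on the functions on the open subsets of `U`. -/
@[ext]
structure Op (U : Opens M.X) : Type u where
  app : ∀ V : Opens M.X, V ≤ U → Module.End ℂ (M.Fn V)

/-- A family of operators, as a point of a product. -/
def Op.equiv (U : Opens M.X) :
    M.Op U ≃ ∀ V : {V : Opens M.X // V ≤ U}, Module.End ℂ (M.Fn V.1) where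
  toFun D V := D.app V.1 V.2
  invFun D := ⟨fun V h => D ⟨V, h⟩⟩

instance (U : Opens M.X) : Ring (M.Op U) := (Op.equiv M U).ring

instance (U : Opens M.X) : Algebra ℂ (M.Op U) := (Op.equiv M U).algebra ℂ

section

variable {M} {U V : Opens M.X} (h : V ≤ U) (f : M.Fn V)

@[simp]
theorem Op.zero_apply : (0 : M.Op U).app V h f = 0 := rfl

@[simp]
theorem Op.add_apply (D E : M.Op U) : (D + E).app V h f = D.app V h f + E.app V h f := rfl

@[simp]
theorem Op.sub_apply (D E : M.Op U) : (D - E).app V h f = D.app V h f - E.app V h f := rfl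

@[simp]
theorem Op.smul_apply (c : ℂ) (D : M.Op U) : (c • D).app V h f = c • D.app V h f := rfl

theorem Op.zsmul_apply (c : ℤ) (D : M.Op U) : (c • D).app V h f = c • D.app V h f := rfl

@[simp]
theorem Op.mul_apply (D E : M.Op U) : (D * E).app V h f = D.app V h (E.app V h f) := rfl

@[simp]
theorem Op.sum_apply (D : ZMod 2 → M.Op U) :
    (∑ k, D k).app V h f = ∑ k, (D k).app V h f := by
  let φ : M.Op U →+ M.Fn V := AddMonoidHom.mk' (fun E => E.app V h f) fun _ _ => rfl
  exact map_sum φ D Finset.univ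

theorem Op.ext_apply {D E : M.Op U} (H : ∀ V h f, D.app V h f = E.app V h f) : D = E :=
  Op.ext (funext fun V => funext fun h => LinearMap.ext (H V h))

end

/-- The superderivations of parity `k` of the structure sheaf over `U` (they commute with
restrictions and annihilate the constants). -/
def Der (U : Opens M.X) (k : ZMod 2) : Submodule ℂ (M.Op U) where
  carrier := {D |
    (∀ (V W : Opens M.X) (hV : V ≤ U) (hW : W ≤ U) (h : W ≤ V) (f : M.Fn V),
      M.res h (D.app V hV f) = D.app W hW (M.res h f)) ∧
    (∀ (V : Opens M.X) (hV : V ≤ U) (c : OddConstants r), D.app V hV (M.cst V c) = 0) ∧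
    (∀ (V : Opens M.X) (hV : V ≤ U) (i : ZMod 2) (f : M.Fn V),
      f ∈ M.gr V i → D.app V hV f ∈ M.gr V (k + i)) ∧
    (∀ (V : Opens M.X) (hV : V ≤ U) (i : ZMod 2) (f g : M.Fn V), f ∈ M.gr V i →
      D.app V hV (f * g) = D.app V hV f * g + koszul k i • (f * D.app V hV g))}
  add_mem' := by
    rintro D E ⟨h1, h2, h3, h4⟩ ⟨k1, k2, k3, k4⟩
    refine ⟨fun V W hV hW h f => ?_, fun V hV c => ?_, fun V hV i f hf => ?_,
      fun V hV i f g hf => ?_⟩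
    · simp [h1 V W hV hW h, k1 V W hV hW h]
    · simp [h2, k2]
    · exact Submodule.add_mem _ (h3 V hV i f hf) (k3 V hV i f hf)
    · simp only [Op.add_apply, h4 V hV i f g hf, k4 V hV i f g hf, add_mul, mul_add, smul_add]
      abel
  zero_mem' := by
    refine ⟨fun V W hV hW h f => ?_, fun V hV c => ?_, fun V hV i f hf => ?_,
      fun V hV i f g hf => ?_⟩ <;> simp
  smul_mem' := by
    rintro c D ⟨h1, h2, h3, h4⟩
    refine ⟨fun V W hV hW h f => ?_, fun V hV c => ?_, fun V hV i f hf => ?_,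
      fun V hV i f g hf => ?_⟩
    · simp [h1 V W hV hW h]
    · simp [h2]
    · exact Submodule.smul_mem _ _ (h3 V hV i f hf)
    · simp only [Op.smul_apply, h4 V hV i f g hf, smul_add, smul_mul_assoc, mul_smul_comm,
        smul_comm c]

/-- Local vector fields, the sections over `U` of the tangent sheaf: sums of an even and an odd
superderivation.  `X.comp k` is the component of parity `k` of `X`. -/
@[ext]
structure VF (U : Opens M.X) : Type u where
  comp : ∀ k : ZMod 2, M.Der U k

/-- A vector field, as a point of a product. -/
def VF.equiv (U : Opens M.X) : M.VF U ≃ ∀ k : ZMod 2, M.Der U k where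
  toFun X := X.comp
  invFun X := ⟨X⟩

instance (U : Opens M.X) : AddCommGroup (M.VF U) := (VF.equiv M U).addCommGroup

section

variable {M} {U : Opens M.X} (X Y : M.VF U) (k : ZMod 2)

@[simp]
theorem VF.zero_comp : (0 : M.VF U).comp k = 0 := rfl

@[simp]
theorem VF.add_comp : (X + Y).comp k = X.comp k + Y.comp k := rfl

@[simp]
theorem VF.zsmul_comp (n : ℤ) : (n • X).comp k = n • X.comp k := rfl

end

variable {M}

/-- A vector field is homogeneous of parity `k`. -/
def IsHomog {U : Opens M.X} (k : ZMod 2) (X : M.VF U) : Prop := ∀ l, l ≠ k → X.comp l = 0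

/-- The action of a vector field on functions. -/
def act {U : Opens M.X} (X : M.VF U) : M.Op U := ∑ k, (X.comp k : M.Op U)

/-- The derivative `X f` of a function on `U`. -/
def dfn {U : Opens M.X} (X : M.VF U) (f : M.Fn U) : M.Fn U := (act X).app U le_rfl f

/-- Restriction of vector fields. -/
def resVF {U V : Opens M.X} (h : V ≤ U) (X : M.VF U) : M.VF V where
  comp k := ⟨⟨fun W hW => (X.comp k).1.app W (hW.trans h)⟩,
    fun W W' hW hW' hh f => (X.comp k).2.1 W W' (hW.trans h) (hW'.trans h) hh f,
    fun W hW c => (X.comp k).2.2.1 W (hW.trans h) c,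
    fun W hW i f hf => (X.comp k).2.2.2.1 W (hW.trans h) i f hf,
    fun W hW i f g hf => (X.comp k).2.2.2.2 W (hW.trans h) i f g hf⟩

/-- Left multiplication by a function. -/
def mulOp {U : Opens M.X} (f : M.Fn U) : M.Op U where
  app _ h := LinearMap.mulLeft ℂ (M.res h f)

@[simp]
theorem mulOp_apply {U V : Opens M.X} (h : V ≤ U) (f : M.Fn U) (g : M.Fn V) :
    (mulOp f).app V h g = M.res h f * g := rfl

theorem mulOp_mem {U : Opens M.X} {i p k : ZMod 2} (h : i + p = k) {f : M.Fn U}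
    (hf : f ∈ M.gr U i) {D : M.Op U} (hD : D ∈ M.Der U p) : mulOp f * D ∈ M.Der U k := by
  subst h
  obtain ⟨h1, h2, h3, h4⟩ := hD
  refine ⟨fun V W hV hW h g => ?_, fun V hV c => ?_, fun V hV j g hg => ?_,
    fun V hV j g g' hg => ?_⟩
  · simp [h1 V W hV hW h, res_res]
  · simp [h2]
  · have := SetLike.mul_mem_graded (M.res_gr hV hf) (h3 V hV j g hg)
    rw [← add_assoc] at this
    exact this
  · simp only [Op.mul_apply, mulOp_apply,
      h4 V hV j g g' hg, mul_add, mul_assoc, mul_smul_comm, koszul_add_left]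
    rw [← mul_assoc (M.res hV f) g, M.supercomm _ i j _ _ (M.res_gr hV hf) hg, smul_mul_assoc,
      smul_smul, mul_assoc, mul_comm (koszul i j)]

/-- The supercommutator of homogeneous operators. -/
def superComm {U : Opens M.X} (p q : ZMod 2) (D E : M.Op U) : M.Op U :=
  D * E - koszul p q • (E * D)

theorem superComm_apply {U V : Opens M.X} (h : V ≤ U) (p q : ZMod 2) (D E : M.Op U)
    (f : M.Fn V) : (superComm p q D E).app V h f =
      D.app V h (E.app V h f) - koszul p q • E.app V h (D.app V h f) := rfl

theorem superComm_mem {U : Opens M.X} {p q k : ZMod 2} (h : p + q = k) {D E : M.Op U}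
    (hD : D ∈ M.Der U p) (hE : E ∈ M.Der U q) : superComm p q D E ∈ M.Der U k := by
  subst h
  obtain ⟨h1, h2, h3, h4⟩ := hD
  obtain ⟨k1, k2, k3, k4⟩ := hE
  refine ⟨fun V W hV hW h g => ?_, fun V hV c => ?_, fun V hV j g hg => ?_,
    fun V hV j f g hf => ?_⟩
  · simp only [superComm_apply, map_sub, map_zsmul, h1 V W hV hW h, k1 V W hV hW h]
  · simp [superComm_apply, h2, k2]
  · have a := h3 V hV _ _ (k3 V hV j g hg)
    have b := k3 V hV _ _ (h3 V hV j g hg)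
    rw [← add_assoc] at a b
    rw [add_comm q p] at b
    exact Submodule.sub_mem _ a (zsmul_mem b _)
  · simp only [superComm_apply, h4 V hV j f g hf, k4 V hV j f g hf, map_add,
      map_zsmul, h4 V hV _ _ g (k3 V hV j f hf), k4 V hV _ _ g (h3 V hV j f hf),
      h4 V hV j f _ hf, k4 V hV j f _ hf]
    have e1 : koszul p (q + j) = koszul p q * koszul p j := by
      rw [koszul_comm, koszul_add_left, koszul_comm q, koszul_comm j]
    have e2 : koszul q (p + j) = koszul p q * koszul q j := by
      rw [koszul_comm, koszul_add_left, koszul_comm j]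
    rw [e1, e2, koszul_add_left]
    simp only [smul_add, smul_smul, sub_mul, mul_sub, smul_sub, smul_mul_assoc, mul_smul_comm,
      ← mul_assoc, koszul_sq, one_mul]
    rw [mul_comm (koszul q j) (koszul p j), mul_right_comm (koszul p j) (koszul q j),
      mul_comm (koszul p j) (koszul p q)]
    abel

/-- The product `f X` of a function and a vector field. -/
def fsmul {U : Opens M.X} (f : M.Fn U) (X : M.VF U) : M.VF U where
  comp k := ⟨∑ i, mulOp (M.part U i f) * (X.comp (k - i) : M.Op U),
    Submodule.sum_mem _ fun i _ => mulOp_mem (by ring) (M.part_mem U i f) (X.comp (k - i)).2⟩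

/-- The Lie superbracket of vector fields. -/
def bracket {U : Opens M.X} (X Y : M.VF U) : M.VF U where
  comp k := ⟨∑ p, superComm p (k - p) (X.comp p) (Y.comp (k - p)),
    Submodule.sum_mem _ fun p _ => superComm_mem (by ring) (X.comp p).2 (Y.comp (k - p)).2⟩

theorem act_apply {U V : Opens M.X} (h : V ≤ U) (X : M.VF U) (f : M.Fn V) :
    (act X).app V h f = ∑ k, (X.comp k).1.app V h f := by
  simp [act]

theorem act_injective {U : Opens M.X} : Function.Injective (act (M := M) (U := U)) := by
  intro X Y h
  apply VF.ext
  funext k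
  apply Subtype.ext
  apply Op.ext_apply
  intro V hV f
  have key : ∀ (i : ZMod 2) (f : M.Fn V), f ∈ M.gr V i →
      (X.comp k).1.app V hV f = (Y.comp k).1.app V hV f := by
    intro i f hf
    have hp : ∀ Z : M.VF U,
        M.part V (k + i) ((act Z).app V hV f) = (Z.comp k).1.app V hV f := by
      intro Z
      rw [act_apply, map_sum, Finset.sum_eq_single k]
      · exact DirectSum.decompose_of_mem_same _ ((Z.comp k).2.2.2.1 V hV i f hf)
      · intro l _ hl
        exact DirectSum.decompose_of_mem_ne _ ((Z.comp l).2.2.2.1 V hV i f hf)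
          (fun e => hl (add_right_cancel e))
      · simp
    rw [← hp X, ← hp Y, h]
  rw [← M.sum_part V f, map_sum, map_sum]
  exact Finset.sum_congr rfl fun i _ => key i _ (M.part_mem _ _ _)

theorem act_add {U : Opens M.X} (X Y : M.VF U) : act (X + Y) = act X + act Y := by
  simp [act, Finset.sum_add_distrib]

theorem act_zsmul {U : Opens M.X} (n : ℤ) (X : M.VF U) : act (n • X) = n • act X := by
  simp only [act, VF.zsmul_comp, Finset.smul_sum]
  rfl

theorem mulOp_add {U : Opens M.X} (f g : M.Fn U) : mulOp (f + g) = mulOp f + mulOp g := by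
  apply Op.ext_apply; intro V hV h; simp [add_mul]

theorem mulOp_mul {U : Opens M.X} (f g : M.Fn U) : mulOp (f * g) = mulOp f * mulOp g := by
  apply Op.ext_apply; intro V hV h; simp [mul_assoc]

theorem act_fsmul {U : Opens M.X} (f : M.Fn U) (X : M.VF U) :
    act (fsmul f X) = mulOp f * act X := by
  have hf : mulOp f = ∑ i, mulOp (M.part U i f) := by
    conv_lhs => rw [← M.sum_part U f]
    let φ : M.Fn U →+ M.Op U := AddMonoidHom.mk' mulOp mulOp_add
    exact map_sum φ _ _
  rw [hf, Finset.sum_mul]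
  simp only [act, fsmul]
  rw [Finset.sum_comm]
  refine Finset.sum_congr rfl fun i _ => ?_
  rw [← Finset.mul_sum]
  congr 1
  exact Fintype.sum_equiv (Equiv.subRight i) _ _ fun k => rfl

theorem fsmul_add {U : Opens M.X} (f : M.Fn U) (X Y : M.VF U) :
    fsmul f (X + Y) = fsmul f X + fsmul f Y := by
  apply act_injective
  simp [act_fsmul, act_add, mul_add]

theorem add_fsmul {U : Opens M.X} (f g : M.Fn U) (X : M.VF U) :
    fsmul (f + g) X = fsmul f X + fsmul g X := by
  apply act_injective
  simp [act_fsmul, act_add, mulOp_add, add_mul]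

theorem mul_fsmul {U : Opens M.X} (f g : M.Fn U) (X : M.VF U) :
    fsmul (f * g) X = fsmul f (fsmul g X) := by
  apply act_injective
  simp [act_fsmul, mulOp_mul, mul_assoc]

theorem fsmul_zsmul {U : Opens M.X} (n : ℤ) (f : M.Fn U) (X : M.VF U) :
    fsmul f (n • X) = n • fsmul f X := by
  apply act_injective
  rw [act_fsmul, act_zsmul, act_zsmul, act_fsmul, mul_smul_comm]

theorem fsmul_isHomog {U : Opens M.X} {i k : ZMod 2} {f : M.Fn U} (hf : f ∈ M.gr U i)
    {X : M.VF U} (hX : IsHomog k X) : IsHomog (i + k) (fsmul f X) := by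
  intro l hl
  apply Subtype.ext
  change ∑ j, mulOp (M.part U j f) * (X.comp (l - j) : M.Op U) = 0
  refine Finset.sum_eq_zero fun j _ => ?_
  by_cases hj : j = i
  · rw [hX (l - j) (fun e => hl (by rw [← e, hj]; ring))]
    simp
  · have : M.part U j f = 0 := DirectSum.decompose_of_mem_ne _ hf (Ne.symm hj)
    rw [this]
    apply Op.ext_apply
    intro V hV g
    simp

theorem act_resVF {U V W : Opens M.X} (h : V ≤ U) (hW : W ≤ V) (X : M.VF U) (f : M.Fn W) :
    (act (resVF h X)).app W hW f = (act X).app W (hW.trans h) f := by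
  rw [act_apply, act_apply]
  rfl

theorem resVF_add {U V : Opens M.X} (h : V ≤ U) (X Y : M.VF U) :
    resVF h (X + Y) = resVF h X + resVF h Y := rfl

theorem resVF_fsmul {U V : Opens M.X} (h : V ≤ U) (f : M.Fn U) (X : M.VF U) :
    resVF h (fsmul f X) = fsmul (M.res h f) (resVF h X) := by
  apply act_injective
  apply Op.ext_apply
  intro W hW g
  rw [act_resVF, act_fsmul, act_fsmul, Op.mul_apply, Op.mul_apply, act_resVF]
  simp [res_res]

theorem res_cst {U V : Opens M.X} (h : V ≤ U) (c : OddConstants r) :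
    M.res h (M.cst U c) = M.cst V c := by
  simp [cst, res_res]

theorem cst_gr (U : Opens M.X) {i : ZMod 2} {c : OddConstants r}
    (hc : c ∈ extParity (Fin r → ℂ) i) : M.cst U c ∈ M.gr U i :=
  M.res_gr _ (M.const_gr i c hc)

theorem even_comm (U : Opens M.X) {g : M.Fn U} (hg : g ∈ M.gr U 0) (f : M.Fn U) :
    g * f = f * g := by
  rw [← M.sum_part U f, Finset.mul_sum, Finset.sum_mul]
  refine Finset.sum_congr rfl fun i _ => ?_
  rw [M.supercomm U 0 i _ _ hg (M.part_mem U i f), koszul_zero_left, one_smul]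

/-! ### Connections and Higgs fields -/

/-- A connection on the tangent sheaf, as the covariant derivative `(X, Y) ↦ ∇_X Y`.  (The
connection is odd as a map from the tangent sheaf to `1`-forms with values in it, so `∇_X` has the
parity of `X`.) -/
structure Connection (M : Superspace.{u} r) where
  nabla : ∀ {U : Opens M.X}, M.VF U → M.VF U → M.VF U
  add_left : ∀ {U : Opens M.X} (X X' Y : M.VF U), nabla (X + X') Y = nabla X Y + nabla X' Y
  add_right : ∀ {U : Opens M.X} (X Y Y' : M.VF U), nabla X (Y + Y') = nabla X Y + nabla X Y'
  fsmul_left : ∀ {U : Opens M.X} (f : M.Fn U) (X Y : M.VF U),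
    nabla (fsmul f X) Y = fsmul f (nabla X Y)
  leibniz : ∀ {U : Opens M.X} (k i : ZMod 2) (X Y : M.VF U) (f : M.Fn U),
    IsHomog k X → f ∈ M.gr U i →
      nabla X (fsmul f Y) = fsmul (dfn X f) Y + koszul k i • fsmul f (nabla X Y)
  homog : ∀ {U : Opens M.X} (k l : ZMod 2) (X Y : M.VF U),
    IsHomog k X → IsHomog l Y → IsHomog (k + l) (nabla X Y)
  nabla_res : ∀ {U V : Opens M.X} (h : V ≤ U) (X Y : M.VF U),
    resVF h (nabla X Y) = nabla (resVF h X) (resVF h Y)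

/-- An odd global `1`-form `A` with values in the endomorphisms of the tangent sheaf, given by its
contractions: `ins X` is the endomorphism `i_X(A)`, which is function-linear in `X` and has the
parity of `X`. -/
structure HiggsField (M : Superspace.{u} r) where
  ins : ∀ {U : Opens M.X}, M.VF U → M.VF U → M.VF U
  add_left : ∀ {U : Opens M.X} (X X' Y : M.VF U), ins (X + X') Y = ins X Y + ins X' Y
  add_right : ∀ {U : Opens M.X} (X Y Y' : M.VF U), ins X (Y + Y') = ins X Y + ins X Y'
  fsmul_left : ∀ {U : Opens M.X} (f : M.Fn U) (X Y : M.VF U),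
    ins (fsmul f X) Y = fsmul f (ins X Y)
  fsmul_right : ∀ {U : Opens M.X} (k i : ZMod 2) (X Y : M.VF U) (f : M.Fn U),
    IsHomog k X → f ∈ M.gr U i → ins X (fsmul f Y) = koszul k i • fsmul f (ins X Y)
  homog : ∀ {U : Opens M.X} (k l : ZMod 2) (X Y : M.VF U),
    IsHomog k X → IsHomog l Y → IsHomog (k + l) (ins X Y)
  ins_res : ∀ {U V : Opens M.X} (h : V ≤ U) (X Y : M.VF U),
    resVF h (ins X Y) = ins (resVF h X) (resVF h Y)

namespace Connection

/-- The connection `∇ + c A`, for an even constant `c`. -/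
def pencil (N : M.Connection) (A : M.HiggsField) (c : OddConstants r)
    (hc : c ∈ extParity (Fin r → ℂ) 0) : M.Connection where
  nabla {U} X Y := N.nabla X Y + fsmul (M.cst U c) (A.ins X Y)
  add_left X X' Y := by
    rw [N.add_left, A.add_left, fsmul_add]; abel
  add_right X Y Y' := by
    rw [N.add_right, A.add_right, fsmul_add]; abel
  fsmul_left {U} f X Y := by
    rw [N.fsmul_left, A.fsmul_left, fsmul_add, ← mul_fsmul, ← mul_fsmul,
      M.even_comm U (M.cst_gr U hc) f]
  leibniz {U} k i X Y f hX hf := by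
    rw [N.leibniz k i X Y f hX hf, A.fsmul_right k i X Y f hX hf, fsmul_zsmul, fsmul_add,
      ← mul_fsmul, ← mul_fsmul, M.even_comm U (M.cst_gr U hc) f, smul_add, add_assoc]
  homog {U} k l X Y hX hY := by
    intro j hj
    have h1 := N.homog k l X Y hX hY j hj
    have h2 := fsmul_isHomog (M.cst_gr U hc) (A.homog k l X Y hX hY) j (by rwa [zero_add])
    rw [VF.add_comp, h1, h2, add_zero]
  nabla_res {U V} h X Y := by
    rw [resVF_add, N.nabla_res, resVF_fsmul, A.ins_res, res_cst]

/-- The torsion of a connection, on vector fields of parities `k` and `l`. -/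
def torsion (N : M.Connection) (k l : ZMod 2) {U : Opens M.X} (X Y : M.VF U) : M.VF U :=
  N.nabla X Y - koszul k l • N.nabla Y X - bracket X Y

/-- The torsion vanishes. -/
def Torsionless (N : M.Connection) : Prop :=
  ∀ (U : Opens M.X) (k l : ZMod 2) (X Y : M.VF U), IsHomog k X → IsHomog l Y →
    N.torsion k l X Y = 0

/-- The value of the curvature form `∇²` on vector fields `X`, `Y` of parities `k` and `l`, applied
to `Z`. -/
def curvature (N : M.Connection) (k l : ZMod 2) {U : Opens M.X} (X Y Z : M.VF U) : M.VF U :=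
  N.nabla X (N.nabla Y Z) - koszul k l • N.nabla Y (N.nabla X Z) - N.nabla (bracket X Y) Z

/-- The curvature vanishes. -/
def Flat (N : M.Connection) : Prop :=
  ∀ (U : Opens M.X) (k l : ZMod 2) (X Y Z : M.VF U), IsHomog k X → IsHomog l Y →
    N.curvature k l X Y Z = 0

/-- A vector field `Y` with `∇ Y = 0`. -/
def FlatField (N : M.Connection) {U : Opens M.X} (Y : M.VF U) : Prop :=
  ∀ (V : Opens M.X) (h : V ≤ U) (X : M.VF V), N.nabla X (resVF h Y) = 0

/-- The linear coefficient `R₁` of the curvature of the pencil `∇ + c A`. -/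
def curvOne (N : M.Connection) (A : M.HiggsField) (k l : ZMod 2) {U : Opens M.X}
    (X Y Z : M.VF U) : M.VF U :=
  (N.nabla X (A.ins Y Z) + A.ins X (N.nabla Y Z))
    - koszul k l • (N.nabla Y (A.ins X Z) + A.ins Y (N.nabla X Z)) - A.ins (bracket X Y) Z

end Connection

namespace HiggsField

/-- The quadratic coefficient `R₂` of the curvature of the pencil `∇ + c A`. -/
def curvTwo (A : M.HiggsField) (k l : ZMod 2) {U : Opens M.X} (X Y Z : M.VF U) : M.VF U :=
  A.ins X (A.ins Y Z) - koszul k l • A.ins Y (A.ins X Z)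

/-- The multiplication `X ∘ Y = i_X(A)(Y)`. -/
def mul (A : M.HiggsField) {U : Opens M.X} (X Y : M.VF U) : M.VF U := A.ins X Y

/-- The multiplication is supercommutative. -/
def Supercommutative (A : M.HiggsField) : Prop :=
  ∀ (U : Opens M.X) (k l : ZMod 2) (X Y : M.VF U), IsHomog k X → IsHomog l Y →
    A.mul X Y = koszul k l • A.mul Y X

/-- The multiplication is associative. -/
def Associative (A : M.HiggsField) : Prop :=
  ∀ (U : Opens M.X) (X Y Z : M.VF U), A.mul (A.mul X Y) Z = A.mul X (A.mul Y Z)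

/-- Every point has a neighbourhood `W` with a vector potential: a vector field `C` on `W` such that
`X ∘ Y = [X, [Y, C]]` for all local flat vector fields on `W`. -/
def HasLocalPotentials (A : M.HiggsField) (N : M.Connection) : Prop :=
  ∀ x : M.X, ∃ (W : Opens M.X) (_ : x ∈ W) (C : M.VF W),
    ∀ (V : Opens M.X) (h : V ≤ W) (X Y : M.VF V), N.FlatField X → N.FlatField Y →
      A.mul X Y = bracket X (bracket Y (resVF h C))

end HiggsField

end Superspace

end

/-! An even constant λ is annihilated by vector fields and commutes with all functions, so it can be
pulled out of every term of the curvature and the torsion of ∇_λ (`curvature_pencil`,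
`torsion_pencil`). The curvature becomes ∇₀² + λ R₁ + λ² R₂ with ∇₀² = 0, and the torsion becomes λ
times the supercommutator of ∘; the value λ = 1 settles (a). For (c), R₂ = 0 says that left
multiplications supercommute, and then (X∘Y)∘Z, Z∘(X∘Y), X∘(Z∘Y), X∘(Y∘Z) agree up to signs whose
product is 1. Conversely, associativity turns R₂(X,Y)Z into the product of the supercommutator of X,
Y with Z.

The content is (b). Since ∇₀ has no torsion, [Y, C] = ∇₀_Y C for flat Y, so a potential is a field C
with X∘Y = ∇₀_X ∇₀_Y C for flat X, Y. Let e_i be a local frame of flat fields. On e_i the operator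
R₁ is the exterior covariant derivative of the 1-form X ↦ X∘e_i. If C exists, this form is the
covariant differential of B_i = ∇₀_{e_i} C, so R₁(X,Y)e_i is the curvature of ∇₀ applied to B_i and
vanishes; R₁ is linear over functions in its last argument (`curvOne_smul`), hence R₁ = 0
(`Chart.IsFrame.curvOne_eq_zero`). If R₁ = 0, the form is closed, and the Poincaré lemma provides
B_i with X∘e_i = ∇₀_X B_i. The 1-form sending e_i to B_i is closed too: the coframe dual to e_i is
closed because there is no torsion, and what remains is symmetric because ∘ is supercommutative. A
second use of the Poincaré lemma provides C (`Chart.IsFrame.exists_potential`).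

What is left is local: flat frames (`Chart.exists_parallel_frame`) and the Poincaré lemma
(`Chart.exists_primitive`) for coordinates of three kinds. Both are proved one coordinate at a time,
preserving what has been achieved for the earlier ones. A frame e is made parallel along z by
passing to Φe, where ∂_z Φ + ΦΓ = 0 up to signs and Γ is the connection matrix; flatness makes Γ,
hence Φ, independent of the coordinates already treated. For odd z one takes Φ = 1 - θΓ, for formal
z a recursion gives a series, and for analytic z the equation is a linear differential equation
solved by Picard iteration. Analytic coordinates come last, so that Γ is then free of formal and odd
variables and the equation lives in a finite dimensional algebra.

Derivations are not assumed to be continuous. That they are determined by their values on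
coordinates, so that coordinate fields form a frame, comes from Hadamard's lemma
(`Chart.der_eq_zero`). -/

noncomputable section

/-! ### Holomorphic functions of several variables -/

section Holomorphic

open Metric Filter Topology

variable {E F : Type*} [NormedAddCommGroup E] [NormedSpace ℂ E] [NormedAddCommGroup F]
  [NormedSpace ℂ F]

/-- Cauchy's estimate for the Fréchet derivative. -/
theorem norm_fderiv_le_div_of_forall_ball {f : E → F} {x : E} {R r C : ℝ} (hr : 0 < r)
    (hrR : r < R) (hf : DifferentiableOn ℂ f (ball x R)) (hC : ∀ y ∈ ball x R, ‖f y‖ ≤ C) :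
    ‖fderiv ℂ f x‖ ≤ C / r := by
  have hR : 0 < R := hr.trans hrR
  have hC0 : 0 ≤ C := (norm_nonneg _).trans (hC x (mem_ball_self hR))
  refine ContinuousLinearMap.opNorm_le_of_unit_norm (𝕜 := ℂ) (div_nonneg hC0 hr.le) ?_
  intro v hv
  -- On the complex line through `x` in a unit direction the claim is the one-variable estimate.
  have hmem : ∀ ζ : ℂ, ‖ζ‖ ≤ r → x + ζ • v ∈ ball x R := by
    intro ζ hζ
    rw [mem_ball, dist_eq_norm, add_sub_cancel_left, norm_smul, hv, mul_one]
    exact hζ.trans_lt hrR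
  have hline : ∀ ζ : ℂ, HasDerivAt (fun ζ : ℂ => x + ζ • v) v ζ := fun ζ => by
    simpa using ((hasDerivAt_id ζ).smul_const v).const_add x
  have hd : ∀ ζ : ℂ, ‖ζ‖ ≤ r →
      HasDerivAt (fun ζ : ℂ => f (x + ζ • v)) (fderiv ℂ f (x + ζ • v) v) ζ := fun ζ hζ =>
    ((hf.differentiableAt (isOpen_ball.mem_nhds (hmem ζ hζ))).hasFDerivAt).comp_hasDerivAt ζ
      (hline ζ)
  have h0 : deriv (fun ζ : ℂ => f (x + ζ • v)) 0 = fderiv ℂ f x v := by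
    simpa using (hd 0 (by simpa using hr.le)).deriv
  rw [← h0]
  refine Complex.norm_deriv_le_of_forall_mem_sphere_norm_le hr ?_ fun ζ hζ => hC _ (hmem ζ ?_)
  · refine DifferentiableOn.diffContOnCl fun ζ hζ => ?_
    refine (hd ζ ?_).differentiableAt.differentiableWithinAt
    rw [closure_ball _ hr.ne', mem_closedBall_zero_iff] at hζ
    exact hζ
  · simpa using (mem_sphere_zero_iff_norm.1 hζ).le

/-- Uniform limits of holomorphic functions are holomorphic, with convergence of the
derivatives. -/
theorem exists_hasFDerivAt_of_tendstoUniformlyOn [CompleteSpace F] {f : ℕ → E → F}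
    {g : E → F} {U : Set E} (hU : IsOpen U) (hf : ∀ n, DifferentiableOn ℂ (f n) U)
    (h : TendstoUniformlyOn f g atTop U) {x : E} (hx : x ∈ U) :
    ∃ g' : E →L[ℂ] F, HasFDerivAt g g' x ∧ Tendsto (fun n => fderiv ℂ (f n) x) atTop (𝓝 g') := by
  obtain ⟨R, hR, hRU⟩ := Metric.isOpen_iff.1 hU x hx
  have hin : ∀ y ∈ ball x (R / 2), ball y (R / 2) ⊆ U := fun y hy z hz => hRU <| by
    rw [mem_ball] at *
    linarith [dist_triangle z y x]
  have hyU : ∀ y ∈ ball x (R / 2), y ∈ U := fun y hy => hin y hy (mem_ball_self (by linarith))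
  -- Cauchy's estimate for differences of members of the sequence: a bound `ε * (R / 4) / 2` for the
  -- values gives `ε / 2` for the derivatives after division by `R / 4`.
  have hcau : UniformCauchySeqOn (fun n => fderiv ℂ (f n)) atTop (ball x (R / 2)) := by
    rw [Metric.uniformCauchySeqOn_iff]
    intro ε hε
    obtain ⟨n₀, hn₀⟩ := Metric.uniformCauchySeqOn_iff.1 h.uniformCauchySeqOn (ε * (R / 4) / 2)
      (by positivity)
    refine ⟨n₀, fun k hk l hl y hy => ?_⟩
    have hdk := (hf k).differentiableAt (hU.mem_nhds (hyU y hy))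
    have hdl := (hf l).differentiableAt (hU.mem_nhds (hyU y hy))
    rw [dist_eq_norm, ← fderiv_sub hdk hdl]
    have := norm_fderiv_le_div_of_forall_ball (f := f k - f l) (x := y) (R := R / 2) (r := R / 4)
      (C := ε * (R / 4) / 2) (by linarith) (by linarith)
      (((hf k).sub (hf l)).mono (hin y hy)) fun z hz => by
        have := hn₀ k hk l hl z (hin y hy hz)
        rw [dist_eq_norm] at this
        exact this.le
    refine this.trans_lt ?_
    rw [div_lt_iff₀ (by linarith)]
    nlinarith [mul_pos hε hR]
  have hlim : ∀ y ∈ ball x (R / 2), ∃ l, Tendsto (fun n => fderiv ℂ (f n) y) atTop (𝓝 l) :=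
    fun y hy => cauchySeq_tendsto_of_complete (hcau.cauchySeq hy)
  choose! G hG using hlim
  refine ⟨G x, ?_, hG x (mem_ball_self (by linarith))⟩
  refine hasFDerivAt_of_tendstoUniformlyOn isOpen_ball
    (hcau.tendstoUniformlyOn_of_tendsto hG)
    (fun n y hy => ((hf n).differentiableAt (hU.mem_nhds (hyU y hy))).hasFDerivAt)
    (fun y hy => h.tendsto_at (hyU y hy)) (mem_ball_self (by linarith))

/-- The first order Taylor estimate for a bounded holomorphic function on a disc. -/
theorem norm_sub_sub_smul_deriv_le {h : ℂ → F} {ρ C : ℝ} (hρ : 0 < ρ)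
    (hd : DifferentiableOn ℂ h (ball 0 (2 * ρ))) (hC : ∀ ζ ∈ ball (0 : ℂ) (2 * ρ), ‖h ζ‖ ≤ C)
    [CompleteSpace F] {ζ : ℂ} (hζ : ζ ∈ ball (0 : ℂ) ρ) :
    ‖h ζ - h 0 - ζ • deriv h 0‖ ≤ C / (ρ / 4) / (ρ / 4) * ‖ζ‖ * ‖ζ‖ := by
  -- Cauchy's estimate at the cost of more than `ρ / 4` in the radius. Two applications, with radii
  -- `2 * ρ`, `3 / 2 * ρ`, `ρ`, bound the second derivative by `K`; two mean value inequalities then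
  -- integrate this bound.
  have key : ∀ (k : ℂ → F) (K a b : ℝ), 0 < a → a + ρ / 4 < b →
      DifferentiableOn ℂ k (ball 0 b) → (∀ ζ ∈ ball (0 : ℂ) b, ‖k ζ‖ ≤ K) →
      ∀ ζ ∈ ball (0 : ℂ) a, ‖deriv k ζ‖ ≤ K / (ρ / 4) := by
    intro k K a b ha hab hk hK ζ hζ
    have hsub : closedBall ζ (ρ / 4) ⊆ ball (0 : ℂ) b := fun z hz => by
      rw [mem_ball] at *
      rw [mem_closedBall] at hz
      linarith [dist_triangle z ζ 0]
    refine Complex.norm_deriv_le_of_forall_mem_sphere_norm_le (by linarith) ?_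
      fun z hz => hK z (hsub (sphere_subset_closedBall hz))
    refine DifferentiableOn.diffContOnCl (hk.mono ?_)
    rwa [closure_ball _ (by linarith)]
  have hd1 : DifferentiableOn ℂ (deriv h) (ball 0 (2 * ρ)) := hd.deriv isOpen_ball
  have b1 := key h C (3 / 2 * ρ) (2 * ρ) (by linarith) (by linarith) hd hC
  have b2 := key (deriv h) _ ρ (3 / 2 * ρ) (by linarith) (by linarith)
    (hd1.mono (ball_subset_ball (by linarith))) b1
  set K := C / (ρ / 4) / (ρ / 4) with hK
  have hK0 : 0 ≤ K := (norm_nonneg _).trans (b2 0 (mem_ball_self hρ))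
  have hat : ∀ z ∈ ball (0 : ℂ) ρ, DifferentiableAt ℂ h z ∧ DifferentiableAt ℂ (deriv h) z :=
    fun z hz =>
      have : z ∈ ball (0 : ℂ) (2 * ρ) := ball_subset_ball (by linarith) hz
      ⟨hd.differentiableAt (isOpen_ball.mem_nhds this),
        hd1.differentiableAt (isOpen_ball.mem_nhds this)⟩
  have hz0 : (0 : ℂ) ∈ ball (0 : ℂ) ρ := mem_ball_self hρ
  have step1 : ∀ z ∈ ball (0 : ℂ) ρ, ‖deriv h z - deriv h 0‖ ≤ K * ‖z‖ := fun z hz => by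
    simpa using (convex_ball (0 : ℂ) ρ).norm_image_sub_le_of_norm_deriv_le
      (fun w hw => (hat w hw).2) b2 hz0 hz
  have hlt : ∀ w : ℂ, ‖w‖ ≤ ‖ζ‖ → w ∈ ball (0 : ℂ) ρ := fun w hw => by
    rw [mem_ball_zero_iff] at *; linarith
  have step2 := (convex_closedBall (0 : ℂ) ‖ζ‖).norm_image_sub_le_of_norm_hasDerivWithin_le
    (f := fun w => h w - w • deriv h 0) (f' := fun w => deriv h w - deriv h 0) (C := K * ‖ζ‖)
    (fun w hw => by
      have h1 := (hasDerivAt_id w).smul_const (deriv h 0)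
      rw [one_smul] at h1
      exact ((hat w (hlt w (mem_closedBall_zero_iff.1 hw))).1.hasDerivAt.sub h1).hasDerivWithinAt)
    (fun w hw => (step1 w (hlt w (mem_closedBall_zero_iff.1 hw))).trans
      (mul_le_mul_of_nonneg_left (mem_closedBall_zero_iff.1 hw) hK0))
    (mem_closedBall_self (norm_nonneg ζ)) (mem_closedBall_zero_iff.2 le_rfl)
  simpa [sub_right_comm] using step2

/-- Directional derivatives of holomorphic functions are holomorphic. -/
theorem differentiableOn_fderiv_apply [CompleteSpace F] {f : E → F} {U : Set E}
    (hf : DifferentiableOn ℂ f U) (hU : IsOpen U) (v : E) :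
    DifferentiableOn ℂ (fun x => fderiv ℂ f x v) U := by
  intro x hx
  obtain ⟨R, hR, hRU⟩ := Metric.isOpen_iff.1 hU x hx
  obtain ⟨R', hR', hC⟩ := Metric.continuousAt_iff.1
    (hf.differentiableAt (hU.mem_nhds hx)).continuousAt 1 one_pos
  set s := min R R' / 2 with hs
  have hs0 : 0 < s := by positivity
  have hsR : 2 * s ≤ R := by rw [hs]; linarith [min_le_left R R']
  have hsR' : 2 * s ≤ R' := by rw [hs]; linarith [min_le_right R R']
  set C := ‖f x‖ + 1
  have hbd : ∀ y ∈ ball x (2 * s), ‖f y‖ ≤ C := fun y hy => by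
    have := (hC (lt_of_lt_of_le (mem_ball.1 hy) hsR')).le
    rw [dist_eq_norm] at this
    calc ‖f y‖ = ‖f x + (f y - f x)‖ := by rw [add_sub_cancel]
      _ ≤ C := (norm_add_le _ _).trans (add_le_add le_rfl this)
  have hsU : ball x (2 * s) ⊆ U := (ball_subset_ball hsR).trans hRU
  -- Small enough that discs of radius `2 * ρ` in the direction `v` around points of `ball x s` stay
  -- in `ball x (2 * s)`, where `f` is bounded; the summand 1 covers `v = 0`.
  set ρ := s / (2 * (‖v‖ + 1)) with hρ
  have hρ0 : 0 < ρ := by positivity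
  have hρv : 2 * ρ * ‖v‖ ≤ s := by
    have h1 : ρ * (2 * (‖v‖ + 1)) = s := by rw [hρ]; field_simp
    nlinarith
  have hmem : ∀ y ∈ ball x s, ∀ ζ ∈ ball (0 : ℂ) (2 * ρ), y + ζ • v ∈ ball x (2 * s) := by
    intro y hy ζ hζ
    rw [mem_ball, dist_eq_norm] at *
    rw [sub_zero] at hζ
    calc ‖y + ζ • v - x‖ = ‖(y - x) + ζ • v‖ := by congr 1; abel
      _ ≤ ‖y - x‖ + ‖ζ‖ * ‖v‖ := (norm_add_le _ _).trans_eq (by rw [norm_smul])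
      _ < 2 * s := by nlinarith [norm_nonneg v]
  have hd : ∀ y ∈ ball x s, ∀ ζ ∈ ball (0 : ℂ) (2 * ρ),
      HasDerivAt (fun ζ : ℂ => f (y + ζ • v)) (fderiv ℂ f (y + ζ • v) v) ζ := fun y hy ζ hζ => by
    have h1 : HasDerivAt (fun ζ : ℂ => y + ζ • v) v ζ := by
      simpa using ((hasDerivAt_id ζ).smul_const v).const_add y
    exact ((hf.differentiableAt (hU.mem_nhds (hsU (hmem y hy ζ hζ)))).hasFDerivAt).comp_hasDerivAt ζ
      h1
  have htay : ∀ y ∈ ball x s, ∀ ζ ∈ ball (0 : ℂ) ρ,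
      ‖f (y + ζ • v) - f y - ζ • fderiv ℂ f y v‖ ≤ C / (ρ / 4) / (ρ / 4) * ‖ζ‖ * ‖ζ‖ := by
    intro y hy ζ hζ
    have h0 : deriv (fun ζ : ℂ => f (y + ζ • v)) 0 = fderiv ℂ f y v := by
      simpa using (hd y hy 0 (mem_ball_self (by linarith))).deriv
    have := norm_sub_sub_smul_deriv_le (h := fun ζ : ℂ => f (y + ζ • v)) hρ0
      (fun ζ hζ => (hd y hy ζ hζ).differentiableAt.differentiableWithinAt)
      (fun ζ hζ => hbd _ (hmem y hy ζ hζ)) hζ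
    simpa [h0] using this
  set K := C / (ρ / 4) / (ρ / 4)
  have hK0 : 0 ≤ K := by positivity
  obtain ⟨n₀, hn₀⟩ := exists_nat_gt (1 / ρ)
  let ζ : ℕ → ℂ := fun n => ((n + n₀ + 1 : ℕ) : ℂ)⁻¹
  have hζn : ∀ n, ‖ζ n‖ = ((n + n₀ + 1 : ℕ) : ℝ)⁻¹ := fun n => by
    simp only [ζ, norm_inv, Complex.norm_natCast]
  have hζ0 : ∀ n, ζ n ≠ 0 := fun n => inv_ne_zero (Nat.cast_ne_zero.2 (Nat.succ_ne_zero _))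
  have hζρ : ∀ n, ζ n ∈ ball (0 : ℂ) ρ := fun n => by
    rw [mem_ball_zero_iff, hζn]
    refine inv_lt_of_inv_lt₀ hρ0 ?_
    rw [← one_div]
    refine hn₀.trans_le ?_
    exact_mod_cast (by omega : n₀ ≤ n + n₀ + 1)
  -- Difference quotients are holomorphic, and by the Taylor estimate they are within `K * ‖ζ n‖` of
  -- the directional derivative, uniformly in `y`. The shift by `n₀` keeps every `ζ n` in the disc
  -- of radius `ρ`.
  let q : ℕ → E → F := fun n y => (ζ n)⁻¹ • (f (y + ζ n • v) - f y)
  have hq : ∀ n, DifferentiableOn ℂ (q n) (ball x s) := fun n y hy => by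
    have h1 : DifferentiableAt ℂ f (y + ζ n • v) := hf.differentiableAt
      (hU.mem_nhds (hsU (hmem y hy _ (ball_subset_ball (by linarith) (hζρ n)))))
    have h2 : DifferentiableAt ℂ f y := hf.differentiableAt
      (hU.mem_nhds (hsU (ball_subset_ball (by linarith) hy)))
    have h3 : DifferentiableAt ℂ (fun y => f (y + ζ n • v)) y :=
      DifferentiableAt.comp y h1 (differentiableAt_id.add_const _)
    exact ((h3.sub h2).const_smul _).differentiableWithinAt
  have hqlim : TendstoUniformlyOn q (fun y => fderiv ℂ f y v) atTop (ball x s) := by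
    rw [Metric.tendstoUniformlyOn_iff]
    intro ε hε
    have hlim : Tendsto (fun n => K * ‖ζ n‖) atTop (𝓝 0) := by
      have h1 : Tendsto (fun n : ℕ => ((n + (n₀ + 1) : ℕ) : ℝ)⁻¹) atTop (𝓝 0) :=
        (tendsto_inv_atTop_nhds_zero_nat (𝕜 := ℝ)).comp (tendsto_add_atTop_nat (n₀ + 1))
      simpa [hζn, add_assoc] using h1.const_mul K
    filter_upwards [hlim.eventually (gt_mem_nhds hε)] with n hn y hy
    refine lt_of_le_of_lt ?_ hn
    rw [dist_comm, dist_eq_norm]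
    have h1 : q n y - fderiv ℂ f y v
        = (ζ n)⁻¹ • (f (y + ζ n • v) - f y - ζ n • fderiv ℂ f y v) := by
      rw [smul_sub _ _ (ζ n • _), smul_smul, inv_mul_cancel₀ (hζ0 n), one_smul]
    rw [h1, norm_smul, norm_inv]
    have := htay y hy (ζ n) (hζρ n)
    rw [inv_mul_le_iff₀ (norm_pos_iff.2 (hζ0 n))]
    linarith
  obtain ⟨g', hg', -⟩ := exists_hasFDerivAt_of_tendstoUniformlyOn isOpen_ball hq hqlim
    (mem_ball_self hs0)
  exact hg'.differentiableAt.differentiableWithinAt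

/-- Holomorphic functions on open subsets of finite dimensional spaces are smooth. -/
theorem contDiffOn_nat_of_differentiableOn [FiniteDimensional ℂ E] [CompleteSpace F] {f : E → F}
    {U : Set E} (hf : DifferentiableOn ℂ f U) (hU : IsOpen U) (n : ℕ) : ContDiffOn ℂ n f U := by
  induction n generalizing f with
  | zero => exact contDiffOn_zero.2 hf.continuousOn
  | succ n ih =>
    rw [Nat.cast_add, Nat.cast_one, contDiffOn_succ_iff_fderiv_of_isOpen hU]
    refine ⟨hf, fun h => by simp at h, ?_⟩
    rw [contDiffOn_clm_apply]
    exact fun v => ih (differentiableOn_fderiv_apply hf hU v)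

end Holomorphic

end

noncomputable section

/-! ### Partial primitives of holomorphic functions on polydiscs -/

section Primitive

open Metric Filter Topology MeasureTheory

variable {m : ℕ} {F : Type*} [NormedAddCommGroup F] [NormedSpace ℂ F]

/-- The partial derivative in the `i`-th coordinate. -/
def pderivC (i : Fin m) (f : (Fin m → ℂ) → F) (z : Fin m → ℂ) : F :=
  fderiv ℂ f z (Pi.single i 1)

theorem pderivC_comm [CompleteSpace F] {f : (Fin m → ℂ) → F} {U : Set (Fin m → ℂ)}
    (hf : DifferentiableOn ℂ f U) (hU : IsOpen U) (i j : Fin m) {z : Fin m → ℂ} (hz : z ∈ U) :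
    pderivC i (pderivC j f) z = pderivC j (pderivC i f) z := by
  have h2 := (contDiffOn_nat_of_differentiableOn hf hU 2).contDiffAt (hU.mem_nhds hz)
  have hs : IsSymmSndFDerivAt ℂ f z := h2.isSymmSndFDerivAt (by simp)
  have hd : DifferentiableAt ℂ (fderiv ℂ f) z :=
    (h2.fderiv_right (m := 1) (by norm_num)).differentiableAt (by norm_num)
  have key : ∀ v w, fderiv ℂ (fun x => fderiv ℂ f x v) z w = fderiv ℂ (fderiv ℂ f) z w v := by
    intro v w
    rw [fderiv_clm_apply hd (differentiableAt_const v)]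
    simp
  change fderiv ℂ (fun x => fderiv ℂ f x _) z _ = fderiv ℂ (fun x => fderiv ℂ f x _) z _
  rw [key, key]
  exact hs _ _

/-- Contraction of the `i`-th coordinate towards the one of `a`. -/
def slide (a : Fin m → ℂ) (i : Fin m) (t : ℝ) (x : Fin m → ℂ) : Fin m → ℂ :=
  x + (((t : ℂ) - 1) * (x i - a i)) • Pi.single i 1

/-- The linear part of `slide`. -/
def slideL (i : Fin m) (t : ℝ) : (Fin m → ℂ) →L[ℂ] (Fin m → ℂ) :=
  ContinuousLinearMap.id ℂ _ +
    ((t : ℂ) - 1) • (ContinuousLinearMap.proj (R := ℂ) (φ := fun _ : Fin m => ℂ) i).smulRight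
      (Pi.single i 1)

theorem slide_apply_same (a : Fin m → ℂ) (i : Fin m) (t : ℝ) (x : Fin m → ℂ) :
    slide a i t x i = a i + t * (x i - a i) := by
  simp [slide]; ring

theorem slide_apply_ne (a : Fin m → ℂ) {i j : Fin m} (h : j ≠ i) (t : ℝ) (x : Fin m → ℂ) :
    slide a i t x j = x j := by
  simp [slide, h]

theorem slide_one (a : Fin m → ℂ) (i : Fin m) (x : Fin m → ℂ) : slide a i 1 x = x := by
  simp [slide]

theorem slide_mem_ball {a : Fin m → ℂ} {R : ℝ} (i : Fin m) {t : ℝ} (ht : t ∈ Set.Icc (0 : ℝ) 1)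
    {x : Fin m → ℂ} (hx : x ∈ ball a R) : slide a i t x ∈ ball a R := by
  have hR : 0 < R := dist_nonneg.trans_lt (mem_ball.1 hx)
  rw [mem_ball, dist_pi_lt_iff hR] at *
  intro j
  by_cases h : j = i
  · subst h
    rw [slide_apply_same, dist_eq_norm, add_sub_cancel_left, norm_mul]
    have h1 : ‖(t : ℂ)‖ ≤ 1 := by
      rw [Complex.norm_real, Real.norm_of_nonneg ht.1]; exact ht.2
    have h2 := hx j
    rw [dist_eq_norm] at h2
    exact (mul_le_of_le_one_left (norm_nonneg _) h1).trans_lt h2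
  · rw [slide_apply_ne a h]
    exact hx j

theorem hasFDerivAt_slide (a : Fin m → ℂ) (i : Fin m) (t : ℝ) (x : Fin m → ℂ) :
    HasFDerivAt (slide a i t) (slideL i t) x := by
  have h1 : HasFDerivAt (fun x : Fin m → ℂ => x i)
      (ContinuousLinearMap.proj (R := ℂ) (φ := fun _ : Fin m => ℂ) i) x :=
    ContinuousLinearMap.hasFDerivAt (ContinuousLinearMap.proj (R := ℂ) (φ := fun _ : Fin m => ℂ) i)
  have h2 := (((h1.sub_const (a i)).const_mul ((t : ℂ) - 1)).smul_const
    (Pi.single i (1 : ℂ) : Fin m → ℂ))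
  have h3 := (hasFDerivAt_id x).add h2
  refine h3.congr_fderiv ?_
  ext v j
  simp [slideL, mul_assoc]

theorem continuous_slide (a : Fin m → ℂ) (i : Fin m) :
    Continuous fun p : ℝ × (Fin m → ℂ) => slide a i p.1 p.2 := by
  unfold slide; fun_prop

theorem continuous_slideL (i : Fin m) : Continuous (slideL (m := m) i) := by
  unfold slideL; fun_prop

/-- The mean of `f` over the segment which contracts the `i`-th coordinate to the one of `a`. -/
def slideMean (a : Fin m → ℂ) (i : Fin m) (f : (Fin m → ℂ) → F) (x : Fin m → ℂ) : F :=
  ∫ t in (0 : ℝ)..1, f (slide a i t x)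

variable {a : Fin m → ℂ} {R : ℝ} {f : (Fin m → ℂ) → F}

theorem slideMean_congr {g : (Fin m → ℂ) → F} (hfg : ∀ x ∈ ball a R, f x = g x) (i : Fin m)
    {x : Fin m → ℂ} (hx : x ∈ ball a R) : slideMean a i f x = slideMean a i g x := by
  refine intervalIntegral.integral_congr fun t ht => ?_
  rw [Set.uIcc_of_le zero_le_one] at ht
  exact hfg _ (slide_mem_ball i ht hx)

/-- The primitive of `f` in the `i`-th coordinate vanishing on the hyperplane through `a`. -/
def slidePrim (a : Fin m → ℂ) (i : Fin m) (f : (Fin m → ℂ) → F) (x : Fin m → ℂ) : F :=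
  (x i - a i) • slideMean a i f x

theorem norm_slidePrim_le {C : ℝ} (hC : ∀ x ∈ ball a R, ‖f x‖ ≤ C) (i : Fin m)
    {x : Fin m → ℂ} (hx : x ∈ ball a R) : ‖slidePrim a i f x‖ ≤ R * C := by
  have hR : 0 < R := dist_nonneg.trans_lt (mem_ball.1 hx)
  have h1 : ‖slideMean a i f x‖ ≤ C := by
    have := intervalIntegral.norm_integral_le_of_norm_le_const (a := 0) (b := 1)
      (f := fun t : ℝ => f (slide a i t x)) (C := C) fun t ht => by
        rw [Set.uIoc_of_le zero_le_one] at ht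
        exact hC _ (slide_mem_ball i (Set.Ioc_subset_Icc_self ht) hx)
    simpa [slideMean] using this
  have h2 : ‖x i - a i‖ ≤ R := by
    have := (dist_pi_lt_iff hR).1 (mem_ball.1 hx) i
    rw [dist_eq_norm] at this
    exact this.le
  rw [slidePrim, norm_smul]
  exact mul_le_mul h2 h1 (norm_nonneg _) hR.le

variable [CompleteSpace F]

theorem continuousOn_comp_slide {G : Type*} [TopologicalSpace G] {g : (Fin m → ℂ) → G}
    (hg : ContinuousOn g (ball a R)) (i : Fin m) :
    ContinuousOn (fun p : ℝ × (Fin m → ℂ) => g (slide a i p.1 p.2))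
      (Set.Icc (0 : ℝ) 1 ×ˢ ball a R) :=
  hg.comp (continuous_slide a i).continuousOn fun _ hp => slide_mem_ball i hp.1 hp.2

theorem continuousOn_slide_path {G : Type*} [TopologicalSpace G] {g : (Fin m → ℂ) → G}
    (hg : ContinuousOn g (ball a R)) (i : Fin m) {x : Fin m → ℂ} (hx : x ∈ ball a R) :
    ContinuousOn (fun t : ℝ => g (slide a i t x)) (Set.Icc 0 1) :=
  hg.comp ((continuous_slide a i).comp (Continuous.prodMk_left x)).continuousOn
    fun _ ht => slide_mem_ball i ht hx

/-- Differentiation under the integral sign: the derivative of the integrand is continuous, hence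
bounded, on the compact product of `[0, 1]` with a closed ball around `x`. -/
theorem hasFDerivAt_slideMean (hf : DifferentiableOn ℂ f (ball a R)) (i : Fin m)
    {x : Fin m → ℂ} (hx : x ∈ ball a R) :
    HasFDerivAt (slideMean a i f)
      (∫ t in (0 : ℝ)..1, (fderiv ℂ f (slide a i t x)).comp (slideL i t)) x := by
  obtain ⟨δ, hδ, hδR⟩ := nhds_basis_closedBall.mem_iff.1 (isOpen_ball.mem_nhds hx)
  have hfc : ContinuousOn (fderiv ℂ f) (ball a R) :=
    (contDiffOn_nat_of_differentiableOn hf isOpen_ball 1).continuousOn_fderiv_of_isOpen isOpen_ball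
      (by norm_num)
  have hIoc : Set.uIoc (0 : ℝ) 1 ⊆ Set.Icc 0 1 := by
    rw [Set.uIoc_of_le zero_le_one]; exact Set.Ioc_subset_Icc_self
  have hc2 : ContinuousOn (fun p : ℝ × (Fin m → ℂ) =>
      (fderiv ℂ f (slide a i p.1 p.2)).comp (slideL i p.1)) (Set.Icc (0 : ℝ) 1 ×ˢ ball a R) :=
    (continuousOn_comp_slide hfc i).clm_comp
      ((continuous_slideL i).comp continuous_fst).continuousOn
  obtain ⟨C, hC⟩ := (isCompact_Icc.prod (isCompact_closedBall x δ)).exists_bound_of_continuousOn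
    (hc2.mono (Set.prod_mono le_rfl hδR))
  refine intervalIntegral.hasFDerivAt_integral_of_dominated_of_fderiv_le (𝕜 := ℂ)
    (F := fun x t => f (slide a i t x))
    (F' := fun x t => (fderiv ℂ f (slide a i t x)).comp (slideL i t))
    (s := closedBall x δ) (bound := fun _ => C)
    (closedBall_mem_nhds x hδ) ?_ ?_ ?_ ?_ ?_ ?_
  · filter_upwards [closedBall_mem_nhds x hδ] with y hy
    exact ((continuousOn_slide_path hf.continuousOn i (hδR hy)).mono hIoc).aestronglyMeasurable
      measurableSet_uIoc
  · refine ContinuousOn.intervalIntegrable ?_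
    rw [Set.uIcc_of_le zero_le_one]
    exact continuousOn_slide_path hf.continuousOn i hx
  · refine ContinuousOn.aestronglyMeasurable ?_ measurableSet_uIoc
    exact (((continuousOn_slide_path hfc i hx).clm_comp (continuous_slideL i).continuousOn)).mono hIoc
  · exact Eventually.of_forall fun t ht y hy => hC (t, y) ⟨hIoc ht, hy⟩
  · simp
  · refine Eventually.of_forall fun t ht y hy => ?_
    have := hf.differentiableAt (isOpen_ball.mem_nhds (slide_mem_ball i (hIoc ht) (hδR hy)))
    exact this.hasFDerivAt.comp y (hasFDerivAt_slide a i t y)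

theorem differentiableOn_slideMean (hf : DifferentiableOn ℂ f (ball a R)) (i : Fin m) :
    DifferentiableOn ℂ (slideMean a i f) (ball a R) := fun _ hx =>
  (hasFDerivAt_slideMean hf i hx).differentiableAt.differentiableWithinAt

theorem fderiv_slideMean_apply (hf : DifferentiableOn ℂ f (ball a R)) (i : Fin m)
    {x : Fin m → ℂ} (hx : x ∈ ball a R) (v : Fin m → ℂ) :
    fderiv ℂ (slideMean a i f) x v =
      ∫ t in (0 : ℝ)..1, fderiv ℂ f (slide a i t x) (slideL i t v) := by
  rw [(hasFDerivAt_slideMean hf i hx).fderiv]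
  refine ContinuousLinearMap.intervalIntegral_apply ?_ v
  refine ContinuousOn.intervalIntegrable ?_
  rw [Set.uIcc_of_le zero_le_one]
  have hfc : ContinuousOn (fderiv ℂ f) (ball a R) :=
    (contDiffOn_nat_of_differentiableOn hf isOpen_ball 1).continuousOn_fderiv_of_isOpen isOpen_ball
      (by norm_num)
  exact (continuousOn_slide_path hfc i hx).clm_comp (continuous_slideL i).continuousOn

theorem differentiableOn_slidePrim (hf : DifferentiableOn ℂ f (ball a R)) (i : Fin m) :
    DifferentiableOn ℂ (slidePrim a i f) (ball a R) :=
  ((differentiable_apply i).sub_const (a i)).differentiableOn.smul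
    (differentiableOn_slideMean hf i)

theorem fderiv_slidePrim (hf : DifferentiableOn ℂ f (ball a R)) (i : Fin m) {x : Fin m → ℂ}
    (hx : x ∈ ball a R) (v : Fin m → ℂ) : fderiv ℂ (slidePrim a i f) x v =
      v i • slideMean a i f x + (x i - a i) • fderiv ℂ (slideMean a i f) x v := by
  have h1 : HasFDerivAt (fun x : Fin m → ℂ => x i - a i)
      (ContinuousLinearMap.proj (R := ℂ) (φ := fun _ : Fin m => ℂ) i) x :=
    HasFDerivAt.sub_const _ (ContinuousLinearMap.hasFDerivAt
      (ContinuousLinearMap.proj (R := ℂ) (φ := fun _ : Fin m => ℂ) i))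
  have h2 := h1.smul ((differentiableOn_slideMean hf i).differentiableAt
    (isOpen_ball.mem_nhds hx)).hasFDerivAt
  have h3 : fderiv ℂ (slidePrim a i f) x = _ := h2.fderiv
  rw [h3]
  simp [add_comm]

/-- The product rule turns the left side into the integral over `[0, 1]` of the `t`-derivative of `t
• f (slide a i t x)`, which is `f x`. -/
theorem pderivC_slidePrim_same (hf : DifferentiableOn ℂ f (ball a R)) (i : Fin m)
    {x : Fin m → ℂ} (hx : x ∈ ball a R) : pderivC i (slidePrim a i f) x = f x := by
  unfold pderivC
  rw [fderiv_slidePrim hf i hx, fderiv_slideMean_apply hf i hx, slideMean]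
  have hfc : ContinuousOn (fderiv ℂ f) (ball a R) :=
    (contDiffOn_nat_of_differentiableOn hf isOpen_ball 1).continuousOn_fderiv_of_isOpen isOpen_ball
      (by norm_num)
  have hpath : ∀ t : ℝ, HasDerivAt (fun t : ℝ => slide a i t x)
      ((x i - a i) • (Pi.single i (1 : ℂ) : Fin m → ℂ)) t := by
    intro t
    have h1 : HasDerivAt (fun t : ℝ => (t : ℂ)) 1 t := Complex.ofRealCLM.hasDerivAt
    have h2 := (((h1.sub_const 1).mul_const (x i - a i)).smul_const
      (Pi.single i (1 : ℂ) : Fin m → ℂ)).const_add x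
    rwa [one_mul] at h2
  have hL : ∀ t : ℝ, slideL i t (Pi.single i (1 : ℂ) : Fin m → ℂ)
      = (t : ℂ) • (Pi.single i (1 : ℂ) : Fin m → ℂ) := by
    intro t
    simp only [slideL, add_apply, ContinuousLinearMap.id_apply,
      smul_apply, ContinuousLinearMap.smulRight_apply,
      ContinuousLinearMap.proj_apply, Pi.single_eq_same, one_smul, sub_smul]
    abel
  have hd : ∀ t ∈ Set.uIcc (0 : ℝ) 1, HasDerivAt (fun t : ℝ => (t : ℂ) • f (slide a i t x))
      ((t : ℂ) • fderiv ℂ f (slide a i t x) ((x i - a i) • (Pi.single i (1 : ℂ) : Fin m → ℂ))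
        + f (slide a i t x)) t := by
    intro t ht
    rw [Set.uIcc_of_le zero_le_one] at ht
    have h1 : HasDerivAt (fun t : ℝ => (t : ℂ)) 1 t := Complex.ofRealCLM.hasDerivAt
    have h2 := ((hf.differentiableAt (isOpen_ball.mem_nhds
      (slide_mem_ball i ht hx))).hasFDerivAt.restrictScalars ℝ).comp_hasDerivAt t (hpath t)
    have h3 := h1.smul h2
    rw [one_smul] at h3
    exact h3
  have hc1 : ContinuousOn (fun t : ℝ => f (slide a i t x)) (Set.uIcc 0 1) := by
    rw [Set.uIcc_of_le zero_le_one]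
    exact continuousOn_slide_path hf.continuousOn i hx
  have hc2 : ContinuousOn (fun t : ℝ => fderiv ℂ f (slide a i t x)) (Set.uIcc 0 1) := by
    rw [Set.uIcc_of_le zero_le_one]
    exact continuousOn_slide_path hfc i hx
  have hc3 : ContinuousOn (fun t : ℝ => (t : ℂ) • fderiv ℂ f (slide a i t x)
      ((x i - a i) • (Pi.single i (1 : ℂ) : Fin m → ℂ))) (Set.uIcc 0 1) :=
    Complex.continuous_ofReal.continuousOn.smul (hc2.clm_apply continuousOn_const)
  have hftc := intervalIntegral.integral_eq_sub_of_hasDerivAt hd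
    ((hc3.add hc1).intervalIntegrable)
  rw [intervalIntegral.integral_add hc3.intervalIntegrable
    hc1.intervalIntegrable] at hftc
  simp only [slide_one, Complex.ofReal_one, one_smul, Complex.ofReal_zero, zero_smul, sub_zero]
    at hftc
  rw [← hftc, Pi.single_eq_same, one_smul, add_comm, ← intervalIntegral.integral_smul]
  congr 1
  refine intervalIntegral.integral_congr fun t _ => ?_
  simp only [hL, map_smul]
  rw [smul_comm]

/-- The linear part of `slide` fixes the other basis vectors. Hence integration in one coordinate
creates no dependence on another. -/
theorem pderivC_slideMean_ne (hf : DifferentiableOn ℂ f (ball a R)) {i j : Fin m} (h : j ≠ i)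
    {x : Fin m → ℂ} (hx : x ∈ ball a R) :
    pderivC j (slideMean a i f) x = slideMean a i (pderivC j f) x := by
  unfold pderivC
  rw [fderiv_slideMean_apply hf i hx, slideMean]
  refine intervalIntegral.integral_congr fun t _ => ?_
  simp [slideL, h]

theorem pderivC_slidePrim_ne (hf : DifferentiableOn ℂ f (ball a R)) {i j : Fin m} (h : j ≠ i)
    {x : Fin m → ℂ} (hx : x ∈ ball a R) :
    pderivC j (slidePrim a i f) x = slidePrim a i (pderivC j f) x := by
  rw [slidePrim, ← pderivC_slideMean_ne hf h hx]
  unfold pderivC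
  rw [fderiv_slidePrim hf i hx]
  simp [h.symm]

end Primitive

end

noncomputable section

/-! ### Linear differential equations in one coordinate -/

section LinearODE

open Metric Filter Topology

variable {m : ℕ} {𝔅 : Type*} [NormedRing 𝔅] [NormedAlgebra ℂ 𝔅]

/-- The terms of the Picard series for `∂ᵢ Φ = - Φ G`. -/
def picardTerm (a : Fin m → ℂ) (i : Fin m) (G : (Fin m → ℂ) → 𝔅) : ℕ → (Fin m → ℂ) → 𝔅
  | 0 => fun _ => 1
  | k + 1 => slidePrim a i fun z => -(picardTerm a i G k z * G z)

variable {a : Fin m → ℂ} {R : ℝ} {G : (Fin m → ℂ) → 𝔅}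

theorem differentiableOn_picardTerm [CompleteSpace 𝔅] (hG : DifferentiableOn ℂ G (ball a R))
    (i : Fin m) (k : ℕ) :
    DifferentiableOn ℂ (picardTerm a i G k) (ball a R) := by
  induction k with
  | zero => exact differentiableOn_const 1
  | succ k ih => exact differentiableOn_slidePrim (ih.mul hG).neg i

theorem pderivC_mul {f g : (Fin m → ℂ) → 𝔅} {z : Fin m → ℂ} (hf : DifferentiableAt ℂ f z)
    (hg : DifferentiableAt ℂ g z) (i : Fin m) :
    pderivC i (fun z => f z * g z) z = pderivC i f z * g z + f z * pderivC i g z := by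
  unfold pderivC
  have : fderiv ℂ (fun z => f z * g z) z = _ := fderiv_mul' hf hg
  rw [this]
  simp [add_comm]

theorem pderivC_neg {F : Type*} [NormedAddCommGroup F] [NormedSpace ℂ F] (f : (Fin m → ℂ) → F)
    (z : Fin m → ℂ) (i : Fin m) : pderivC i (fun z => -f z) z = -pderivC i f z := by
  unfold pderivC
  rw [fderiv_fun_neg]; rfl

theorem pderivC_picardTerm_ne [CompleteSpace 𝔅] (hG : DifferentiableOn ℂ G (ball a R))
    {i j : Fin m} (h : j ≠ i)
    (hj : ∀ z ∈ ball a R, pderivC j G z = 0) (k : ℕ) :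
    ∀ z ∈ ball a R, pderivC j (picardTerm a i G k) z = 0 := by
  induction k with
  | zero => intro z _; simp [pderivC, picardTerm]
  | succ k ih =>
    intro z hz
    have hk := differentiableOn_picardTerm hG i k
    have hkG : DifferentiableOn ℂ (fun z => -(picardTerm a i G k z * G z)) (ball a R) :=
      (hk.mul hG).neg
    rw [picardTerm, pderivC_slidePrim_ne hkG h hz, slidePrim,
      slideMean_congr (g := fun _ => 0) _ i hz]
    · simp [slideMean]
    · intro x hx
      have hx' := isOpen_ball.mem_nhds hx
      rw [pderivC_neg, pderivC_mul (hk.differentiableAt hx') (hG.differentiableAt hx'), ih x hx,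
        hj x hx]
      simp

/-- A geometric bound, without the factorial of the usual Picard estimate; it suffices since the
radius may be shrunk. -/
theorem norm_picardTerm_le {C : ℝ} (hR : 0 < R) (hC : ∀ z ∈ ball a R, ‖G z‖ ≤ C) (i : Fin m)
    (k : ℕ) : ∀ z ∈ ball a R, ‖picardTerm a i G k z‖ ≤ ‖(1 : 𝔅)‖ * (R * C) ^ k := by
  have hC0 : 0 ≤ C := (norm_nonneg _).trans (hC a (mem_ball_self hR))
  induction k with
  | zero => intro z _; simp [picardTerm]
  | succ k ih =>
    intro z hz
    refine (norm_slidePrim_le (C := ‖(1 : 𝔅)‖ * (R * C) ^ k * C) (fun x hx => ?_) i hz).trans_eq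
      (by ring)
    rw [norm_neg]
    exact (norm_mul_le _ _).trans (mul_le_mul (ih x hx) (hC x hx) (norm_nonneg _) (by positivity))

/-- Local solvability of `∂ᵢ Φ = - Φ G` by invertible `Φ`, which depends only on the coordinates
on which `G` depends. -/
theorem exists_linear_ode_solution [CompleteSpace 𝔅] (hR : 0 < R)
    (hG : DifferentiableOn ℂ G (ball a R))
    (i : Fin m) : ∃ R' > 0, R' ≤ R ∧ ∃ Φ Ψ : (Fin m → ℂ) → 𝔅, DifferentiableOn ℂ Φ (ball a R') ∧
      DifferentiableOn ℂ Ψ (ball a R') ∧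
      (∀ z ∈ ball a R', Φ z * Ψ z = 1) ∧ (∀ z ∈ ball a R', Ψ z * Φ z = 1) ∧
      (∀ z ∈ ball a R', pderivC i Φ z = -(Φ z * G z)) ∧
      (∀ j ≠ i, (∀ z ∈ ball a R, pderivC j G z = 0) → ∀ z ∈ ball a R', pderivC j Φ z = 0) := by
  obtain ⟨R₁, hR₁, hb⟩ := Metric.continuousAt_iff.1
    (hG.differentiableAt (ball_mem_nhds a hR)).continuousAt 1 one_pos
  set C := ‖G a‖ + 1 with hCdef
  have hCpos : 0 < C := by positivity
  -- `R₁` keeps `G` bounded by `C`, and `1 / (2 * C)` makes the ratio `S * C` of the geometric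
  -- series at most `1 / 2`.
  set S := min (min R R₁) (1 / (2 * C)) with hS
  have hS0 : 0 < S := by positivity
  have hSR : S ≤ R := (min_le_left _ _).trans (min_le_left _ _)
  have hSR₁ : S ≤ R₁ := (min_le_left _ _).trans (min_le_right _ _)
  have hSC : S * C ≤ 1 / 2 := by
    calc S * C ≤ 1 / (2 * C) * C := mul_le_mul_of_nonneg_right (min_le_right _ _) hCpos.le
      _ = 1 / 2 := by field_simp
  have hsub : ball a S ⊆ ball a R := ball_subset_ball hSR
  have hC : ∀ z ∈ ball a S, ‖G z‖ ≤ C := fun z hz => by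
    have := (hb (lt_of_lt_of_le (mem_ball.1 hz) hSR₁)).le
    rw [dist_eq_norm] at this
    calc ‖G z‖ = ‖G a + (G z - G a)‖ := by rw [add_sub_cancel]
      _ ≤ C := (norm_add_le _ _).trans (add_le_add le_rfl this)
  have hGS := hG.mono hsub
  have hT := norm_picardTerm_le (𝔅 := 𝔅) hS0 hC i
  set u : ℕ → ℝ := fun k => ‖(1 : 𝔅)‖ * (S * C) ^ k
  have hu : Summable u := (summable_geometric_of_lt_one (by positivity) (by linarith)).mul_left _
  set Φ : (Fin m → ℂ) → 𝔅 := fun z => ∑' k, picardTerm a i G k z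
  set f : ℕ → (Fin m → ℂ) → 𝔅 := fun N z => ∑ k ∈ Finset.range N, picardTerm a i G k z
  have hunif : TendstoUniformlyOn f Φ atTop (ball a S) := tendstoUniformlyOn_tsum_nat hu hT
  have hpt := differentiableOn_picardTerm (𝔅 := 𝔅) hGS i
  have hfd : ∀ N, DifferentiableOn ℂ (f N) (ball a S) := fun N =>
    DifferentiableOn.fun_sum fun k _ => hpt k
  have hΦ : ∀ z ∈ ball a S, ∃ g' : (Fin m → ℂ) →L[ℂ] 𝔅, HasFDerivAt Φ g' z ∧
      Tendsto (fun n => fderiv ℂ (f n) z) atTop (𝓝 g') := fun z hz =>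
    exists_hasFDerivAt_of_tendstoUniformlyOn isOpen_ball hfd hunif hz
  have hΦd : DifferentiableOn ℂ Φ (ball a S) := fun z hz => by
    obtain ⟨g', hg', -⟩ := hΦ z hz
    exact hg'.differentiableAt.differentiableWithinAt
  have hlim : ∀ z ∈ ball a S, ∀ j, Tendsto (fun n => pderivC j (f n) z) atTop (𝓝 (pderivC j Φ z)) :=
      fun z hz j => by
    obtain ⟨g', hg', hl⟩ := hΦ z hz
    unfold pderivC
    rw [hg'.fderiv]
    exact ((ContinuousLinearMap.apply ℂ 𝔅 (Pi.single j 1 : Fin m → ℂ)).continuous.tendsto _).comp hl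
  have hsum : ∀ z ∈ ball a S, ∀ j N,
      pderivC j (f N) z = ∑ k ∈ Finset.range N, pderivC j (picardTerm a i G k) z := by
    intro z hz j N
    unfold pderivC
    rw [show fderiv ℂ (f N) z = _ from fderiv_fun_sum fun k _ =>
      (hpt k).differentiableAt (isOpen_ball.mem_nhds hz)]
    simp
  have hode : ∀ z ∈ ball a S, pderivC i Φ z = -(Φ z * G z) := by
    intro z hz
    -- The equation holds for partial sums up to a shift of the index, and passes to the limit
    -- because the derivatives converge as well.
    have h1 : ∀ N, pderivC i (f (N + 1)) z = -(f N z * G z) := by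
      intro N
      rw [hsum z hz, Finset.sum_range_succ']
      have h0 : pderivC i (picardTerm a i G 0) z = 0 := by simp [pderivC, picardTerm]
      rw [h0, add_zero, Finset.sum_mul, ← Finset.sum_neg_distrib]
      refine Finset.sum_congr rfl fun k _ => ?_
      exact pderivC_slidePrim_same ((hpt k).mul hGS).neg i hz
    have h2 := (hlim z hz i).comp (tendsto_add_atTop_nat 1)
    have h3 : Tendsto (fun N => -(f N z * G z)) atTop (𝓝 (-(Φ z * G z))) :=
      ((hunif.tendsto_at hz).mul_const _).neg
    refine tendsto_nhds_unique h2 ?_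
    simpa only [Function.comp_def, h1] using h3
  -- All terms after the first carry the factor `z i - a i`. Since units form an open set, `Φ` is
  -- invertible near `a`.
  have hΦa : Φ a = 1 := by
    have : ∀ k ≠ 0, picardTerm a i G k a = 0 := by
      intro k hk
      obtain ⟨k, rfl⟩ := Nat.exists_eq_succ_of_ne_zero hk
      simp [picardTerm, slidePrim]
    change ∑' k, picardTerm a i G k a = 1
    rw [tsum_eq_single 0 this]
    rfl
  have hunit : ∀ᶠ z in 𝓝 a, IsUnit (Φ z) := by
    have hca : ContinuousAt Φ a := (hΦd.differentiableAt (ball_mem_nhds a hS0)).continuousAt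
    exact hca.eventually (Units.isOpen.mem_nhds (by rw [hΦa]; exact isUnit_one))
  obtain ⟨R₂, hR₂, hun⟩ := Metric.eventually_nhds_iff_ball.1 hunit
  have hs1 : ball a (min S R₂) ⊆ ball a S := ball_subset_ball (min_le_left _ _)
  have hs2 : ball a (min S R₂) ⊆ ball a R₂ := ball_subset_ball (min_le_right _ _)
  refine ⟨min S R₂, lt_min hS0 hR₂, (min_le_left _ _).trans hSR, Φ, fun z => Ring.inverse (Φ z),
    hΦd.mono hs1, ?_, fun z hz => Ring.mul_inverse_cancel _ (hun z (hs2 hz)),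
    fun z hz => Ring.inverse_mul_cancel _ (hun z (hs2 hz)), fun z hz => hode z (hs1 hz), ?_⟩
  · intro z hz
    exact ((hΦd.mono hs1) z hz).inverse (hun z (hs2 hz))
  · intro j hji hj z hz
    refine tendsto_nhds_unique (hlim z (hs1 hz) j) ?_
    have : ∀ n, pderivC j (f n) z = 0 := fun n => by
      rw [hsum z (hs1 hz)]
      exact Finset.sum_eq_zero fun k _ =>
        pderivC_picardTerm_ne hGS hji (fun x hx => hj x (hsub hx)) k z (hs1 hz)
    simp only [this]
    exact tendsto_const_nhds

end LinearODE

end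

noncomputable section

/-! ### Formal power series over an algebra -/

namespace MvPowerSeries

variable {σ Λ : Type*} [Ring Λ]

theorem coeff_X_pow_mul_eq (j : σ) (k : ℕ) (f : MvPowerSeries σ Λ) (d : σ →₀ ℕ) :
    coeff d (X j ^ k * f) = if k ≤ d j then coeff (d - Finsupp.single j k) f else 0 := by
  rw [X_pow_eq, coeff_monomial_mul]
  simp [Finsupp.single_le_iff]

theorem coeff_X_mul_eq (j : σ) (f : MvPowerSeries σ Λ) (d : σ →₀ ℕ) :
    coeff d (X j * f) = if 1 ≤ d j then coeff (d - Finsupp.single j 1) f else 0 := by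
  have := coeff_X_pow_mul_eq j 1 f d
  rwa [pow_one] at this

theorem coeff_add_X_mul (j : σ) (f : MvPowerSeries σ Λ) (d : σ →₀ ℕ) :
    coeff (d + Finsupp.single j 1) (X j * f) = coeff d f := by
  rw [coeff_X_mul_eq]
  simp

theorem X_mul_cancel {j : σ} {f g : MvPowerSeries σ Λ} (h : X j * f = X j * g) : f = g := by
  ext d
  rw [← coeff_add_X_mul j, h, coeff_add_X_mul]

/-- The sum of `X j ^ k * g k` over all `k`. -/
def ysum (j : σ) (g : ℕ → MvPowerSeries σ Λ) : MvPowerSeries σ Λ := fun d =>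
  coeff d (∑ k ∈ Finset.range (d j + 1), X j ^ k * g k)

/-- Terms with `k > d j` do not reach the exponent `d`, so any longer truncation has the same
coefficient. Identities for infinite sums thereby reduce to finite ones. -/
theorem coeff_ysum (j : σ) (g : ℕ → MvPowerSeries σ Λ) {d : σ →₀ ℕ} {K : ℕ} (hK : d j < K) :
    coeff d (ysum j g) = coeff d (∑ k ∈ Finset.range K, X j ^ k * g k) := by
  change coeff d (∑ k ∈ Finset.range (d j + 1), X j ^ k * g k) = _
  rw [map_sum, map_sum]
  refine Finset.sum_subset (Finset.range_subset_range.2 hK) fun k _ hk => ?_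
  rw [coeff_X_pow_mul_eq, if_neg]
  simpa [Nat.lt_succ_iff] using hk

theorem ysum_mul (j : σ) (g : ℕ → MvPowerSeries σ Λ) (h : MvPowerSeries σ Λ) :
    ysum j g * h = ysum j fun k => g k * h := by
  classical
  ext d
  rw [coeff_ysum j _ (Nat.lt_succ_self (d j))]
  simp_rw [← mul_assoc, ← Finset.sum_mul]
  rw [coeff_mul, coeff_mul]
  refine Finset.sum_congr rfl fun q hq => ?_
  rw [coeff_ysum j g (K := d j + 1)]
  have := DFunLike.congr_fun (Finset.HasAntidiagonal.mem_antidiagonal.1 hq) j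
  rw [Finsupp.add_apply] at this
  omega

theorem mul_ysum (j : σ) (g : ℕ → MvPowerSeries σ Λ) (h : MvPowerSeries σ Λ) :
    h * ysum j g = ysum j fun k => h * g k := by
  classical
  ext d
  rw [coeff_ysum j _ (Nat.lt_succ_self (d j))]
  simp_rw [← mul_assoc, X_pow_mul, mul_assoc, ← Finset.mul_sum]
  rw [coeff_mul, coeff_mul]
  refine Finset.sum_congr rfl fun q hq => ?_
  rw [coeff_ysum j g (K := d j + 1)]
  have := DFunLike.congr_fun (Finset.HasAntidiagonal.mem_antidiagonal.1 hq) j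
  rw [Finsupp.add_apply] at this
  omega

theorem ysum_eq (j : σ) (g : ℕ → MvPowerSeries σ Λ) :
    ysum j g = g 0 + X j * ysum j fun k => g (k + 1) := by
  rw [mul_ysum]
  ext d
  rw [map_add, coeff_ysum j _ (show d j < d j + 1 + 1 by omega), coeff_ysum j _ (Nat.lt_succ_self _),
    Finset.sum_range_succ', map_add, add_comm]
  simp [pow_succ, mul_assoc]

variable [Algebra ℂ Λ]

/-- Coefficientwise application of a linear map. -/
def mapCoeff (T : Λ →ₗ[ℂ] Λ) : MvPowerSeries σ Λ →ₗ[ℂ] MvPowerSeries σ Λ where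
  toFun f := fun d => T (coeff d f)
  map_add' f g := by ext d; exact map_add T _ _
  map_smul' c f := by ext d; exact map_smul T c _

@[simp]
theorem coeff_mapCoeff (T : Λ →ₗ[ℂ] Λ) (f : MvPowerSeries σ Λ) (d : σ →₀ ℕ) :
    coeff d (mapCoeff T f) = T (coeff d f) := rfl

/-- The derivative in the variable `j`. -/
def yderiv (j : σ) : MvPowerSeries σ Λ →ₗ[ℂ] MvPowerSeries σ Λ where
  toFun f := fun d => (d j + 1) • coeff (d + Finsupp.single j 1) f
  map_add' f g := by ext d; exact smul_add _ _ _
  map_smul' c f := by ext d; exact smul_comm _ c _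

theorem coeff_yderiv (j : σ) (f : MvPowerSeries σ Λ) (d : σ →₀ ℕ) :
    coeff d (yderiv j f) = (d j + 1) • coeff (d + Finsupp.single j 1) f := rfl

/-- The degree operator in the variable `j`. -/
theorem coeff_X_mul_yderiv (j : σ) (f : MvPowerSeries σ Λ) (d : σ →₀ ℕ) :
    coeff d (X j * yderiv j f) = d j • coeff d f := by
  rw [coeff_X_mul_eq]
  split_ifs with h
  · rw [coeff_yderiv]
    have h1 : d - Finsupp.single j 1 + Finsupp.single j 1 = d :=
      tsub_add_cancel_of_le (by simpa [Finsupp.single_le_iff] using h)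
    rw [h1]
    congr 1
    simp
    omega
  · have : d j = 0 := by omega
    rw [this, zero_smul]

/-- Multiplication by `X j`, which can be cancelled, turns the derivative into the degree operator;
degrees add along the antidiagonal. -/
theorem yderiv_mul (j : σ) (f g : MvPowerSeries σ Λ) :
    yderiv j (f * g) = yderiv j f * g + f * yderiv j g := by
  classical
  apply X_mul_cancel (j := j)
  rw [mul_add, ← mul_assoc, ← mul_assoc, X_mul (φ := f), mul_assoc f]
  ext d
  rw [coeff_X_mul_yderiv, map_add, coeff_mul, coeff_mul, coeff_mul, ← Finset.sum_add_distrib,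
    Finset.smul_sum]
  refine Finset.sum_congr rfl fun q hq => ?_
  rw [coeff_X_mul_yderiv, coeff_X_mul_yderiv, smul_mul_assoc, mul_smul_comm, ← add_smul,
    ← Finset.HasAntidiagonal.mem_antidiagonal.1 hq]
  rfl

theorem yderiv_comm (i j : σ) (f : MvPowerSeries σ Λ) :
    yderiv i (yderiv j f) = yderiv j (yderiv i f) := by
  by_cases h : i = j
  · rw [h]
  · ext d
    simp only [coeff_yderiv]
    rw [smul_smul, smul_smul, add_right_comm, mul_comm]
    simp [h, Ne.symm h]

theorem yderiv_C (j : σ) (a : Λ) : yderiv j (C a) = 0 := by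
  classical
  ext d
  rw [coeff_yderiv, coeff_C, if_neg, smul_zero, coeff_zero]
  intro h
  have := DFunLike.congr_fun h j
  simp at this

theorem yderiv_one (j : σ) : yderiv j (1 : MvPowerSeries σ Λ) = 0 := by
  rw [← map_one (C (R := Λ) (σ := σ)), yderiv_C]

theorem yderiv_X_same (j : σ) : yderiv j (X j : MvPowerSeries σ Λ) = 1 := by
  classical
  ext d
  rw [coeff_yderiv, coeff_X, coeff_one]
  by_cases h : d = 0
  · simp [h]
  · rw [if_neg h, if_neg, smul_zero]
    intro h'
    exact h (by simpa using h')

theorem yderiv_X_ne {i j : σ} (h : i ≠ j) : yderiv i (X j : MvPowerSeries σ Λ) = 0 := by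
  classical
  ext d
  rw [coeff_yderiv, coeff_X, if_neg, smul_zero, coeff_zero]
  intro h'
  have := DFunLike.congr_fun h' i
  simp [h.symm] at this

theorem yderiv_X_pow (j : σ) (k : ℕ) :
    yderiv j ((X j : MvPowerSeries σ Λ) ^ (k + 1)) = (k + 1) • X j ^ k := by
  induction k with
  | zero => simp [yderiv_X_same]
  | succ k ih =>
    rw [pow_succ, yderiv_mul, ih, yderiv_X_same, mul_one, smul_mul_assoc, ← pow_succ,
      ← succ_nsmul]

/-- A series with vanishing derivatives is constant. -/
theorem eq_C_of_yderiv_eq_zero {f : MvPowerSeries σ Λ} (h : ∀ j, yderiv j f = 0) :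
    f = C (coeff 0 f) := by
  classical
  ext d
  rw [coeff_C]
  split_ifs with hd
  · rw [hd]
  · obtain ⟨j, hj⟩ : ∃ j, d j ≠ 0 := by
      by_contra! hc
      exact hd (Finsupp.ext hc)
    have h1 := coeff_X_mul_yderiv j f d
    rw [h j, mul_zero, coeff_zero, ← Nat.cast_smul_eq_nsmul ℂ] at h1
    exact (smul_eq_zero_iff_right (by exact_mod_cast hj)).1 h1.symm

theorem yderiv_ysum_same (j : σ) (g : ℕ → MvPowerSeries σ Λ) :
    yderiv j (ysum j g) = ysum j fun k => yderiv j (g k) + (k + 1) • g (k + 1) := by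
  ext d
  -- The derivative looks at exponent `d j + 1`, so the truncation needs one more term than on the
  -- right-hand side; the superfluous term has no coefficient at `d`.
  have h1 : coeff d (yderiv j (ysum j g)) =
      coeff d (yderiv j (∑ k ∈ Finset.range (d j + 1 + 1), X j ^ k * g k)) := by
    rw [coeff_yderiv, coeff_yderiv, coeff_ysum j g]
    simp
  rw [h1, coeff_ysum j _ (show d j < d j + 1 by omega), map_sum]
  simp_rw [yderiv_mul, mul_add]
  rw [Finset.sum_add_distrib, Finset.sum_add_distrib, map_add, map_add, Finset.sum_range_succ',
    Finset.sum_range_succ (fun k => X j ^ k * yderiv j (g k))]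
  simp_rw [yderiv_X_pow]
  rw [pow_zero, yderiv_one, zero_mul, add_zero, map_add, coeff_X_pow_mul_eq, if_neg (by omega),
    add_zero, add_comm]
  simp_rw [smul_mul_assoc, mul_smul_comm]

theorem yderiv_ysum_ne {i j : σ} (h : i ≠ j) (g : ℕ → MvPowerSeries σ Λ) :
    yderiv i (ysum j g) = ysum j fun k => yderiv i (g k) := by
  have h0 : ∀ k, yderiv i ((X j : MvPowerSeries σ Λ) ^ k) = 0 := by
    intro k
    induction k with
    | zero => rw [pow_zero, yderiv_one]
    | succ k ih => rw [pow_succ, yderiv_mul, ih, yderiv_X_ne h, zero_mul, mul_zero, add_zero]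
  ext d
  rw [coeff_yderiv, coeff_ysum j g (K := d j + 1), ← coeff_yderiv, coeff_ysum j _ (Nat.lt_succ_self _),
    map_sum]
  · simp_rw [yderiv_mul, h0, zero_mul, zero_add]
  · simp [h.symm]

theorem mapCoeff_ysum (T : Λ →ₗ[ℂ] Λ) (j : σ) (g : ℕ → MvPowerSeries σ Λ) :
    mapCoeff T (ysum j g) = ysum j fun k => mapCoeff T (g k) := by
  ext d
  rw [coeff_mapCoeff, coeff_ysum j g (Nat.lt_succ_self _), coeff_ysum j _ (Nat.lt_succ_self _)]
  simp only [map_sum, coeff_X_pow_mul_eq]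
  refine Finset.sum_congr rfl fun k _ => ?_
  split_ifs <;> simp

end MvPowerSeries

/-! ### Exterior algebras: contraction and norm -/

section Exterior

open MvPowerSeries

/-- A norm on a finite dimensional complex algebra. -/
abbrev finiteNormedRing (A : Type*) [Ring A] [Algebra ℂ A] [Module.Finite ℂ A] : NormedRing A :=
  letI : NormedRing (Matrix (Fin (Module.finrank ℂ A)) (Fin (Module.finrank ℂ A)) ℂ) :=
    Matrix.linftyOpNormedRing
  NormedRing.induced A (Matrix (Fin (Module.finrank ℂ A)) (Fin (Module.finrank ℂ A)) ℂ)
    (Algebra.leftMulMatrix (Module.finBasis ℂ A)) (Algebra.leftMulMatrix_injective _)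

/-- The normed algebra structure of a finite dimensional complex algebra. -/
abbrev finiteNormedAlgebra (A : Type*) [Ring A] [Algebra ℂ A] [Module.Finite ℂ A] :
    letI := finiteNormedRing A
    NormedAlgebra ℂ A :=
  letI : NormedRing (Matrix (Fin (Module.finrank ℂ A)) (Fin (Module.finrank ℂ A)) ℂ) :=
    Matrix.linftyOpNormedRing
  letI : NormedAlgebra ℂ (Matrix (Fin (Module.finrank ℂ A)) (Fin (Module.finrank ℂ A)) ℂ) :=
    Matrix.linftyOpNormedAlgebra
  NormedAlgebra.induced ℂ A (Matrix (Fin (Module.finrank ℂ A)) (Fin (Module.finrank ℂ A)) ℂ)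
    (Algebra.leftMulMatrix (Module.finBasis ℂ A))

instance (V : Type) [AddCommGroup V] [Module ℂ V] [Module.Finite ℂ V] :
    Module.Finite ℂ (ExteriorAlgebra ℂ V) :=
  Module.Finite.of_basis (Module.finBasis ℂ V).ExteriorAlgebra

instance (r n : ℕ) : NormedRing (ModelExterior r n) := finiteNormedRing _

instance (r n : ℕ) : NormedAlgebra ℂ (ModelExterior r n) := finiteNormedAlgebra _

instance (r n : ℕ) : CompleteSpace (ModelExterior r n) := FiniteDimensional.complete ℂ _

/-- The odd derivation of the exterior algebra dual to the `k`-th odd coordinate. -/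
def thetaDeriv {r n : ℕ} (k : Fin n) : ModelExterior r n →ₗ[ℂ] ModelExterior r n :=
  CliffordAlgebra.contractLeft
    ((LinearMap.proj k : (Fin n → ℂ) →ₗ[ℂ] ℂ) ∘ₗ LinearMap.snd ℂ (Fin r → ℂ) (Fin n → ℂ))

theorem thetaDeriv_ι_mul {r n : ℕ} (k : Fin n) (v : (Fin r → ℂ) × (Fin n → ℂ))
    (b : ModelExterior r n) : thetaDeriv k (CliffordAlgebra.ι 0 v * b) =
      v.2 k • b - CliffordAlgebra.ι 0 v * thetaDeriv k b :=
  CliffordAlgebra.contractLeft_ι_mul _ v b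

theorem thetaDeriv_ι {r n : ℕ} (k : Fin n) (v : (Fin r → ℂ) × (Fin n → ℂ)) :
    thetaDeriv k (CliffordAlgebra.ι 0 v : ModelExterior r n) = algebraMap ℂ _ (v.2 k) :=
  CliffordAlgebra.contractLeft_ι _ _ v

theorem thetaDeriv_algebraMap {r n : ℕ} (k : Fin n) (c : ℂ) :
    thetaDeriv k (algebraMap ℂ (ModelExterior r n) c) = 0 :=
  CliffordAlgebra.contractLeft_algebraMap _ _ c

theorem zmod_two_cases (i : ZMod 2) : i = 0 ∨ i = 1 := by
  revert i; decide

/-- The sign is the grading involution. With `involute a` in its place the rule makes sense for all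
`a` and follows by induction on products of generators. -/
theorem thetaDeriv_mul {r n : ℕ} (k : Fin n) {i : ZMod 2} {a : ModelExterior r n}
    (ha : a ∈ extParity ((Fin r → ℂ) × (Fin n → ℂ)) i) (b : ModelExterior r n) :
    thetaDeriv k (a * b) = thetaDeriv k a * b + koszul 1 i • (a * thetaDeriv k b) := by
  have key : ∀ a : ModelExterior r n, thetaDeriv k (a * b) =
      thetaDeriv k a * b + CliffordAlgebra.involute a * thetaDeriv k b := by
    intro a
    induction a using CliffordAlgebra.left_induction with
    | algebraMap c =>
      rw [thetaDeriv_algebraMap, zero_mul, zero_add, AlgHom.commutes, ← Algebra.smul_def,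
        ← Algebra.smul_def, map_smul]
    | add x y hx hy => rw [add_mul, map_add, hx, hy, map_add, map_add, add_mul, add_mul]; abel
    | ι_mul x v hx =>
      rw [mul_assoc, thetaDeriv_ι_mul, hx, thetaDeriv_ι_mul, map_mul, CliffordAlgebra.involute_ι]
      simp only [sub_mul, mul_add, smul_mul_assoc, neg_mul, mul_assoc]
      abel
  rw [key]
  congr 1
  obtain rfl | rfl := zmod_two_cases i
  · rw [CliffordAlgebra.involute_eq_of_mem_even ha]
    simp [koszul]
  · rw [CliffordAlgebra.involute_eq_of_mem_odd ha]
    simp [koszul, ZMod.val_one]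

theorem thetaDeriv_mem {r n : ℕ} (k : Fin n) {i : ZMod 2} {a : ModelExterior r n}
    (ha : a ∈ extParity ((Fin r → ℂ) × (Fin n → ℂ)) i) :
    thetaDeriv k a ∈ extParity ((Fin r → ℂ) × (Fin n → ℂ)) (1 + i) := by
  induction a, ha using CliffordAlgebra.evenOdd_induction with
  | range_ι_pow v hv =>
    obtain rfl | rfl := zmod_two_cases i
    · rw [ZMod.val_zero, pow_zero] at hv
      obtain ⟨c, rfl⟩ := Submodule.mem_one.1 hv
      rw [thetaDeriv_algebraMap]
      exact Submodule.zero_mem _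
    · rw [ZMod.val_one, pow_one] at hv
      obtain ⟨v, rfl⟩ := hv
      rw [thetaDeriv_ι]
      exact CliffordAlgebra.one_le_evenOdd_zero (0 : QuadraticForm ℂ _) (Submodule.mem_one.2 ⟨_, rfl⟩)
  | add x y hx hy ihx ihy => rw [map_add]; exact Submodule.add_mem _ ihx ihy
  | ι_mul_ι_mul v w x hx ih =>
    rw [mul_assoc, thetaDeriv_ι_mul, thetaDeriv_ι_mul, mul_sub, mul_smul_comm, ← mul_assoc]
    have hw : ∀ u, CliffordAlgebra.ι (0 : QuadraticForm ℂ ((Fin r → ℂ) × (Fin n → ℂ))) u * x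
        ∈ extParity ((Fin r → ℂ) × (Fin n → ℂ)) (1 + i) := fun u =>
      SetLike.mul_mem_graded (CliffordAlgebra.ι_mem_evenOdd_one _ u) hx
    refine Submodule.sub_mem _ (Submodule.smul_mem _ _ (hw w)) (Submodule.sub_mem _
      (Submodule.smul_mem _ _ (hw v)) ?_)
    have := SetLike.mul_mem_graded (CliffordAlgebra.ι_mul_ι_mem_evenOdd_zero (0 : QuadraticForm ℂ _)
      v w) ih
    rwa [zero_add] at this

theorem thetaDeriv_map_inl {r n : ℕ} (k : Fin n) (c : OddConstants r) :
    thetaDeriv k (ExteriorAlgebra.map (LinearMap.inl ℂ (Fin r → ℂ) (Fin n → ℂ)) c) = 0 := by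
  induction c using CliffordAlgebra.left_induction with
  | algebraMap c => rw [AlgHom.commutes, thetaDeriv_algebraMap]
  | add x y hx hy => rw [map_add, map_add, hx, hy, add_zero]
  | ι_mul x v hx =>
    rw [map_mul]
    have h1 : ExteriorAlgebra.map (LinearMap.inl ℂ (Fin r → ℂ) (Fin n → ℂ))
        (CliffordAlgebra.ι 0 v) = CliffordAlgebra.ι 0 (v, 0) :=
      ExteriorAlgebra.map_apply_ι _ v
    rw [h1, thetaDeriv_ι_mul, hx]
    simp

theorem extParity_disjoint {V : Type} [AddCommGroup V] [Module ℂ V] {i j : ZMod 2} (h : i ≠ j)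
    {a : ExteriorAlgebra ℂ V} (hi : a ∈ extParity V i) (hj : a ∈ extParity V j) : a = 0 := by
  have h1 := DirectSum.decompose_of_mem_same (extParity V) hi
  rw [← h1]
  exact DirectSum.decompose_of_mem_ne (extParity V) hj h.symm

theorem one_mem_extParity (V : Type) [AddCommGroup V] [Module ℂ V] :
    (1 : ExteriorAlgebra ℂ V) ∈ extParity V 0 := SetLike.one_mem_graded (extParity V)

theorem algebraMap_mem_extParity {V : Type} [AddCommGroup V] [Module ℂ V] (c : ℂ) :
    algebraMap ℂ (ExteriorAlgebra ℂ V) c ∈ extParity V 0 := by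
  rw [Algebra.algebraMap_eq_smul_one]
  exact Submodule.smul_mem _ _ (one_mem_extParity V)

/-- Holomorphy can be tested by linear functionals. -/
theorem differentiableOn_iff_dual {E : Type*} [NormedAddCommGroup E] [NormedSpace ℂ E]
    {A : Type*} [NormedAddCommGroup A] [NormedSpace ℂ A] [FiniteDimensional ℂ A] {f : E → A}
    {U : Set E} : DifferentiableOn ℂ f U ↔
      ∀ l : Module.Dual ℂ A, DifferentiableOn ℂ (fun z => l (f z)) U := by
  constructor
  · intro h l
    exact (LinearMap.toContinuousLinearMap l).differentiable.comp_differentiableOn h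
  · intro h
    let e := (Module.finBasis ℂ A).equivFun
    have h1 : DifferentiableOn ℂ (fun z => e (f z)) U := by
      rw [differentiableOn_pi]
      exact fun i => h ((LinearMap.proj i : (Fin _ → ℂ) →ₗ[ℂ] ℂ) ∘ₗ e.toLinearMap)
    have h2 := (LinearMap.toContinuousLinearMap e.symm.toLinearMap).differentiable.comp_differentiableOn h1
    exact h2.congr fun z _ => (e.symm_apply_apply _).symm

end Exterior

end

/-! ### Functions in a chart and their partial derivatives -/

noncomputable section

theorem zmod_two_univ (i : ZMod 2) : (Finset.univ : Finset (ZMod 2)) = {i, i + 1} := by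
  revert i; decide

theorem zmod_two_ne (i : ZMod 2) : i ≠ i + 1 := by
  revert i; decide

section PartialDerivative

open Filter Topology

variable {m : ℕ} {F : Type*} [NormedAddCommGroup F] [NormedSpace ℂ F]

theorem pderivC_congr {f g : (Fin m → ℂ) → F} {U : Set (Fin m → ℂ)} (hU : IsOpen U)
    (h : ∀ z ∈ U, f z = g z) (i : Fin m) {z : Fin m → ℂ} (hz : z ∈ U) :
    pderivC i f z = pderivC i g z := by
  unfold pderivC
  rw [Filter.EventuallyEq.fderiv_eq (eventually_of_mem (hU.mem_nhds hz) h)]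

theorem pderivC_const (c : F) (i : Fin m) (z : Fin m → ℂ) : pderivC i (fun _ => c) z = 0 := by
  simp [pderivC]

theorem pderivC_linear {G : Type*} [NormedAddCommGroup G] [NormedSpace ℂ G]
    [FiniteDimensional ℂ F] (T : F →ₗ[ℂ] G) {f : (Fin m → ℂ) → F} {z : Fin m → ℂ}
    (hf : DifferentiableAt ℂ f z) (i : Fin m) :
    pderivC i (fun w => T (f w)) z = T (pderivC i f z) := by
  have h1 := (LinearMap.toContinuousLinearMap T).hasFDerivAt.comp z hf.hasFDerivAt
  unfold pderivC
  rw [show fderiv ℂ (fun w => T (f w)) z = _ from h1.fderiv]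
  rfl

theorem pderivC_sum {ι : Type*} (s : Finset ι) {f : ι → (Fin m → ℂ) → F} {z : Fin m → ℂ}
    (hf : ∀ k ∈ s, DifferentiableAt ℂ (f k) z) (i : Fin m) :
    pderivC i (fun w => ∑ k ∈ s, f k w) z = ∑ k ∈ s, pderivC i (f k) z := by
  unfold pderivC
  rw [fderiv_fun_sum hf]
  simp

theorem pderivC_add {f g : (Fin m → ℂ) → F} {z : Fin m → ℂ} (hf : DifferentiableAt ℂ f z)
    (hg : DifferentiableAt ℂ g z) (i : Fin m) :
    pderivC i (fun w => f w + g w) z = pderivC i f z + pderivC i g z := by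
  unfold pderivC
  rw [fderiv_fun_add hf hg]; rfl

theorem pderivC_smul (c : ℂ) {f : (Fin m → ℂ) → F} {z : Fin m → ℂ} (hf : DifferentiableAt ℂ f z)
    (i : Fin m) : pderivC i (fun w => c • f w) z = c • pderivC i f z := by
  unfold pderivC
  rw [fderiv_fun_const_smul hf]; rfl

end PartialDerivative

namespace Superspace

/-- Indices of analytic even, formal even and odd coordinates. -/
abbrev CoordIdx (m p n : ℕ) : Type := Fin m ⊕ Fin p ⊕ Fin n

/-- The parity of a coordinate. -/
def cpar {m p n : ℕ} : CoordIdx m p n → ZMod 2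
  | .inl _ => 0
  | .inr (.inl _) => 0
  | .inr (.inr _) => 1

namespace Chart

open MvPowerSeries

variable {r m p n : ℕ} {M : Superspace.{u} r} (c : M.Chart m p n)

/-- The domain of a chart. -/
def dom : Opens M.X := ⟨c.coord.source, c.coord.open_source⟩

variable {V W : Opens M.X} (hV : V ≤ c.dom) (hW : W ≤ c.dom)

include hV in
theorem subset_source : (V : Set M.X) ⊆ c.coord.source := hV

include hV in
theorem isOpen_image : IsOpen (c.coord '' V) := c.coord.isOpen_image_of_subset_source V.2 hV

open Classical in
/-- A function in the coordinates of a chart. -/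
def val (f : M.Fn V) (z : Fin m → ℂ) : MvPowerSeries (Fin p) (ModelExterior r n) :=
  -- Off the image of `V` the value carries no meaning; the statements about it are restricted to
  -- that open image.
  if h : c.coord.symm z ∈ V then c.expand V (c.subset_source hV) f ⟨_, h⟩ else 0

theorem val_coord (f : M.Fn V) (x : V) :
    c.val hV f (c.coord x) = c.expand V (c.subset_source hV) f x := by
  have h1 : c.coord.symm (c.coord x) = x := c.coord.left_inv (hV x.2)
  unfold val
  rw [dif_pos (show c.coord.symm (c.coord x) ∈ V by rw [h1]; exact x.2)]
  exact congrArg _ (Subtype.ext h1)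

theorem ext {f g : M.Fn V} (h : ∀ x : V, c.expand V (c.subset_source hV) f x =
    c.expand V (c.subset_source hV) g x) : f = g :=
  c.injective V _ (funext h)

theorem ext_val {f g : M.Fn V} (h : ∀ z ∈ c.coord '' V, c.val hV f z = c.val hV g z) : f = g :=
  c.ext hV fun x => by rw [← val_coord, ← val_coord]; exact h _ ⟨x, x.2, rfl⟩

theorem differentiableOn_coeff_val (f : M.Fn V) (d : Fin p →₀ ℕ) :
    DifferentiableOn ℂ (fun z => coeff d (c.val hV f z)) (c.coord '' V) := by
  rw [differentiableOn_iff_dual]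
  intro l
  obtain ⟨g, hg, hgl⟩ := (c.mem_range V (c.subset_source hV)
    (c.expand V (c.subset_source hV) f)).1 ⟨f, rfl⟩ d l
  refine hg.congr ?_
  rintro _ ⟨x, hx, rfl⟩
  exact (by rw [hgl ⟨x, hx⟩, ← val_coord])

theorem differentiableAt_coeff_val (f : M.Fn V) (d : Fin p →₀ ℕ) {z : Fin m → ℂ}
    (hz : z ∈ c.coord '' V) : DifferentiableAt ℂ (fun z => coeff d (c.val hV f z)) z :=
  (c.differentiableOn_coeff_val hV f d).differentiableAt ((c.isOpen_image hV).mem_nhds hz)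

theorem exists_val_eq (F : (Fin m → ℂ) → MvPowerSeries (Fin p) (ModelExterior r n))
    (hF : ∀ d, DifferentiableOn ℂ (fun z => coeff d (F z)) (c.coord '' V)) :
    ∃ f : M.Fn V, ∀ z ∈ c.coord '' V, c.val hV f z = F z := by
  have h1 : (fun x : V => F (c.coord x)) ∈ Set.range (c.expand V (c.subset_source hV)) := by
    rw [c.mem_range V (c.subset_source hV)]
    intro d l
    exact ⟨fun z => l (coeff d (F z)), differentiableOn_iff_dual.1 (hF d) l, fun x => rfl⟩
  obtain ⟨f, hf⟩ := h1
  refine ⟨f, ?_⟩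
  rintro _ ⟨x, hx, rfl⟩
  rw [c.val_coord hV f ⟨x, hx⟩, hf]

/-- The function with given coordinate expression. -/
def ofVal (F : (Fin m → ℂ) → MvPowerSeries (Fin p) (ModelExterior r n))
    (hF : ∀ d, DifferentiableOn ℂ (fun z => coeff d (F z)) (c.coord '' V)) : M.Fn V :=
  (c.exists_val_eq hV F hF).choose

theorem val_ofVal {F : (Fin m → ℂ) → MvPowerSeries (Fin p) (ModelExterior r n)}
    (hF : ∀ d, DifferentiableOn ℂ (fun z => coeff d (F z)) (c.coord '' V)) {z : Fin m → ℂ}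
    (hz : z ∈ c.coord '' V) : c.val hV (c.ofVal hV F hF) z = F z :=
  (c.exists_val_eq hV F hF).choose_spec z hz

section

variable {z : Fin m → ℂ} (hz : z ∈ c.coord '' V)

include hz

theorem val_add (f g : M.Fn V) : c.val hV (f + g) z = c.val hV f z + c.val hV g z := by
  obtain ⟨x, hx, rfl⟩ := hz
  simp only [c.val_coord hV _ ⟨x, hx⟩, map_add, Pi.add_apply]

theorem val_mul (f g : M.Fn V) : c.val hV (f * g) z = c.val hV f z * c.val hV g z := by
  obtain ⟨x, hx, rfl⟩ := hz
  simp only [c.val_coord hV _ ⟨x, hx⟩, map_mul, Pi.mul_apply]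

theorem val_smul (a : ℂ) (f : M.Fn V) : c.val hV (a • f) z = a • c.val hV f z := by
  obtain ⟨x, hx, rfl⟩ := hz
  simp only [c.val_coord hV _ ⟨x, hx⟩, map_smul, Pi.smul_apply]

theorem val_zero : c.val hV (0 : M.Fn V) z = 0 := by
  obtain ⟨x, hx, rfl⟩ := hz
  simp only [c.val_coord hV _ ⟨x, hx⟩, map_zero, Pi.zero_apply]

theorem val_one : c.val hV (1 : M.Fn V) z = 1 := by
  obtain ⟨x, hx, rfl⟩ := hz
  simp only [c.val_coord hV _ ⟨x, hx⟩, map_one, Pi.one_apply]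

theorem val_zsmul (a : ℤ) (f : M.Fn V) : c.val hV (a • f) z = a • c.val hV f z := by
  obtain ⟨x, hx, rfl⟩ := hz
  simp only [c.val_coord hV _ ⟨x, hx⟩, map_zsmul, Pi.smul_apply]

theorem val_cst (a : OddConstants r) : c.val hV (M.cst V a) z =
    C (ExteriorAlgebra.map (LinearMap.inl ℂ (Fin r → ℂ) (Fin n → ℂ)) a) := by
  obtain ⟨x, hx, rfl⟩ := hz
  rw [c.val_coord hV _ ⟨x, hx⟩, c.expand_cst]

end

theorem val_res (h : W ≤ V) (f : M.Fn V) {z : Fin m → ℂ} (hz : z ∈ c.coord '' W) :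
    c.val hW (M.res h f) z = c.val hV f z := by
  obtain ⟨x, hx, rfl⟩ := hz
  rw [c.val_coord hW _ ⟨x, hx⟩, c.expand_res V W (c.subset_source hV) (c.subset_source hW) h,
    ← val_coord]

/-- Charts are only required to respect parity in one direction. For the converse, the component of
`f` of the wrong parity has coefficients of both parities, so they vanish, and expansion is
injective. -/
theorem mem_gr_iff {i : ZMod 2} {f : M.Fn V} : f ∈ M.gr V i ↔ ∀ z ∈ c.coord '' V, ∀ d,
    coeff d (c.val hV f z) ∈ extParity ((Fin r → ℂ) × (Fin n → ℂ)) i := by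
  constructor
  · rintro hf _ ⟨x, hx, rfl⟩ d
    rw [c.val_coord hV _ ⟨x, hx⟩]
    exact c.expand_gr V (c.subset_source hV) i f hf _ d
  · intro h
    have hz : M.part V (i + 1) f = 0 := by
      refine c.ext_val hV fun z hz => ?_
      rw [c.val_zero hV hz]
      ext d : 1
      rw [coeff_zero]
      have hmem : ∀ j, coeff d (c.val hV (M.part V j f) z) ∈
          extParity ((Fin r → ℂ) × (Fin n → ℂ)) j := by
        intro j
        obtain ⟨x, hx, rfl⟩ := hz
        rw [c.val_coord hV _ ⟨x, hx⟩]
        exact c.expand_gr V (c.subset_source hV) j _ (M.part_mem V j f) _ d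
      have hne : i + 1 ≠ i := (zmod_two_ne i).symm
      refine extParity_disjoint hne (hmem _) ?_
      have hsum : f = M.part V i f + M.part V (i + 1) f := by
        conv_lhs => rw [← M.sum_part V f]
        rw [show (Finset.univ : Finset (ZMod 2)) = {i, i + 1} from zmod_two_univ i,
          Finset.sum_pair hne.symm]
      have h2 := h z hz d
      rw [hsum, c.val_add hV hz, map_add] at h2
      exact (Submodule.add_mem_iff_right _ (hmem i)).1 h2
    have hsum : f = M.part V i f := by
      conv_lhs => rw [← M.sum_part V f]
      rw [show (Finset.univ : Finset (ZMod 2)) = {i, i + 1} from zmod_two_univ i,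
        Finset.sum_pair (zmod_two_ne i), hz, add_zero]
    rw [hsum]
    exact M.part_mem V i f

/-- Partial derivatives in the model. -/
def pdVal : CoordIdx m p n → ((Fin m → ℂ) → MvPowerSeries (Fin p) (ModelExterior r n)) →
    (Fin m → ℂ) → MvPowerSeries (Fin p) (ModelExterior r n)
  | .inl i, F => fun z d => pderivC i (fun w => coeff d (F w)) z
  | .inr (.inl j), F => fun z => yderiv j (F z)
  | .inr (.inr k), F => fun z => mapCoeff (thetaDeriv k) (F z)

theorem coeff_pdVal_inl (i : Fin m)
    (F : (Fin m → ℂ) → MvPowerSeries (Fin p) (ModelExterior r n)) (z : Fin m → ℂ)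
    (d : Fin p →₀ ℕ) : coeff d (pdVal (.inl i : CoordIdx m p n) F z) =
      pderivC i (fun w => coeff d (F w)) z := rfl

theorem differentiableOn_pdVal (a : CoordIdx m p n)
    {F : (Fin m → ℂ) → MvPowerSeries (Fin p) (ModelExterior r n)} {U : Set (Fin m → ℂ)}
    (hU : IsOpen U) (hF : ∀ d, DifferentiableOn ℂ (fun z => coeff d (F z)) U) (d : Fin p →₀ ℕ) :
    DifferentiableOn ℂ (fun z => coeff d (pdVal a F z)) U := by
  match a with
  | .inl i => exact differentiableOn_fderiv_apply (hF d) hU _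
  | .inr (.inl j) =>
    simp only [pdVal, coeff_yderiv]
    exact (hF _).const_smul _
  | .inr (.inr k) =>
    exact (LinearMap.toContinuousLinearMap (thetaDeriv k)).differentiable.comp_differentiableOn
      (hF d)

theorem pdVal_congr (a : CoordIdx m p n)
    {F G : (Fin m → ℂ) → MvPowerSeries (Fin p) (ModelExterior r n)} {U : Set (Fin m → ℂ)}
    (hU : IsOpen U) (h : ∀ z ∈ U, F z = G z) {z : Fin m → ℂ} (hz : z ∈ U) :
    pdVal a F z = pdVal a G z := by
  match a with
  | .inl i =>
    ext d : 1
    rw [coeff_pdVal_inl, coeff_pdVal_inl]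
    exact pderivC_congr hU (fun w hw => by rw [h w hw]) i hz
  | .inr (.inl j) => simp only [pdVal, h z hz]
  | .inr (.inr k) => simp only [pdVal, h z hz]

/-- Partial derivatives of functions on the domain of a chart. -/
def pd (a : CoordIdx m p n) (f : M.Fn V) : M.Fn V :=
  c.ofVal hV (pdVal a (c.val hV f))
    (differentiableOn_pdVal a (c.isOpen_image hV) (c.differentiableOn_coeff_val hV f))

theorem val_pd (a : CoordIdx m p n) (f : M.Fn V) {z : Fin m → ℂ} (hz : z ∈ c.coord '' V) :
    c.val hV (c.pd hV a f) z = pdVal a (c.val hV f) z := c.val_ofVal hV _ hz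

theorem pd_add (a : CoordIdx m p n) (f g : M.Fn V) :
    c.pd hV a (f + g) = c.pd hV a f + c.pd hV a g := by
  refine c.ext_val hV fun z hz => ?_
  have hU := c.isOpen_image hV
  rw [val_pd _ _ _ _ hz, val_add _ _ hz, val_pd _ _ _ _ hz, val_pd _ _ _ _ hz,
    pdVal_congr a hU (fun w hw => c.val_add hV hw f g) hz]
  match a with
  | .inl i =>
    ext d : 1
    simp only [map_add, coeff_pdVal_inl]
    exact pderivC_add (c.differentiableAt_coeff_val hV f d hz)
      (c.differentiableAt_coeff_val hV g d hz) i
  | .inr (.inl j) => simp only [pdVal, map_add]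
  | .inr (.inr k) => simp only [pdVal, map_add]

theorem pd_smul (a : CoordIdx m p n) (b : ℂ) (f : M.Fn V) :
    c.pd hV a (b • f) = b • c.pd hV a f := by
  refine c.ext_val hV fun z hz => ?_
  have hU := c.isOpen_image hV
  rw [val_pd _ _ _ _ hz, val_smul _ _ hz, val_pd _ _ _ _ hz,
    pdVal_congr a hU (fun w hw => c.val_smul hV hw b f) hz]
  match a with
  | .inl i =>
    ext d : 1
    exact pderivC_smul b (c.differentiableAt_coeff_val hV f d hz) i
  | .inr (.inl j) => simp only [pdVal, map_smul]
  | .inr (.inr k) => simp only [pdVal, map_smul]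

theorem pd_res (a : CoordIdx m p n) (h : W ≤ V) (f : M.Fn V) :
    M.res h (c.pd hV a f) = c.pd hW a (M.res h f) := by
  refine c.ext_val hW fun z hz => ?_
  rw [c.val_res hV hW h _ hz, val_pd _ _ _ _ hz, val_pd _ _ _ _ (Set.image_mono h hz)]
  exact (pdVal_congr a (c.isOpen_image hW) (fun w hw => c.val_res hV hW h f hw) hz).symm

theorem mapCoeff_C (T : ModelExterior r n →ₗ[ℂ] ModelExterior r n) (a : ModelExterior r n) :
    mapCoeff T (C a : MvPowerSeries (Fin p) (ModelExterior r n)) = C (T a) := by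
  ext d
  rw [coeff_mapCoeff, coeff_C, coeff_C]
  split_ifs <;> simp

theorem pd_eq_of_val_const (a : CoordIdx m p n) {f : M.Fn V} {b : ModelExterior r n}
    (hf : ∀ z ∈ c.coord '' V, c.val hV f z = C b) {z : Fin m → ℂ} (hz : z ∈ c.coord '' V) :
    c.val hV (c.pd hV a f) z = match a with
      | .inl _ => 0
      | .inr (.inl _) => 0
      | .inr (.inr k) => C (thetaDeriv k b) := by
  rw [val_pd _ _ _ _ hz, pdVal_congr a (c.isOpen_image hV) hf hz]
  match a with
  | .inl i =>
    ext d : 1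
    rw [coeff_pdVal_inl, pderivC_const, coeff_zero]
  | .inr (.inl j) => exact yderiv_C j b
  | .inr (.inr k) => exact mapCoeff_C _ b

theorem pd_cst (a : CoordIdx m p n) (b : OddConstants r) : c.pd hV a (M.cst V b) = 0 := by
  refine c.ext_val hV fun z hz => ?_
  rw [c.pd_eq_of_val_const hV a (fun z hz => c.val_cst hV hz b) hz, val_zero _ _ hz]
  match a with
  | .inl i => rfl
  | .inr (.inl j) => rfl
  | .inr (.inr k) => simp only [thetaDeriv_map_inl, map_zero]

theorem pd_mem (a : CoordIdx m p n) {i : ZMod 2} {f : M.Fn V} (hf : f ∈ M.gr V i) :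
    c.pd hV a f ∈ M.gr V (cpar a + i) := by
  rw [c.mem_gr_iff hV] at *
  intro z hz d
  rw [val_pd _ _ _ _ hz]
  match a with
  | .inl j =>
    rw [coeff_pdVal_inl]
    -- The coefficients are fixed by the projection `P` to parity `i`, and `P`, being linear,
    -- commutes with the derivative.
    let P : ModelExterior r n →ₗ[ℂ] ModelExterior r n :=
      GradedAlgebra.proj (extParity ((Fin r → ℂ) × (Fin n → ℂ))) i
    have h1 : ∀ w ∈ c.coord '' V, coeff d (c.val hV f w) = P (coeff d (c.val hV f w)) :=
      fun w hw => (DirectSum.decompose_of_mem_same _ (hf w hw d)).symm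
    rw [pderivC_congr (c.isOpen_image hV) h1 j hz,
      pderivC_linear P (c.differentiableAt_coeff_val hV f d hz)]
    change _ ∈ extParity ((Fin r → ℂ) × (Fin n → ℂ)) (0 + i)
    rw [zero_add]
    exact SetLike.coe_mem _
  | .inr (.inl j) =>
    change _ ∈ extParity ((Fin r → ℂ) × (Fin n → ℂ)) (0 + i)
    rw [zero_add]
    exact nsmul_mem (hf z hz _) _
  | .inr (.inr k) => exact thetaDeriv_mem k (hf z hz d)

theorem pd_mul (a : CoordIdx m p n) {i : ZMod 2} {f : M.Fn V} (hf : f ∈ M.gr V i) (g : M.Fn V) :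
    c.pd hV a (f * g) = c.pd hV a f * g + koszul (cpar a) i • (f * c.pd hV a g) := by
  classical
  rw [c.mem_gr_iff hV] at hf
  refine c.ext_val hV fun z hz => ?_
  rw [val_add _ _ hz, val_zsmul _ _ hz, val_mul _ _ hz, val_mul _ _ hz, val_pd _ _ _ _ hz,
    val_pd _ _ _ _ hz, val_pd _ _ _ _ hz,
    pdVal_congr a (c.isOpen_image hV) (fun w hw => c.val_mul hV hw f g) hz]
  match a with
  | .inl j =>
    rw [show koszul (cpar (.inl j : CoordIdx m p n)) i = 1 from koszul_zero_left i, one_smul]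
    ext d : 1
    rw [map_add, coeff_pdVal_inl, coeff_mul, coeff_mul, ← Finset.sum_add_distrib]
    have h1 : ∀ d, DifferentiableAt ℂ (fun z => coeff d (c.val hV f z)) z :=
      fun d => c.differentiableAt_coeff_val hV f d hz
    have h2 : ∀ d, DifferentiableAt ℂ (fun z => coeff d (c.val hV g z)) z :=
      fun d => c.differentiableAt_coeff_val hV g d hz
    simp only [coeff_mul]
    rw [pderivC_sum _ fun q _ => (h1 q.1).mul (h2 q.2)]
    refine Finset.sum_congr rfl fun q _ => ?_
    rw [pderivC_mul (h1 q.1) (h2 q.2)]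
    rfl
  | .inr (.inl j) =>
    rw [show koszul (cpar (.inr (.inl j) : CoordIdx m p n)) i = 1 from koszul_zero_left i, one_smul]
    exact yderiv_mul j _ _
  | .inr (.inr k) =>
    ext d : 1
    simp only [pdVal]
    rw [map_add, map_zsmul, coeff_mapCoeff, coeff_mul, coeff_mul, coeff_mul, map_sum,
      Finset.smul_sum, ← Finset.sum_add_distrib]
    refine Finset.sum_congr rfl fun q _ => ?_
    rw [thetaDeriv_mul k (hf z hz q.1)]
    rfl

end Chart

end Superspace

end

/-! ### Coordinate functions, coordinate fields and constants in a chart -/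

noncomputable section

namespace Superspace

variable {r : ℕ} {M : Superspace.{u} r}

/-- A homogeneous derivation as a vector field. -/
def VF.ofDer {U : Opens M.X} (k : ZMod 2) {D : M.Op U} (hD : D ∈ M.Der U k) : M.VF U where
  comp l := ⟨if l = k then D else 0, by
    split_ifs with h
    · rw [h]; exact hD
    · exact Submodule.zero_mem _⟩

theorem isHomog_ofDer {U : Opens M.X} {k : ZMod 2} {D : M.Op U} (hD : D ∈ M.Der U k) :
    IsHomog k (VF.ofDer k hD) := fun _ hl => Subtype.ext (if_neg hl)

theorem act_ofDer {U : Opens M.X} {k : ZMod 2} {D : M.Op U} (hD : D ∈ M.Der U k) :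
    act (VF.ofDer k hD) = D := by
  simp [act, VF.ofDer]

namespace Chart

open MvPowerSeries Metric

variable {m p n : ℕ} (c : M.Chart m p n) {V W : Opens M.X} (hV : V ≤ c.dom) (hW : W ≤ c.dom)

/-- A partial derivative as an operator. -/
def pdOp (a : CoordIdx m p n) : M.Op c.dom where
  app _ h :=
    { toFun := c.pd h a
      map_add' := c.pd_add h a
      map_smul' := c.pd_smul h a }

theorem pdOp_mem (a : CoordIdx m p n) : c.pdOp a ∈ M.Der c.dom (cpar a) :=
  ⟨fun _ _ hV hW h f => c.pd_res hV hW a h f, fun _ hV b => c.pd_cst hV a b,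
    fun _ hV _ _ hf => c.pd_mem hV a hf, fun _ hV _ _ g hf => c.pd_mul hV a hf g⟩

/-- The coordinate vector fields. -/
def partialVF (a : CoordIdx m p n) : M.VF V := resVF hV (VF.ofDer (cpar a) (c.pdOp_mem a))

theorem isHomog_partialVF (a : CoordIdx m p n) : IsHomog (cpar a) (c.partialVF hV a) := by
  intro l hl
  have h := isHomog_ofDer (c.pdOp_mem a) l hl
  apply Subtype.ext
  apply Op.ext_apply
  intro W hW f
  have := congrArg (fun D : M.Der c.dom l => D.1.app W (hW.trans hV) f) h
  exact this

theorem act_partialVF (a : CoordIdx m p n) (h : W ≤ V) (f : M.Fn W) :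
    (act (c.partialVF hV a)).app W h f = c.pd (h.trans hV) a f := by
  rw [partialVF, act_resVF, act_ofDer]
  rfl

theorem dfn_partialVF (a : CoordIdx m p n) (f : M.Fn V) :
    dfn (c.partialVF hV a) f = c.pd hV a f := c.act_partialVF hV a le_rfl f

/-- Values of the coordinate functions. -/
def zVal : CoordIdx m p n → (Fin m → ℂ) → MvPowerSeries (Fin p) (ModelExterior r n)
  | .inl i => fun z => C (algebraMap ℂ _ (z i))
  | .inr (.inl j) => fun _ => MvPowerSeries.X j
  | .inr (.inr k) => fun _ => C (CliffordAlgebra.ι 0 (0, Pi.single k 1))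

theorem differentiable_zVal (a : CoordIdx m p n) (d : Fin p →₀ ℕ) :
    Differentiable ℂ fun z => coeff d (zVal (r := r) a z) := by
  classical
  match a with
  | .inl i =>
    simp only [zVal, coeff_C]
    split_ifs
    · have h1 : Differentiable ℂ fun z : Fin m → ℂ => z i := differentiable_apply i
      have h2 : Differentiable ℂ (algebraMap ℂ (ModelExterior r n)) :=
        (LinearMap.toContinuousLinearMap (Algebra.linearMap ℂ (ModelExterior r n))).differentiable
      exact h2.comp h1
    · exact differentiable_const _
  | .inr (.inl j) => exact differentiable_const _
  | .inr (.inr k) => exact differentiable_const _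

/-- The coordinate functions. -/
def zf (a : CoordIdx m p n) : M.Fn V :=
  c.ofVal hV (zVal a) fun d => (differentiable_zVal a d).differentiableOn

theorem val_zf (a : CoordIdx m p n) {z : Fin m → ℂ} (hz : z ∈ c.coord '' V) :
    c.val hV (c.zf hV a) z = zVal a z := c.val_ofVal hV _ hz

theorem res_zf (h : W ≤ V) (a : CoordIdx m p n) : M.res h (c.zf hV a) = c.zf hW a := by
  refine c.ext_val hW fun z hz => ?_
  rw [c.val_res hV hW h _ hz, val_zf _ _ _ hz, val_zf _ _ _ (Set.image_mono h hz)]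

theorem zf_mem (a : CoordIdx m p n) : c.zf hV a ∈ M.gr V (cpar a) := by
  classical
  rw [c.mem_gr_iff hV]
  intro z hz d
  rw [val_zf _ _ _ hz]
  match a with
  | .inl i =>
    simp only [zVal, coeff_C]
    split_ifs
    · exact algebraMap_mem_extParity _
    · exact Submodule.zero_mem _
  | .inr (.inl j) =>
    simp only [zVal, MvPowerSeries.coeff_X]
    split_ifs
    · exact one_mem_extParity _
    · exact Submodule.zero_mem _
  | .inr (.inr k) =>
    simp only [zVal, coeff_C]
    split_ifs
    · exact CliffordAlgebra.ι_mem_evenOdd_one _ _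
    · exact Submodule.zero_mem _

theorem pd_zf (a b : CoordIdx m p n) : c.pd hV a (c.zf hV b) = if a = b then 1 else 0 := by
  classical
  refine c.ext_val hV fun z hz => ?_
  rw [val_pd _ _ _ _ hz, pdVal_congr a (c.isOpen_image hV) (fun w hw => c.val_zf hV b hw) hz,
    apply_ite (fun f : M.Fn V => c.val hV f z), val_zero _ _ hz, val_one _ _ hz]
  match a, b with
  | .inl i, .inl j =>
    ext d : 1
    rw [coeff_pdVal_inl]
    simp only [zVal, coeff_C, Sum.inl.injEq]
    by_cases hd : d = 0
    · simp only [hd, if_true]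
      have h1 := pderivC_linear (Algebra.linearMap ℂ (ModelExterior r n))
        (f := fun w : Fin m → ℂ => w j) (z := z) (differentiableAt_apply (𝕜 := ℂ) j z) i
      rw [show pderivC i (fun w : Fin m → ℂ => algebraMap ℂ (ModelExterior r n) (w j)) z = _ from h1]
      have h2 : pderivC i (fun w : Fin m → ℂ => w j) z = (Pi.single i (1 : ℂ) : Fin m → ℂ) j := by
        unfold pderivC
        rw [show fderiv ℂ (fun w : Fin m → ℂ => w j) z = _ from
          (ContinuousLinearMap.hasFDerivAt
            (ContinuousLinearMap.proj (R := ℂ) (φ := fun _ : Fin m => ℂ) j)).fderiv]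
        rfl
      rw [h2]
      by_cases hij : i = j
      · simp [hij]
      · simp [hij, Ne.symm hij]
    · simp only [hd, if_false, pderivC_const]
      split_ifs <;> simp [coeff_one, hd]
  | .inl i, .inr (.inl j) =>
    ext d : 1
    rw [coeff_pdVal_inl]
    simp [zVal, pderivC_const]
  | .inl i, .inr (.inr j) =>
    ext d : 1
    rw [coeff_pdVal_inl]
    simp [zVal, pderivC_const]
  | .inr (.inl i), .inl j => simp [pdVal, zVal, yderiv_C]
  | .inr (.inl i), .inr (.inl j) =>
    simp only [pdVal, zVal, Sum.inr.injEq, Sum.inl.injEq]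
    split_ifs with h
    · rw [h, yderiv_X_same]
    · rw [yderiv_X_ne h]
  | .inr (.inl i), .inr (.inr j) => simp [pdVal, zVal, yderiv_C]
  | .inr (.inr i), .inl j => simp [pdVal, zVal, mapCoeff_C, thetaDeriv_algebraMap]
  | .inr (.inr i), .inr (.inl j) =>
    simp only [pdVal, zVal, reduceCtorEq, Sum.inr.injEq, if_false]
    ext d
    rw [coeff_mapCoeff, MvPowerSeries.coeff_X, coeff_zero]
    split_ifs
    · exact (by simpa using thetaDeriv_algebraMap (r := r) i 1)
    · exact map_zero _
  | .inr (.inr i), .inr (.inr j) =>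
    simp only [pdVal, zVal, mapCoeff_C, thetaDeriv_ι, Sum.inr.injEq]
    by_cases h : i = j
    · simp [h]
    · simp [h]

/-- Functions with constant values in the exterior algebra. -/
def kap (b : ModelExterior r n) : M.Fn V :=
  c.ofVal hV (fun _ => C b) fun _ => differentiableOn_const _

theorem val_kap (b : ModelExterior r n) {z : Fin m → ℂ} (hz : z ∈ c.coord '' V) :
    c.val hV (c.kap hV b) z = C b := c.val_ofVal hV _ hz

theorem kap_mul (b b' : ModelExterior r n) : c.kap hV (b * b') = c.kap hV b * c.kap hV b' := by
  refine c.ext_val hV fun z hz => ?_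
  rw [val_mul _ _ hz, val_kap _ _ _ hz, val_kap _ _ _ hz, val_kap _ _ _ hz, map_mul]

theorem kap_add (b b' : ModelExterior r n) : c.kap hV (b + b') = c.kap hV b + c.kap hV b' := by
  refine c.ext_val hV fun z hz => ?_
  rw [val_add _ _ hz, val_kap _ _ _ hz, val_kap _ _ _ hz, val_kap _ _ _ hz, map_add]

theorem kap_algebraMap (a : ℂ) : c.kap hV (algebraMap ℂ _ a) = algebraMap ℂ (M.Fn V) a := by
  refine c.ext_val hV fun z hz => ?_
  rw [val_kap _ _ _ hz, Algebra.algebraMap_eq_smul_one (A := M.Fn V) a, val_smul _ _ hz,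
    val_one _ _ hz, Algebra.algebraMap_eq_smul_one a]
  ext d
  rw [coeff_C]
  change _ = a • coeff d (1 : MvPowerSeries (Fin p) (ModelExterior r n))
  rw [coeff_one]
  split_ifs <;> simp

/-- Together with multiplicativity this exhibits `kap b` as a polynomial in odd constants and odd
coordinates, on which derivations can be evaluated. -/
theorem kap_ι (v : Fin r → ℂ) (w : Fin n → ℂ) : c.kap hV (CliffordAlgebra.ι 0 (v, w)) =
    M.cst V (ExteriorAlgebra.ι ℂ v) + ∑ k, w k • c.zf hV (.inr (.inr k)) := by
  refine c.ext_val hV fun z hz => ?_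
  have h1 : ∀ s : Finset (Fin n), c.val hV (∑ k ∈ s, w k • c.zf hV (.inr (.inr k))) z =
      ∑ k ∈ s, w k • C (CliffordAlgebra.ι 0 (0, Pi.single k 1)) := by
    classical
    intro s
    induction s using Finset.induction_on with
    | empty => simp [val_zero _ _ hz]
    | insert k s hk ih =>
      rw [Finset.sum_insert hk, Finset.sum_insert hk, val_add _ _ hz, ih, val_smul _ _ hz,
        val_zf _ _ _ hz]
      rfl
  rw [val_kap _ _ _ hz, val_add _ _ hz, val_cst _ _ hz, h1, ExteriorAlgebra.map_apply_ι]
  have h2 : ∀ k, w k • (C (CliffordAlgebra.ι 0 (0, Pi.single k 1)) :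
      MvPowerSeries (Fin p) (ModelExterior r n)) =
      C (w k • CliffordAlgebra.ι 0 ((0 : Fin r → ℂ), (Pi.single k 1 : Fin n → ℂ))) := by
    classical
    intro k
    ext d
    change w k • coeff d (C (CliffordAlgebra.ι 0 ((0 : Fin r → ℂ), (Pi.single k 1 : Fin n → ℂ))) :
      MvPowerSeries (Fin p) (ModelExterior r n)) = _
    rw [coeff_C, coeff_C]
    split_ifs <;> simp
  simp_rw [h2]
  rw [← map_sum, ← map_add]
  congr 1
  simp_rw [← map_smul]
  rw [← map_sum]
  have h3 : (v, w) = (v, (0 : Fin n → ℂ)) +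
      ∑ k, w k • ((0 : Fin r → ℂ), (Pi.single k 1 : Fin n → ℂ)) := by
    ext k
    · simp [Prod.fst_sum]
    · simp [Prod.snd_sum, Finset.sum_apply, Pi.single_apply]
  conv_lhs => rw [h3]
  rw [map_add]
  rfl

include hV

/-- The part of a coordinate neighbourhood over an open set of coordinates. -/
theorem exists_opens_image_eq {B : Set (Fin m → ℂ)} (hB : IsOpen B) (hBV : B ⊆ c.coord '' V) :
    ∃ W ≤ V, c.coord '' W = B ∧ ∀ x ∈ V, c.coord x ∈ B → x ∈ W := by
  have ho : IsOpen ((V : Set M.X) ∩ c.coord ⁻¹' B) := by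
    have h1 := c.coord.isOpen_inter_preimage hB
    have h2 : (V : Set M.X) ∩ c.coord ⁻¹' B = (V : Set M.X) ∩ (c.coord.source ∩ c.coord ⁻¹' B) := by
      ext x
      constructor
      · rintro ⟨h, h'⟩; exact ⟨h, hV h, h'⟩
      · rintro ⟨h, -, h'⟩; exact ⟨h, h'⟩
    rw [h2]
    exact V.2.inter h1
  refine ⟨⟨_, ho⟩, fun x hx => hx.1, ?_, fun x hx hxB => ⟨hx, hxB⟩⟩
  ext z
  constructor
  · rintro ⟨x, hx, rfl⟩; exact hx.2
  · intro hz
    obtain ⟨x, hx, rfl⟩ := hBV hz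
    exact ⟨x, ⟨hx, hz⟩, rfl⟩

theorem exists_ball {x : M.X} (hx : x ∈ V) :
    ∃ R > 0, ∃ W ≤ V, x ∈ W ∧ c.coord '' W = ball (c.coord x) R := by
  obtain ⟨R, hR, hRV⟩ := Metric.isOpen_iff.1 (c.isOpen_image hV) (c.coord x) ⟨x, hx, rfl⟩
  obtain ⟨W, hWV, hWi, hWm⟩ := c.exists_opens_image_eq hV isOpen_ball hRV
  exact ⟨R, hR, W, hWV, hWm x hx (mem_ball_self hR), hWi⟩

end Chart

end Superspace

end

/-! ### Primitives in one even coordinate -/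

noncomputable section

theorem slideMean_linear {m : ℕ} {F G : Type*} [NormedAddCommGroup F] [NormedSpace ℂ F]
    [FiniteDimensional ℂ F] [NormedAddCommGroup G] [NormedSpace ℂ G] [CompleteSpace G]
    (T : F →ₗ[ℂ] G) {a : Fin m → ℂ} {R : ℝ} {f : (Fin m → ℂ) → F}
    (hf : DifferentiableOn ℂ f (Metric.ball a R)) (i : Fin m) {x : Fin m → ℂ}
    (hx : x ∈ Metric.ball a R) :
    slideMean a i (fun w => T (f w)) x = T (slideMean a i f x) := by
  have := FiniteDimensional.complete ℂ F
  have h := (LinearMap.toContinuousLinearMap T).intervalIntegral_comp_comm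
    (μ := MeasureTheory.volume) (a := 0) (b := 1) (f := fun t : ℝ => f (slide a i t x)) (by
      refine ContinuousOn.intervalIntegrable ?_
      rw [Set.uIcc_of_le zero_le_one]
      exact continuousOn_slide_path hf.continuousOn i hx)
  exact h

namespace Superspace

namespace Chart

open MvPowerSeries Metric

variable {r m p n : ℕ} {M : Superspace.{u} r} (c : M.Chart m p n) {V W : Opens M.X}
  (hV : V ≤ c.dom) (hW : W ≤ c.dom)

theorem coeff_pdVal_formal (j : Fin p)
    (F : (Fin m → ℂ) → MvPowerSeries (Fin p) (ModelExterior r n)) (z : Fin m → ℂ)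
    (d : Fin p →₀ ℕ) : coeff d (pdVal (.inr (.inl j) : CoordIdx m p n) F z) =
      ((d j + 1 : ℕ) : ℂ) • coeff (d + Finsupp.single j 1) (F z) := by
  rw [Nat.cast_smul_eq_nsmul]; rfl

theorem coeff_pdVal_odd (k : Fin n)
    (F : (Fin m → ℂ) → MvPowerSeries (Fin p) (ModelExterior r n)) (z : Fin m → ℂ)
    (d : Fin p →₀ ℕ) : coeff d (pdVal (.inr (.inr k) : CoordIdx m p n) F z) =
      thetaDeriv k (coeff d (F z)) := rfl

/-- This much is needed for Hadamard's lemma. The general rule `pd_comm` is then deduced from the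
vanishing of brackets of coordinate fields. -/
theorem pd_comm_even {e : CoordIdx m p n} (he : cpar e = 0) (b : CoordIdx m p n) (f : M.Fn V) :
    c.pd hV b (c.pd hV e f) = c.pd hV e (c.pd hV b f) := by
  have hU := c.isOpen_image hV
  refine c.ext_val hV fun z hz => ?_
  rw [val_pd _ _ _ _ hz, val_pd _ _ _ _ hz,
    pdVal_congr b hU (fun w hw => c.val_pd hV e f hw) hz,
    pdVal_congr e hU (fun w hw => c.val_pd hV b f hw) hz]
  have hd := fun d => c.differentiableAt_coeff_val hV f d hz
  ext d : 1
  match e, b, he with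
  | .inl i, .inl j, _ => exact pderivC_comm (c.differentiableOn_coeff_val hV f d) hU j i hz
  | .inl i, .inr (.inl j), _ =>
    simp only [coeff_pdVal_inl, coeff_pdVal_formal]
    rw [pderivC_smul _ (hd _)]
  | .inl i, .inr (.inr k), _ =>
    simp only [coeff_pdVal_inl, coeff_pdVal_odd]
    rw [pderivC_linear _ (hd _)]
  | .inr (.inl i), .inl j, _ =>
    simp only [coeff_pdVal_inl, coeff_pdVal_formal]
    rw [pderivC_smul _ (hd _)]
  | .inr (.inl i), .inr (.inl j), _ => exact congrArg _ (yderiv_comm j i _)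
  | .inr (.inl i), .inr (.inr k), _ =>
    simp only [pdVal, coeff_mapCoeff, coeff_yderiv]
    exact map_nsmul _ _ _

theorem pd_zero (a : CoordIdx m p n) : c.pd hV a (0 : M.Fn V) = 0 := by
  have := c.pd_smul hV a 0 0
  rwa [zero_smul, zero_smul] at this

theorem pd_sub (a : CoordIdx m p n) (f g : M.Fn V) :
    c.pd hV a (f - g) = c.pd hV a f - c.pd hV a g := by
  have h1 : f - g = f + (-1 : ℂ) • g := by rw [neg_one_smul, sub_eq_add_neg]
  rw [h1, pd_add, pd_smul, neg_one_smul, sub_eq_add_neg]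

/-- The sum of the functions `y_j ^ k g_k`. -/
def ysumFn (j : Fin p) (g : ℕ → M.Fn V) : M.Fn V :=
  c.ofVal hV (fun z => ysum j fun k => c.val hV (g k) z) fun d => by
    simp only [coeff_ysum j _ (Nat.lt_succ_self (d j)), map_sum, coeff_X_pow_mul_eq]
    refine DifferentiableOn.fun_sum fun k _ => ?_
    split_ifs
    · exact c.differentiableOn_coeff_val hV _ _
    · exact differentiableOn_const _

theorem val_ysumFn (j : Fin p) (g : ℕ → M.Fn V) {z : Fin m → ℂ} (hz : z ∈ c.coord '' V) :
    c.val hV (c.ysumFn hV j g) z = ysum j fun k => c.val hV (g k) z := c.val_ofVal hV _ hz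

theorem ysumFn_mul (j : Fin p) (g : ℕ → M.Fn V) (h : M.Fn V) :
    c.ysumFn hV j g * h = c.ysumFn hV j fun k => g k * h := by
  refine c.ext_val hV fun z hz => ?_
  rw [val_mul _ _ hz, val_ysumFn _ _ _ _ hz, val_ysumFn _ _ _ _ hz, ysum_mul]
  simp_rw [val_mul _ _ hz]

theorem mul_ysumFn (j : Fin p) (g : ℕ → M.Fn V) (h : M.Fn V) :
    h * c.ysumFn hV j g = c.ysumFn hV j fun k => h * g k := by
  refine c.ext_val hV fun z hz => ?_
  rw [val_mul _ _ hz, val_ysumFn _ _ _ _ hz, val_ysumFn _ _ _ _ hz, mul_ysum]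
  simp_rw [val_mul _ _ hz]

theorem ysumFn_eq (j : Fin p) (g : ℕ → M.Fn V) :
    c.ysumFn hV j g = g 0 + c.zf hV (.inr (.inl j)) * c.ysumFn hV j fun k => g (k + 1) := by
  refine c.ext_val hV fun z hz => ?_
  rw [val_add _ _ hz, val_mul _ _ hz, val_ysumFn _ _ _ _ hz, val_ysumFn _ _ _ _ hz, val_zf _ _ _ hz,
    ysum_eq]
  rfl

theorem ysumFn_add (j : Fin p) (g h : ℕ → M.Fn V) :
    c.ysumFn hV j (fun k => g k + h k) = c.ysumFn hV j g + c.ysumFn hV j h := by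
  refine c.ext_val hV fun z hz => ?_
  rw [val_add _ _ hz, val_ysumFn _ _ _ _ hz, val_ysumFn _ _ _ _ hz, val_ysumFn _ _ _ _ hz]
  ext d : 1
  simp only [map_add, coeff_ysum j _ (Nat.lt_succ_self (d j)), val_add _ _ hz, mul_add,
    Finset.sum_add_distrib]

theorem ysumFn_zero (j : Fin p) : c.ysumFn hV j (fun _ => (0 : M.Fn V)) = 0 := by
  have h := c.ysumFn_mul hV j (fun _ => (0 : M.Fn V)) 0
  simpa using h.symm

theorem ysumFn_sum {ι : Type*} (s : Finset ι) (j : Fin p) (g : ι → ℕ → M.Fn V) :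
    c.ysumFn hV j (fun k => ∑ i ∈ s, g i k) = ∑ i ∈ s, c.ysumFn hV j (g i) := by
  classical
  induction s using Finset.induction_on with
  | empty => simpa using c.ysumFn_zero hV j
  | insert i s hi ih =>
    simp_rw [Finset.sum_insert hi]
    rw [ysumFn_add, ih]

theorem ysumFn_mem (j : Fin p) {g : ℕ → M.Fn V} {i : ZMod 2} (hg : ∀ k, g k ∈ M.gr V i) :
    c.ysumFn hV j g ∈ M.gr V i := by
  rw [c.mem_gr_iff hV]
  intro z hz d
  rw [val_ysumFn _ _ _ _ hz, coeff_ysum j _ (Nat.lt_succ_self (d j)), map_sum]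
  refine Submodule.sum_mem _ fun k _ => ?_
  rw [coeff_X_pow_mul_eq]
  split_ifs
  · exact (c.mem_gr_iff hV).1 (hg k) z hz _
  · exact Submodule.zero_mem _

theorem pd_ysumFn_same (j : Fin p) (g : ℕ → M.Fn V) : c.pd hV (.inr (.inl j)) (c.ysumFn hV j g) =
    c.ysumFn hV j fun k => c.pd hV (.inr (.inl j)) (g k) + ((k : ℂ) + 1) • g (k + 1) := by
  refine c.ext_val hV fun z hz => ?_
  rw [val_pd _ _ _ _ hz, pdVal_congr _ (c.isOpen_image hV) (fun w hw => c.val_ysumFn hV j g hw) hz,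
    val_ysumFn _ _ _ _ hz]
  refine (yderiv_ysum_same j _).trans ?_
  congr 1
  funext k
  rw [val_add _ _ hz, val_pd _ _ _ _ hz, val_smul _ _ hz, ← Nat.cast_smul_eq_nsmul ℂ]
  push_cast
  rfl

theorem pd_ysumFn_ne {j : Fin p} {b : CoordIdx m p n} (hb : b ≠ .inr (.inl j))
    (g : ℕ → M.Fn V) : c.pd hV b (c.ysumFn hV j g) = c.ysumFn hV j fun k => c.pd hV b (g k) := by
  refine c.ext_val hV fun z hz => ?_
  rw [val_pd _ _ _ _ hz, pdVal_congr _ (c.isOpen_image hV) (fun w hw => c.val_ysumFn hV j g hw) hz,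
    val_ysumFn _ _ _ _ hz]
  have h1 : ∀ k, c.val hV (c.pd hV b (g k)) z = pdVal b (c.val hV (g k)) z :=
    fun k => c.val_pd hV b (g k) hz
  simp_rw [h1]
  match b with
  | .inl i =>
    ext d : 1
    rw [coeff_pdVal_inl]
    simp only [coeff_ysum j _ (Nat.lt_succ_self (d j)), map_sum, coeff_X_pow_mul_eq]
    rw [pderivC_sum]
    · refine Finset.sum_congr rfl fun k _ => ?_
      split_ifs
      · rfl
      · exact pderivC_const _ _ _
    · intro k _
      split_ifs
      · exact c.differentiableAt_coeff_val hV _ _ hz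
      · exact differentiableAt_const _
  | .inr (.inl i) => exact yderiv_ysum_ne (fun h => hb (by rw [h])) _
  | .inr (.inr i) => exact mapCoeff_ysum _ _ _

/-- The even coordinates, centred at a point. -/
def ucoord (a : Fin m → ℂ) : CoordIdx m p n → M.Fn V
  | .inl i => c.zf hV (.inl i) - algebraMap ℂ _ (a i)
  | .inr b => c.zf hV (.inr b)

theorem algebraMap_mem_gr (V : Opens M.X) (b : ℂ) : algebraMap ℂ (M.Fn V) b ∈ M.gr V 0 := by
  rw [Algebra.algebraMap_eq_smul_one]
  exact Submodule.smul_mem _ _ (SetLike.one_mem_graded (M.gr V))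

theorem ucoord_mem (a : Fin m → ℂ) (e : CoordIdx m p n) :
    c.ucoord hV a e ∈ M.gr V (cpar e) := by
  match e with
  | .inl i => exact Submodule.sub_mem _ (c.zf_mem hV (.inl i)) (algebraMap_mem_gr V _)
  | .inr b => exact c.zf_mem hV (.inr b)

theorem val_algebraMap (b : ℂ) {z : Fin m → ℂ} (hz : z ∈ c.coord '' V) :
    c.val hV (algebraMap ℂ (M.Fn V) b) z = C (algebraMap ℂ _ b) := by
  rw [← c.kap_algebraMap hV, val_kap _ _ _ hz]

theorem pd_algebraMap (a : CoordIdx m p n) (b : ℂ) : c.pd hV a (algebraMap ℂ (M.Fn V) b) = 0 := by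
  have h : algebraMap ℂ (M.Fn V) b = M.cst V (algebraMap ℂ _ b) := (AlgHom.commutes _ b).symm
  rw [h, pd_cst]

/-- Primitives in an even coordinate, on a polydisc. -/
theorem exists_primitive_even {a : Fin m → ℂ} {R : ℝ} (hB : c.coord '' V = ball a R)
    {e : CoordIdx m p n} (he : cpar e = 0) (g : M.Fn V) :
    ∃ h : M.Fn V, c.pd hV e (c.ucoord hV a e * h) = g ∧
      ∀ b ≠ e, c.pd hV b g = 0 → c.pd hV b (c.ucoord hV a e * h) = 0 := by
  match e, he with
  | .inl i, _ =>
    have hg : ∀ d, DifferentiableOn ℂ (fun z => coeff d (c.val hV g z)) (ball a R) := fun d => by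
      rw [← hB]; exact c.differentiableOn_coeff_val hV g d
    -- The primitive is `slidePrim` in each coefficient, and `H` is its quotient by the centred
    -- coordinate; Hadamard's lemma uses this factorisation.
    let H : (Fin m → ℂ) → MvPowerSeries (Fin p) (ModelExterior r n) := fun z d =>
      slideMean a i (fun w => coeff d (c.val hV g w)) z
    have hH : ∀ d, DifferentiableOn ℂ (fun z => coeff d (H z)) (c.coord '' V) := fun d => by
      rw [hB]; exact differentiableOn_slideMean (hg d) i
    have hprod : ∀ z ∈ c.coord '' V, ∀ d,
        coeff d (c.val hV (c.ucoord hV a (.inl i) * c.ofVal hV H hH) z) =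
          slidePrim a i (fun w => coeff d (c.val hV g w)) z := by
      intro z hz d
      have h1 : c.val hV (c.ucoord hV a (.inl i)) z = C (algebraMap ℂ _ (z i - a i)) := by
        have h2 : c.ucoord hV a (.inl i : CoordIdx m p n) + algebraMap ℂ _ (a i)
            = c.zf hV (.inl i) := sub_add_cancel _ _
        have h3 := congrArg (fun f => c.val hV f z) h2
        simp only [val_add _ _ hz, val_algebraMap _ _ _ hz, val_zf _ _ _ hz] at h3
        rw [map_sub, map_sub, eq_sub_iff_add_eq, h3]
        rfl
      rw [val_mul _ _ hz, val_ofVal _ _ _ hz, h1, coeff_C_mul, ← Algebra.smul_def]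
      rfl
    refine ⟨c.ofVal hV H hH, ?_, ?_⟩
    · refine c.ext_val hV fun z hz => ?_
      rw [val_pd _ _ _ _ hz]
      ext d : 1
      rw [coeff_pdVal_inl, pderivC_congr (c.isOpen_image hV) (fun w hw => hprod w hw d) i hz]
      rw [hB] at hz
      exact pderivC_slidePrim_same (hg d) i hz
    · intro b hb hbg
      refine c.ext_val hV fun z hz => ?_
      have hz0 : ∀ w ∈ c.coord '' V, ∀ d, coeff d (pdVal b (c.val hV g) w) = 0 := fun w hw d => by
        rw [← c.val_pd hV b g hw, hbg, val_zero _ _ hw, coeff_zero]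
      have hz' := hz
      rw [hB] at hz'
      have hvan : ∀ q : (Fin m → ℂ) → ModelExterior r n, (∀ w ∈ c.coord '' V, q w = 0) →
          slideMean a i q z = 0 := by
        intro q hq
        rw [slideMean_congr (g := fun _ => 0) (fun w hw => hq w (by rw [hB]; exact hw)) i hz']
        simp [slideMean]
      rw [val_pd _ _ _ _ hz, val_zero _ _ hz]
      ext d : 1
      rw [coeff_zero]
      match b with
      | .inl j =>
        rw [coeff_pdVal_inl, pderivC_congr (c.isOpen_image hV) (fun w hw => hprod w hw d) j hz,
          pderivC_slidePrim_ne (hg d) (fun h => hb (by rw [h])) hz', slidePrim,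
          hvan (pderivC j _) fun w hw => hz0 w hw d, smul_zero]
      | .inr (.inl j) =>
        rw [coeff_pdVal_formal, hprod z hz, slidePrim, hvan, smul_zero, smul_zero]
        intro w hw
        have := hz0 w hw d
        rw [coeff_pdVal_formal] at this
        exact (smul_eq_zero_iff_right (Nat.cast_ne_zero.2 (Nat.succ_ne_zero _))).1 this
      | .inr (.inr k) =>
        rw [coeff_pdVal_odd, hprod z hz, slidePrim, map_smul,
          ← slideMean_linear _ (hg d) i hz', hvan, smul_zero]
        exact fun w hw => hz0 w hw d
  | .inr (.inl j), _ =>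
    -- Repeated integration by parts: the coefficients `h k` may themselves depend on `y_j`, and the
    -- derivative of the sum of `y_j ^ (k + 1) h k` telescopes to `h 0 = g` because `∂ (h k) + (k +
    -- 2) h (k + 1) = 0`.
    let h : ℕ → M.Fn V := fun k => Nat.rec g
      (fun k q => (-((k : ℂ) + 2)⁻¹) • c.pd hV (.inr (.inl j)) q) k
    let f : ℕ → M.Fn V := fun k => Nat.rec 0 (fun k _ => h k) k
    have hf : c.ucoord hV a (.inr (.inl j)) * c.ysumFn hV j h = c.ysumFn hV j f := by
      rw [c.ysumFn_eq hV j f]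
      exact (zero_add _).symm
    refine ⟨c.ysumFn hV j h, ?_, ?_⟩
    · rw [hf, pd_ysumFn_same, ysumFn_eq]
      have h0 : ∀ k : ℕ, c.pd hV (.inr (.inl j)) (f (k + 1)) + (((k + 1 : ℕ) : ℂ) + 1) • f (k + 1 + 1)
          = 0 := by
        intro k
        change c.pd hV (.inr (.inl j)) (h k) + (((k + 1 : ℕ) : ℂ) + 1) •
          ((-((k : ℂ) + 2)⁻¹) • c.pd hV (.inr (.inl j)) (h k)) = 0
        have hk : (k : ℂ) + 2 ≠ 0 := by exact_mod_cast Nat.succ_ne_zero (k + 1)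
        rw [smul_smul, show (((k + 1 : ℕ) : ℂ) + 1) * (-((k : ℂ) + 2)⁻¹) = -1 by
          push_cast; field_simp; ring, neg_one_smul, add_neg_cancel]
      simp_rw [h0]
      rw [ysumFn_zero, mul_zero, add_zero]
      change c.pd hV (.inr (.inl j)) (0 : M.Fn V) + (((0 : ℕ) : ℂ) + 1) • g = g
      rw [pd_zero]
      simp
    · intro b hb hbg
      have hh : ∀ k, c.pd hV b (h k) = 0 := by
        intro k
        induction k with
        | zero => exact hbg
        | succ k ih =>
          change c.pd hV b (_ • c.pd hV (.inr (.inl j)) (h k)) = 0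
          rw [pd_smul, c.pd_comm_even hV (e := .inr (.inl j)) rfl, ih, pd_zero, smul_zero]
      rw [hf, c.pd_ysumFn_ne hV hb]
      have hfz : ∀ k, c.pd hV b (f k) = 0 := by
        intro k
        cases k with
        | zero => exact c.pd_zero hV b
        | succ k => exact hh k
      simp_rw [hfz]
      exact c.ysumFn_zero hV j

end Chart

end Superspace

end

noncomputable section

namespace Superspace

variable {r : ℕ} {M : Superspace.{u} r} {U V : Opens M.X}

/-! ### The module of vector fields -/

theorem act_zero : act (0 : M.VF U) = 0 := by simp [act]

theorem act_neg (X : M.VF U) : act (-X) = -act X := by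
  have := act_zsmul (-1) X
  simpa using this

theorem act_sub (X Y : M.VF U) : act (X - Y) = act X - act Y := by
  rw [sub_eq_add_neg, act_add, act_neg, sub_eq_add_neg]

theorem mulOp_one : mulOp (1 : M.Fn U) = 1 := by
  apply Op.ext_apply; intro V hV g; simp; rfl

theorem mulOp_zero : mulOp (0 : M.Fn U) = 0 := by
  apply Op.ext_apply; intro V hV g; simp

/-- A vector field is determined by its action, so the axioms are checked in the ring of operators.
-/
instance : Module (M.Fn U) (M.VF U) where
  smul := fsmul
  one_smul X := act_injective (by
    change act (fsmul 1 X) = _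
    rw [act_fsmul, mulOp_one, one_mul])
  mul_smul := mul_fsmul
  smul_zero f := act_injective (by
    change act (fsmul f 0) = _
    rw [act_fsmul, act_zero, mul_zero])
  smul_add := fsmul_add
  add_smul := add_fsmul
  zero_smul X := act_injective (by
    change act (fsmul 0 X) = _
    rw [act_fsmul, mulOp_zero, zero_mul, act_zero])

theorem fsmul_eq_smul (f : M.Fn U) (X : M.VF U) : fsmul f X = f • X := rfl

theorem act_smul (f : M.Fn U) (X : M.VF U) : act (f • X) = mulOp f * act X := act_fsmul f X

theorem dfn_add_left (X Y : M.VF U) (f : M.Fn U) : dfn (X + Y) f = dfn X f + dfn Y f := by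
  simp [dfn, act_add]

theorem dfn_zero_left (f : M.Fn U) : dfn (0 : M.VF U) f = 0 := by
  simp [dfn, act_zero]

theorem dfn_smul (g : M.Fn U) (X : M.VF U) (f : M.Fn U) : dfn (g • X) f = g * dfn X f := by
  rw [dfn, act_smul, Op.mul_apply, mulOp_apply, res_refl, dfn]

theorem dfn_sum_left {ι : Type*} (s : Finset ι) (X : ι → M.VF U) (f : M.Fn U) :
    dfn (∑ i ∈ s, X i) f = ∑ i ∈ s, dfn (X i) f :=
  map_sum (AddMonoidHom.mk' (fun Y : M.VF U => dfn Y f) fun Y Z => dfn_add_left Y Z f) X s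

theorem dfn_sum {ι : Type*} (s : Finset ι) (X : M.VF U) (f : ι → M.Fn U) :
    dfn X (∑ i ∈ s, f i) = ∑ i ∈ s, dfn X (f i) := map_sum _ f s

theorem IsHomog.act_eq {k : ZMod 2} {X : M.VF U} (hX : IsHomog k X) : act X = X.comp k := by
  rw [act, Finset.sum_eq_single k]
  · intro l _ hl
    rw [hX l hl]; rfl
  · simp

theorem IsHomog.dfn_mem {k i : ZMod 2} {X : M.VF U} (hX : IsHomog k X) {f : M.Fn U}
    (hf : f ∈ M.gr U i) : dfn X f ∈ M.gr U (k + i) := by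
  rw [dfn, hX.act_eq]
  exact (X.comp k).2.2.2.1 U le_rfl i f hf

theorem IsHomog.add {k : ZMod 2} {X Y : M.VF U} (hX : IsHomog k X) (hY : IsHomog k Y) :
    IsHomog k (X + Y) := fun l hl => by rw [VF.add_comp, hX l hl, hY l hl, add_zero]

theorem isHomog_zero (k : ZMod 2) : IsHomog k (0 : M.VF U) := fun _ _ => rfl

theorem isHomog_sum {ι : Type*} {s : Finset ι} {k : ZMod 2} {X : ι → M.VF U}
    (h : ∀ i ∈ s, IsHomog k (X i)) : IsHomog k (∑ i ∈ s, X i) := by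
  classical
  induction s using Finset.induction_on with
  | empty => exact isHomog_zero k
  | insert i s hi ih =>
    rw [Finset.sum_insert hi]
    exact (h i (Finset.mem_insert_self _ _)).add
      (ih fun j hj => h j (Finset.mem_insert_of_mem hj))

theorem IsHomog.smul {i k l : ZMod 2} {f : M.Fn U} (hf : f ∈ M.gr U i) {X : M.VF U}
    (hX : IsHomog k X) (hl : i + k = l) : IsHomog l (f • X) := hl ▸ fsmul_isHomog hf hX

/-- The homogeneous components of a vector field. -/
def VF.part (k : ZMod 2) (X : M.VF U) : M.VF U := VF.ofDer k (X.comp k).2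

theorem isHomog_part (k : ZMod 2) (X : M.VF U) : IsHomog k (X.part k) := isHomog_ofDer _

theorem sum_part_VF (X : M.VF U) : ∑ k, X.part k = X := by
  apply act_injective
  have h1 : act (∑ k, X.part k) = ∑ k, act (X.part k) :=
    map_sum (AddMonoidHom.mk' (act (M := M) (U := U)) act_add) _ _
  rw [h1, act]
  exact Finset.sum_congr rfl fun k _ => act_ofDer _

/-- Induction on the homogeneous components of a vector field. -/
theorem VF.induction_homog {P : M.VF U → Prop} (hadd : ∀ X Y, P X → P Y → P (X + Y))
    (h : ∀ k X, IsHomog k X → P X) (X : M.VF U) : P X := by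
  rw [← sum_part_VF X, show (Finset.univ : Finset (ZMod 2)) = {0, 0 + 1} from zmod_two_univ 0,
    Finset.sum_pair (zmod_two_ne 0)]
  exact hadd _ _ (h _ _ (isHomog_part _ _)) (h _ _ (isHomog_part _ _))

theorem superComm_add_left (p q : ZMod 2) (D D' E : M.Op U) :
    superComm p q (D + D') E = superComm p q D E + superComm p q D' E := by
  simp only [superComm, add_mul, mul_add, smul_add]; abel

theorem superComm_add_right (p q : ZMod 2) (D E E' : M.Op U) :
    superComm p q D (E + E') = superComm p q D E + superComm p q D E' := by
  simp only [superComm, add_mul, mul_add, smul_add]; abel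

theorem coe_bracket_comp (X Y : M.VF U) (k : ZMod 2) : ((bracket X Y).comp k : M.Op U) =
    ∑ p, superComm p (k - p) (X.comp p : M.Op U) (Y.comp (k - p) : M.Op U) := rfl

theorem bracket_add_left (X X' Y : M.VF U) : bracket (X + X') Y = bracket X Y + bracket X' Y := by
  apply VF.ext
  funext k
  apply Subtype.ext
  simp only [VF.add_comp, Submodule.coe_add, coe_bracket_comp, superComm_add_left,
    Finset.sum_add_distrib]

theorem bracket_add_right (X Y Y' : M.VF U) : bracket X (Y + Y') = bracket X Y + bracket X Y' := by
  apply VF.ext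
  funext k
  apply Subtype.ext
  simp only [VF.add_comp, Submodule.coe_add, coe_bracket_comp, superComm_add_right,
    Finset.sum_add_distrib]

theorem superComm_zero_left (p q : ZMod 2) (E : M.Op U) : superComm p q 0 E = 0 := by
  simp [superComm]

theorem superComm_zero_right (p q : ZMod 2) (D : M.Op U) : superComm p q D 0 = 0 := by
  simp [superComm]

theorem act_bracket {k l : ZMod 2} {X Y : M.VF U} (hX : IsHomog k X) (hY : IsHomog l Y) :
    act (bracket X Y) = superComm k l (act X) (act Y) := by
  rw [hX.act_eq, hY.act_eq]
  change ∑ j, ∑ p, superComm p (j - p) (X.comp p : M.Op U) (Y.comp (j - p)) = _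
  rw [Finset.sum_comm, Finset.sum_eq_single k, Finset.sum_eq_single (k + l)]
  · rw [add_sub_cancel_left]
  · intro j _ hj
    rw [hY (j - k) (fun h => hj (by rw [← h]; ring))]
    exact superComm_zero_right _ _ _
  · simp
  · intro q _ hq
    refine Finset.sum_eq_zero fun j _ => ?_
    rw [hX q hq]
    exact superComm_zero_left _ _ _
  · simp

theorem dfn_bracket {k l : ZMod 2} {X Y : M.VF U} (hX : IsHomog k X) (hY : IsHomog l Y)
    (f : M.Fn U) : dfn (bracket X Y) f = dfn X (dfn Y f) - koszul k l • dfn Y (dfn X f) := by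
  rw [dfn, act_bracket hX hY]
  rfl

theorem isHomog_bracket {k l : ZMod 2} {X Y : M.VF U} (hX : IsHomog k X) (hY : IsHomog l Y) :
    IsHomog (k + l) (bracket X Y) := by
  intro j hj
  apply Subtype.ext
  change ∑ p, superComm p (j - p) (X.comp p : M.Op U) (Y.comp (j - p)) = 0
  refine Finset.sum_eq_zero fun q _ => ?_
  by_cases hq : q = k
  · rw [hY (j - q) (fun h => hj (by rw [← h, hq]; ring))]
    exact superComm_zero_right _ _ _
  · rw [hX q hq]
    exact superComm_zero_left _ _ _

theorem resVF_smul (h : V ≤ U) (f : M.Fn U) (X : M.VF U) :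
    resVF h (f • X) = M.res h f • resVF h X := resVF_fsmul h f X

theorem resVF_sum {ι : Type*} (s : Finset ι) (h : V ≤ U) (X : ι → M.VF U) :
    resVF h (∑ i ∈ s, X i) = ∑ i ∈ s, resVF h (X i) :=
  map_sum (AddMonoidHom.mk' (resVF h) (resVF_add h)) X s

theorem resVF_zsmul (h : V ≤ U) (a : ℤ) (X : M.VF U) : resVF h (a • X) = a • resVF h X :=
  map_zsmul (AddMonoidHom.mk' (resVF h) (resVF_add h)) a X

theorem IsHomog.resVF (h : V ≤ U) {k : ZMod 2} {X : M.VF U} (hX : IsHomog k X) :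
    IsHomog k (resVF h X) := by
  intro l hl
  apply Subtype.ext
  apply Op.ext_apply
  intro W hW f
  exact congrArg (fun D : M.Der U l => D.1.app W (hW.trans h) f) (hX l hl)

theorem resVF_bracket (h : V ≤ U) (X Y : M.VF U) :
    Superspace.resVF h (bracket X Y) = bracket (Superspace.resVF h X) (Superspace.resVF h Y) := by
  apply VF.ext
  funext k
  apply Subtype.ext
  apply Op.ext_apply
  intro W hW f
  change (∑ p, superComm p (k - p) (X.comp p : M.Op U) (Y.comp (k - p))).app W (hW.trans h) f =
    (∑ p, superComm p (k - p) ((Superspace.resVF h X).comp p : M.Op V)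
      ((Superspace.resVF h Y).comp (k - p))).app W hW f
  rw [Op.sum_apply, Op.sum_apply]
  rfl

/-- Functions are determined locally. -/
theorem eq_of_locally_eq_fn {f g : M.Fn U}
    (h : ∀ x ∈ U, ∃ (V : Opens M.X) (hV : V ≤ U), x ∈ V ∧ M.res hV f = M.res hV g) : f = g := by
  choose! V hV hx hfg using h
  have hV' : ∀ x : U, V x ≤ U := fun x => hV x x.2
  refine M.O.eq_of_locally_eq' (fun x : U => V x) U (fun x => homOfLE (hV' x)) ?_ f g ?_
  · intro x hxU
    exact Opens.mem_iSup.2 ⟨⟨x, hxU⟩, hx x hxU⟩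
  · intro x
    exact hfg x x.2

/-- Vector fields are determined locally. -/
theorem eq_zero_of_locally_eq_zero {X : M.VF U}
    (h : ∀ x ∈ U, ∃ (V : Opens M.X) (hV : V ≤ U), x ∈ V ∧ resVF hV X = 0) : X = 0 := by
  apply VF.ext
  funext k
  apply Subtype.ext
  apply Op.ext_apply
  intro W hW f
  refine eq_of_locally_eq_fn fun x hx => ?_
  obtain ⟨V, hV, hxV, h0⟩ := h x (hW hx)
  refine ⟨W ⊓ V, inf_le_left, ⟨hx, hxV⟩, ?_⟩
  rw [(X.comp k).2.1 W (W ⊓ V) hW (inf_le_left.trans hW)]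
  have := congrArg (fun Y : M.VF V => (Y.comp k).1.app (W ⊓ V) inf_le_right (M.res inf_le_left f)) h0
  exact this.trans (by simp)

end Superspace

end

noncomputable section

namespace Superspace

namespace Chart

open MvPowerSeries Metric

variable {r m p n : ℕ} {M : Superspace.{u} r} (c : M.Chart m p n) {V W : Opens M.X}
  (hV : V ≤ c.dom) (hW : W ≤ c.dom)

/-! ### Coordinate vector fields form a frame -/

/-- A function on a polydisc all of whose even derivatives vanish has constant values. -/
theorem exists_eq_kap {a : Fin m → ℂ} {R : ℝ} (hB : c.coord '' V = ball a R) {f : M.Fn V}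
    (hf : ∀ e : CoordIdx m p n, cpar e = 0 → c.pd hV e f = 0) : ∃ b, f = c.kap hV b := by
  refine ⟨coeff 0 (c.val hV f a), c.ext_val hV fun z hz => ?_⟩
  rw [val_kap _ _ _ hz, eq_C_of_yderiv_eq_zero (f := c.val hV f z)]
  · congr 1
    have hd := c.differentiableOn_coeff_val hV f 0
    rw [hB] at hz hd
    refine isOpen_ball.is_const_of_fderiv_eq_zero (convex_ball a R).isPreconnected hd ?_ hz
      (mem_ball_self (dist_nonneg.trans_lt (mem_ball.1 hz)))
    intro w hw
    ext v
    have h1 : ∀ i, pderivC i (fun z => coeff 0 (c.val hV f z)) w = 0 := by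
      intro i
      rw [← hB] at hw
      rw [← coeff_pdVal_inl (p := p) (n := n) i, ← c.val_pd hV _ f hw, hf _ rfl, val_zero _ _ hw,
        coeff_zero]
    have h2 : v = ∑ i, v i • (Pi.single i 1 : Fin m → ℂ) := by
      ext j
      simp [Finset.sum_apply, Pi.single_apply]
    rw [h2, map_sum]
    simp only [map_smul]
    simp only [pderivC] at h1
    exact Finset.sum_eq_zero fun i _ => by rw [h1 i, smul_zero]
  · intro j
    have := congrArg (fun g => c.val hV g z) (hf (.inr (.inl j)) rfl)
    simp only [val_pd _ _ _ _ hz, val_zero _ _ hz] at this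
    exact this

/-- Hadamard's lemma on a polydisc. -/
theorem exists_hadamard {a : Fin m → ℂ} {R : ℝ} (hB : c.coord '' V = ball a R) (g : M.Fn V) :
    ∃ (b : ModelExterior r n) (q : CoordIdx m p n → M.Fn V), g = c.kap hV b +
      ∑ e ∈ Finset.univ.filter (fun e : CoordIdx m p n => cpar e = 0), c.ucoord hV a e * q e := by
  classical
  -- The even coordinates are removed one at a time: subtracting the primitive `u_e h` of `∂_e f`
  -- kills the derivative along `e` without reviving those already killed. The final remainder has
  -- constant values in the exterior algebra.
  have key : ∀ s : Finset (CoordIdx m p n), (∀ e ∈ s, cpar e = 0) →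
      ∃ (f : M.Fn V) (q : CoordIdx m p n → M.Fn V), g = f + ∑ e ∈ s, c.ucoord hV a e * q e ∧
        ∀ e ∈ s, c.pd hV e f = 0 := by
    intro s
    induction s using Finset.induction_on with
    | empty => exact fun _ => ⟨g, 0, by simp, by simp⟩
    | insert e s he ih =>
      intro hs
      obtain ⟨f, q, hg, hf⟩ := ih fun e' he' => hs e' (Finset.mem_insert_of_mem he')
      have hse := hs e (Finset.mem_insert_self e s)
      obtain ⟨h, h1, h2⟩ := c.exists_primitive_even hV hB hse (c.pd hV e f)
      refine ⟨f - c.ucoord hV a e * h, Function.update q e h, ?_, ?_⟩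
      · rw [Finset.sum_insert he, Function.update_self, ← add_assoc, sub_add_cancel]
        rw [hg]
        congr 1
        refine Finset.sum_congr rfl fun e' he' => ?_
        rw [Function.update_of_ne]
        exact fun h => he (h ▸ he')
      · intro e' he'
        rw [pd_sub]
        by_cases hee : e' = e
        · rw [hee, h1, sub_self]
        · have hes := (Finset.mem_insert.1 he').resolve_left hee
          rw [h2 e' hee, hf e' hes, sub_zero]
          rw [c.pd_comm_even hV hse, hf e' hes, pd_zero]
  obtain ⟨f, q, hg, hf⟩ := key (Finset.univ.filter fun e : CoordIdx m p n => cpar e = 0)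
    fun e he => (Finset.mem_filter.1 he).2
  obtain ⟨b, rfl⟩ := c.exists_eq_kap hV hB fun e he => hf e (by simp [he])
  exact ⟨b, q, hg⟩

/-- Induction on products of generators: a derivation kills the odd constants, and the odd
coordinates by hypothesis. -/
theorem app_kap {k : ZMod 2} {D : M.Op V} (hD : D ∈ M.Der V k)
    (h : ∀ j, D.app V le_rfl (c.zf hV (.inr (.inr j))) = 0) (b : ModelExterior r n) :
    D.app V le_rfl (c.kap hV b) = 0 := by
  obtain ⟨-, h2, -, h4⟩ := hD
  have hconst : ∀ a : ℂ, D.app V le_rfl (algebraMap ℂ (M.Fn V) a) = 0 := by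
    intro a
    have h : algebraMap ℂ (M.Fn V) a = M.cst V (algebraMap ℂ _ a) := (AlgHom.commutes _ a).symm
    rw [h, h2]
  have hι : ∀ v, D.app V le_rfl (c.kap hV (CliffordAlgebra.ι 0 v)) = 0 := by
    rintro ⟨v, w⟩
    rw [kap_ι, map_add, map_sum, h2, zero_add]
    refine Finset.sum_eq_zero fun j _ => ?_
    rw [map_smul, h, smul_zero]
  have hpar : ∀ v, c.kap hV (CliffordAlgebra.ι 0 v) ∈ M.gr V 1 := by
    classical
    intro v
    rw [c.mem_gr_iff hV]
    intro z hz d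
    rw [val_kap _ _ _ hz, coeff_C]
    split_ifs
    · exact CliffordAlgebra.ι_mem_evenOdd_one _ _
    · exact Submodule.zero_mem _
  induction b using CliffordAlgebra.left_induction with
  | algebraMap a => rw [kap_algebraMap, hconst]
  | add x y hx hy => rw [kap_add, map_add, hx, hy, add_zero]
  | ι_mul x v hx => rw [kap_mul, h4 V le_rfl 1 _ _ (hpar v), hι, hx, zero_mul, mul_zero, smul_zero,
      add_zero]

/-- A superderivation which annihilates all coordinates vanishes. -/
theorem der_eq_zero {k : ZMod 2} {D : M.Op V} (hD : D ∈ M.Der V k)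
    (h : ∀ a, D.app V le_rfl (c.zf hV a) = 0) : D = 0 := by
  apply Op.ext_apply
  intro U hU f
  rw [Op.zero_apply]
  have hUd := hU.trans hV
  refine c.ext_val hUd ?_
  rintro _ ⟨x, hx, rfl⟩
  obtain ⟨R, hR, W, hWU, hxW, hB⟩ := c.exists_ball hUd hx
  have hWd := hWU.trans hUd
  have hWV := hWU.trans hU
  set D' : M.Op W := ⟨fun W' hW' => D.app W' (hW'.trans hWV)⟩ with hD'
  have hD'm : D' ∈ M.Der W k :=
    ⟨fun W₁ W₂ h₁ h₂ hh f => hD.1 W₁ W₂ (h₁.trans hWV) (h₂.trans hWV) hh f,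
      fun W₁ h₁ b => hD.2.1 W₁ (h₁.trans hWV) b,
      fun W₁ h₁ i f hf => hD.2.2.1 W₁ (h₁.trans hWV) i f hf,
      fun W₁ h₁ i f g hf => hD.2.2.2 W₁ (h₁.trans hWV) i f g hf⟩
  have hz : ∀ a, D'.app W le_rfl (c.zf hWd a) = 0 := by
    intro a
    have h1 := hD.1 V W le_rfl hWV hWV (c.zf hV a)
    rw [h a, map_zero, c.res_zf hV hWd] at h1
    exact h1.symm
  have hconst : ∀ a : ℂ, D'.app W le_rfl (algebraMap ℂ (M.Fn W) a) = 0 := by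
    intro a
    have h : algebraMap ℂ (M.Fn W) a = M.cst W (algebraMap ℂ _ a) := (AlgHom.commutes _ a).symm
    rw [h, hD'm.2.1]
  have hu : ∀ e, D'.app W le_rfl (c.ucoord hWd (c.coord x) e) = 0 := by
    intro e
    match e with
    | .inl i => exact (map_sub _ _ _).trans (by rw [hz, hconst, sub_zero])
    | .inr b => exact hz _
  have hxim : c.coord x ∈ c.coord '' W := ⟨x, hxW, rfl⟩
  -- Values at the single point `x` suffice, by induction on the formal degree. By Hadamard's lemma
  -- `D' g` is the sum of the `u_e D' (q e)`; the factor `u_e` vanishes at `x` for analytic `e` and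
  -- lowers the degree by one for formal `e`. No continuity of `D` enters.
  have key : ∀ (N : ℕ) (g : M.Fn W) (d : Fin p →₀ ℕ), d.degree < N →
      coeff d (c.val hWd (D'.app W le_rfl g) (c.coord x)) = 0 := by
    intro N
    induction N with
    | zero => intro g d hd; omega
    | succ N ih =>
      intro g d hd
      obtain ⟨b, q, rfl⟩ := c.exists_hadamard hWd hB g
      rw [map_add, c.app_kap hWd hD'm fun j => hz _, zero_add, map_sum]
      have hs : ∀ s : Finset (CoordIdx m p n), (∀ e ∈ s, cpar e = 0) →
          coeff d (c.val hWd (∑ e ∈ s, D'.app W le_rfl (c.ucoord hWd (c.coord x) e * q e))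
            (c.coord x)) = 0 := by
        classical
        intro s
        induction s using Finset.induction_on with
        | empty => intro _; rw [Finset.sum_empty, val_zero _ _ hxim, coeff_zero]
        | insert e s he ihs =>
          intro hes
          rw [Finset.sum_insert he, val_add _ _ hxim, map_add,
            ihs fun e' he' => hes e' (Finset.mem_insert_of_mem he'), add_zero,
            hD'm.2.2.2 W le_rfl _ _ _ (c.ucoord_mem hWd (c.coord x) e), hu, zero_mul, zero_add,
            hes e (Finset.mem_insert_self _ _), koszul_comm, koszul_zero_left, one_smul,
            val_mul _ _ hxim]
          match e, hes e (Finset.mem_insert_self _ _) with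
          | .inl i, _ =>
            have h0 : c.val hWd (c.ucoord hWd (c.coord x) (.inl i)) (c.coord x) = 0 := by
              have h2 : c.ucoord hWd (c.coord x) (.inl i : CoordIdx m p n)
                  + algebraMap ℂ _ (c.coord x i) = c.zf hWd (.inl i) := sub_add_cancel _ _
              have h3 := congrArg (fun f => c.val hWd f (c.coord x)) h2
              simp only [val_add _ _ hxim, val_algebraMap _ _ _ hxim, val_zf _ _ _ hxim] at h3
              exact add_eq_right.1 h3
            rw [h0, zero_mul, coeff_zero]
          | .inr (.inl j), _ =>
            rw [show c.val hWd (c.ucoord hWd (c.coord x) (.inr (.inl j))) (c.coord x)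
              = MvPowerSeries.X j from c.val_zf hWd _ hxim, coeff_X_mul_eq]
            split_ifs with h1
            · refine ih _ _ ?_
              have h3 : d - Finsupp.single j 1 + Finsupp.single j 1 = d :=
                tsub_add_cancel_of_le (by simpa [Finsupp.single_le_iff] using h1)
              have h4 := congrArg Finsupp.degree h3
              rw [map_add, Finsupp.degree_single] at h4
              omega
            · rfl
      exact hs _ fun e he => (Finset.mem_filter.1 he).2
  rw [val_zero _ _ ⟨x, hx, rfl⟩, ← c.val_res hUd hWd hWU _ hxim,
    hD.1 U W hU hWV hWU f]
  ext d : 1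
  rw [coeff_zero]
  exact key (d.degree + 1) (M.res hWU f) d (Nat.lt_succ_self _)

/-- A vector field which annihilates all coordinates vanishes. -/
theorem vf_eq_zero {X : M.VF V} (h : ∀ a, dfn X (c.zf hV a) = 0) : X = 0 := by
  apply VF.ext
  funext k
  apply Subtype.ext
  refine c.der_eq_zero hV (X.comp k).2 fun a => ?_
  have h1 := h a
  rw [dfn, act_apply, zmod_two_univ k, Finset.sum_pair (zmod_two_ne k)] at h1
  have h2 := (X.comp k).2.2.2.1 V le_rfl _ _ (c.zf_mem hV a)
  have h3 := (X.comp (k + 1)).2.2.2.1 V le_rfl _ _ (c.zf_mem hV a)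
  -- The two components of `X` send a coordinate to functions of opposite parities with sum zero, so
  -- each of them kills it.
  have h4 := eq_neg_of_add_eq_zero_left h1
  rw [h4] at h2
  have h5 := (Submodule.neg_mem_iff _).1 h2
  have h6 := DirectSum.decompose_of_mem_same _ h3
  have h7 := DirectSum.decompose_of_mem_ne (ℳ := M.gr V) h5
    (fun e => zmod_two_ne k (add_right_cancel e) : k + cpar a ≠ k + 1 + cpar a)
  rw [h4, ← h6, h7, neg_zero]

/-- The expansion of a vector field in the coordinate frame. -/
theorem eq_sum_partialVF (X : M.VF V) : X = ∑ a, dfn X (c.zf hV a) • c.partialVF hV a := by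
  rw [← sub_eq_zero]
  refine c.vf_eq_zero hV fun b => ?_
  rw [dfn, act_sub, Op.sub_apply, sub_eq_zero]
  change dfn X _ = dfn _ _
  rw [dfn_sum_left]
  simp only [dfn_smul, dfn_partialVF, pd_zf]
  simp

/-- It suffices to test on coordinate functions, whose first derivatives are the constants 0 and 1.
-/
theorem bracket_partialVF (a b : CoordIdx m p n) :
    bracket (c.partialVF hV a) (c.partialVF hV b) = 0 := by
  refine c.vf_eq_zero hV fun d => ?_
  have h1 : ∀ q : Prop, [Decidable q] → ∀ e, c.pd hV e (if q then 1 else (0 : M.Fn V)) = 0 := by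
    intro q _ e
    split_ifs
    · simpa using c.pd_algebraMap hV e 1
    · exact c.pd_zero hV e
  rw [dfn_bracket (c.isHomog_partialVF hV a) (c.isHomog_partialVF hV b)]
  simp only [dfn_partialVF, pd_zf, h1]
  simp

/-- Partial derivatives supercommute. -/
theorem pd_comm (a b : CoordIdx m p n) (f : M.Fn V) :
    c.pd hV a (c.pd hV b f) = koszul (cpar a) (cpar b) • c.pd hV b (c.pd hV a f) := by
  have h := dfn_bracket (c.isHomog_partialVF hV a) (c.isHomog_partialVF hV b) f
  rw [bracket_partialVF, dfn_zero_left] at h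
  simp only [dfn_partialVF] at h
  exact sub_eq_zero.1 h.symm

end Chart

end Superspace

end

noncomputable section

theorem koszul_self_one : koszul 1 1 = -1 := by decide

namespace Superspace

variable {r : ℕ} {M : Superspace.{u} r} {U V W : Opens M.X}

/-! ### Connections -/

namespace Connection

variable (N : M.Connection)

/-- The covariant derivative along a vector field. -/
def along (X : M.VF U) : M.VF U →+ M.VF U := AddMonoidHom.mk' (N.nabla X) (N.add_right X)

/-- The covariant derivative of a vector field. -/
def deriv (Y : M.VF U) : M.VF U →+ M.VF U :=
  AddMonoidHom.mk' (fun X => N.nabla X Y) fun X X' => N.add_left X X' Y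

theorem nabla_zero (X : M.VF U) : N.nabla X 0 = 0 := map_zero (N.along X)

theorem zero_nabla (Y : M.VF U) : N.nabla 0 Y = 0 := map_zero (N.deriv Y)

theorem nabla_sum {ι : Type*} (s : Finset ι) (X : M.VF U) (Y : ι → M.VF U) :
    N.nabla X (∑ i ∈ s, Y i) = ∑ i ∈ s, N.nabla X (Y i) := map_sum (N.along X) Y s

theorem sum_nabla {ι : Type*} (s : Finset ι) (X : ι → M.VF U) (Y : M.VF U) :
    N.nabla (∑ i ∈ s, X i) Y = ∑ i ∈ s, N.nabla (X i) Y := map_sum (N.deriv Y) X s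

theorem nabla_zsmul (a : ℤ) (X Y : M.VF U) : N.nabla X (a • Y) = a • N.nabla X Y :=
  map_zsmul (N.along X) a Y

theorem smul_nabla (f : M.Fn U) (X Y : M.VF U) : N.nabla (f • X) Y = f • N.nabla X Y :=
  N.fsmul_left f X Y

theorem nabla_smul {k i : ZMod 2} {X : M.VF U} (hX : IsHomog k X) {f : M.Fn U}
    (hf : f ∈ M.gr U i) (Y : M.VF U) :
    N.nabla X (f • Y) = dfn X f • Y + koszul k i • f • N.nabla X Y :=
  N.leibniz k i X Y f hX hf

variable {N}

theorem Torsionless.bracket_eq (hT : N.Torsionless) {k l : ZMod 2} {X Y : M.VF U}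
    (hX : IsHomog k X) (hY : IsHomog l Y) :
    bracket X Y = N.nabla X Y - koszul k l • N.nabla Y X :=
  (sub_eq_zero.1 (hT U k l X Y hX hY)).symm

theorem Flat.nabla_comm (hF : N.Flat) {k l : ZMod 2} {X Y : M.VF U} (hX : IsHomog k X)
    (hY : IsHomog l Y) (h : bracket X Y = 0) (Z : M.VF U) :
    N.nabla X (N.nabla Y Z) = koszul k l • N.nabla Y (N.nabla X Z) := by
  have := hF U k l X Y Z hX hY
  rw [curvature, h, zero_nabla, sub_zero] at this
  exact sub_eq_zero.1 this

end Connection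

theorem IsHomog.eq_zero {k l : ZMod 2} (h : k ≠ l) {X : M.VF U} (hk : IsHomog k X)
    (hl : IsHomog l X) : X = 0 := by
  apply VF.ext
  funext j
  by_cases hj : j = k
  · exact hl j (hj ▸ h)
  · exact hk j hj

theorem add_part (i : ZMod 2) (f : M.Fn U) : M.part U i f + M.part U (i + 1) f = f := by
  conv_rhs => rw [← M.sum_part U f, zmod_two_univ i, Finset.sum_pair (zmod_two_ne i)]

namespace Chart

variable {m p n : ℕ} (c : M.Chart m p n) (hV : V ≤ c.dom) (hW : W ≤ c.dom)

/-! ### Frames -/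

/-- A homogeneous frame of the tangent sheaf, on an open subset of the domain of a chart. -/
structure IsFrame (e : CoordIdx m p n → M.VF V) : Prop where
  homog : ∀ b, IsHomog (cpar b) (e b)
  exists_matrix : ∃ Φ Ψ : Matrix (CoordIdx m p n) (CoordIdx m p n) (M.Fn V),
    Φ * Ψ = 1 ∧ Ψ * Φ = 1 ∧ ∀ b, e b = ∑ a, Φ b a • c.partialVF hV a

theorem isFrame_partialVF : c.IsFrame hV (c.partialVF hV) := by
  refine ⟨c.isHomog_partialVF hV, 1, 1, one_mul 1, one_mul 1, fun b => ?_⟩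
  simp [Matrix.one_apply, ite_smul]

theorem sum_mul_smul {ι κ : Type*} [Fintype ι] [Fintype κ] (f : ι → M.Fn V)
    (Φ : Matrix ι κ (M.Fn V)) (X : κ → M.VF V) :
    ∑ b, f b • ∑ a, Φ b a • X a = ∑ a, (∑ b, f b * Φ b a) • X a := by
  simp_rw [Finset.smul_sum, Finset.sum_smul, mul_smul]
  rw [Finset.sum_comm]

theorem sum_smul_partialVF_eq_zero {f : CoordIdx m p n → M.Fn V}
    (h : ∑ a, f a • c.partialVF hV a = 0) (b : CoordIdx m p n) : f b = 0 := by
  have h1 := congrArg (fun X => dfn X (c.zf hV b)) h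
  simp only [dfn_sum_left, dfn_smul, dfn_partialVF, pd_zf, dfn_zero_left] at h1
  simpa using h1

variable {c hV} {e : CoordIdx m p n → M.VF V}

namespace IsFrame

theorem exists_coeff (he : c.IsFrame hV e) (X : M.VF V) :
    ∃ f : CoordIdx m p n → M.Fn V, X = ∑ b, f b • e b := by
  obtain ⟨Φ, Ψ, -, h2, h3⟩ := he.exists_matrix
  refine ⟨fun b => ∑ a, dfn X (c.zf hV a) * Ψ a b, ?_⟩
  simp_rw [h3]
  rw [sum_mul_smul _ Φ]
  conv_lhs => rw [c.eq_sum_partialVF hV X]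
  refine Finset.sum_congr rfl fun a _ => ?_
  congr 1
  simp_rw [Finset.sum_mul, mul_assoc]
  rw [Finset.sum_comm]
  simp_rw [← Finset.mul_sum, ← Matrix.mul_apply, h2, Matrix.one_apply]
  simp

theorem eq_zero_of_sum (he : c.IsFrame hV e) {f : CoordIdx m p n → M.Fn V}
    (h : ∑ b, f b • e b = 0) (a : CoordIdx m p n) : f a = 0 := by
  obtain ⟨Φ, Ψ, h1, -, h3⟩ := he.exists_matrix
  simp_rw [h3] at h
  rw [sum_mul_smul _ Φ] at h
  have h4 := c.sum_smul_partialVF_eq_zero hV h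
  have h5 : ∑ d, (∑ b, f b * Φ b d) * Ψ d a = f a := by
    simp_rw [Finset.sum_mul, mul_assoc]
    rw [Finset.sum_comm]
    simp_rw [← Finset.mul_sum, ← Matrix.mul_apply, h1, Matrix.one_apply]
    simp
  rw [← h5]
  exact Finset.sum_eq_zero fun d _ => by rw [h4 d, zero_mul]

theorem ext (he : c.IsFrame hV e) {f g : CoordIdx m p n → M.Fn V}
    (h : ∑ b, f b • e b = ∑ b, g b • e b) (a : CoordIdx m p n) : f a = g a := by
  rw [← sub_eq_zero] at h ⊢
  rw [← Finset.sum_sub_distrib] at h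
  simp_rw [← sub_smul] at h
  exact he.eq_zero_of_sum h a

/-- The components of the coefficients of unexpected parity contribute a field homogeneous of parity
`k + 1`. Being the difference of two fields of parity `k`, it vanishes, and so do its coefficients.
-/
theorem coeff_mem (he : c.IsFrame hV e) {k : ZMod 2} {f : CoordIdx m p n → M.Fn V}
    (h : IsHomog k (∑ b, f b • e b)) (b : CoordIdx m p n) : f b ∈ M.gr V (k + cpar b) := by
  set X := ∑ b, M.part V (k + cpar b) (f b) • e b with hX
  set Y := ∑ b, M.part V (k + cpar b + 1) (f b) • e b with hY
  have hXY : X + Y = ∑ b, f b • e b := by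
    rw [hX, hY, ← Finset.sum_add_distrib]
    exact Finset.sum_congr rfl fun b _ => by rw [← add_smul, add_part]
  have hpar : ∀ k l : ZMod 2, k + l + l = k := by decide
  have hXh : IsHomog k X := isHomog_sum fun b _ =>
    (he.homog b).smul (M.part_mem V _ _) (hpar _ _)
  have hYh : IsHomog (k + 1) Y := isHomog_sum fun b _ =>
    (he.homog b).smul (M.part_mem V _ _) (by rw [add_right_comm, hpar])
  have hYk : IsHomog k Y := by
    intro l hl
    have h1 := h l hl
    rw [← hXY, VF.add_comp, hXh l hl, zero_add] at h1
    exact h1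
  have hY0 := hYh.eq_zero (zmod_two_ne k).symm hYk
  have := he.eq_zero_of_sum hY0 b
  rw [← add_part (k + cpar b) (f b), this, add_zero]
  exact M.part_mem V _ _

theorem transform (he : c.IsFrame hV e) {Φ Ψ : Matrix (CoordIdx m p n) (CoordIdx m p n) (M.Fn V)}
    (h1 : Φ * Ψ = 1) (h2 : Ψ * Φ = 1) (hΦ : ∀ b a, Φ b a ∈ M.gr V (cpar b + cpar a)) :
    c.IsFrame hV fun b => ∑ a, Φ b a • e a := by
  obtain ⟨Φ', Ψ', h1', h2', h3⟩ := he.exists_matrix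
  have hpar : ∀ k l : ZMod 2, k + l + l = k := by decide
  refine ⟨fun b => isHomog_sum fun a _ => (he.homog a).smul (hΦ b a) (hpar _ _),
    Φ * Φ', Ψ' * Ψ, ?_, ?_, fun b => ?_⟩
  · rw [mul_assoc, ← mul_assoc Φ', h1', one_mul, h1]
  · rw [mul_assoc, ← mul_assoc Ψ, h2, one_mul, h2']
  · simp_rw [h3]
    exact sum_mul_smul (Φ b) Φ' _

theorem restrict (he : c.IsFrame hV e) (h : W ≤ V) :
    c.IsFrame (h.trans hV) fun b => resVF h (e b) := by
  obtain ⟨Φ, Ψ, h1, h2, h3⟩ := he.exists_matrix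
  refine ⟨fun b => (he.homog b).resVF h, Φ.map (M.res h), Ψ.map (M.res h), ?_, ?_, fun b => ?_⟩
  · rw [← Matrix.map_mul, h1, Matrix.map_one _ (map_zero _) (map_one _)]
  · rw [← Matrix.map_mul, h2, Matrix.map_one _ (map_zero _) (map_one _)]
  · rw [h3, resVF_sum]
    exact Finset.sum_congr rfl fun a _ => resVF_smul h _ _

end IsFrame

end Chart

end Superspace

end

/-! ### Parallel transport equations in odd and formal coordinates -/

noncomputable section

theorem zmod_two_add_cancel (k l : ZMod 2) : k + (k + l) = l := by
  revert k l; decide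

theorem zmod_two_add_add (i j k : ZMod 2) : i + j + (j + k) = i + k := by
  revert i j k; decide

namespace Superspace

variable {r : ℕ} {M : Superspace.{u} r} {U V W : Opens M.X}

theorem odd_mul_self {f : M.Fn U} (hf : f ∈ M.gr U 1) : f * f = 0 := by
  have h := M.supercomm U 1 1 f f hf hf
  rw [koszul_self_one, neg_one_zsmul] at h
  have h2 : (2 : ℂ) • (f * f) = 0 := by rw [two_smul]; nth_rewrite 1 [h]; exact neg_add_cancel _
  exact (smul_eq_zero_iff_right two_ne_zero).1 h2

namespace Chart

open MvPowerSeries Metric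

variable {m p n : ℕ} (c : M.Chart m p n) (hV : V ≤ c.dom) (hW : W ≤ c.dom)

/-- Square matrices of functions, indexed by the coordinates. -/
abbrev FnMatrix (_ : M.Chart m p n) (V : Opens M.X) : Type u :=
  Matrix (CoordIdx m p n) (CoordIdx m p n) (M.Fn V)

/-- Matrices of functions which define even endomorphisms. -/
def EvenMatrix (Φ : c.FnMatrix V) : Prop := ∀ b a, Φ b a ∈ M.gr V (cpar b + cpar a)

variable {c}

theorem EvenMatrix.add {Φ Ψ : c.FnMatrix V} (hΦ : c.EvenMatrix Φ) (hΨ : c.EvenMatrix Ψ) :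
    c.EvenMatrix (Φ + Ψ) := fun b a => Submodule.add_mem _ (hΦ b a) (hΨ b a)

theorem EvenMatrix.smul {Φ : c.FnMatrix V} (hΦ : c.EvenMatrix Φ) (a : ℂ) :
    c.EvenMatrix (a • Φ) := fun _ _ => Submodule.smul_mem _ _ (hΦ _ _)

theorem EvenMatrix.mul {Φ Ψ : c.FnMatrix V} (hΦ : c.EvenMatrix Φ) (hΨ : c.EvenMatrix Ψ) :
    c.EvenMatrix (Φ * Ψ) := fun b a => by
  rw [Matrix.mul_apply]
  refine Submodule.sum_mem _ fun d _ => ?_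
  have := SetLike.mul_mem_graded (hΦ b d) (hΨ d a)
  rwa [zmod_two_add_add] at this

variable (c)

theorem evenMatrix_one : c.EvenMatrix (1 : c.FnMatrix V) := fun b a => by
  rw [Matrix.one_apply]
  split_ifs with h
  · rw [h, CharTwo.add_self_eq_zero]
    exact SetLike.one_mem_graded (M.gr V)
  · exact Submodule.zero_mem _

/-- A solution of a parallel transport equation in an odd coordinate. -/
theorem exists_gauge_odd (k : Fin n) {Γ : c.FnMatrix V}
    (hΓ : ∀ b a, Γ b a ∈ M.gr V (1 + (cpar b + cpar a)))
    (hint : ∀ b a, c.pd hV (.inr (.inr k)) (Γ b a) =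
      ∑ d, koszul 1 (cpar b + cpar d) • (Γ b d * Γ d a)) :
    ∃ Φ Ψ : c.FnMatrix V, Φ * Ψ = 1 ∧ Ψ * Φ = 1 ∧ c.EvenMatrix Φ ∧
      (∀ b a, c.pd hV (.inr (.inr k)) (Φ b a) +
        ∑ d, koszul 1 (cpar b + cpar d) • (Φ b d * Γ d a) = 0) ∧
      ∀ e ≠ .inr (.inr k), (∀ b a, c.pd hV e (Γ b a) = 0) → ∀ b a, c.pd hV e (Φ b a) = 0 := by
  set θ : M.Fn V := c.zf hV (.inr (.inr k)) with hθ
  have hθ1 : θ ∈ M.gr V 1 := c.zf_mem hV (.inr (.inr k))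
  have hθθ : θ * θ = 0 := odd_mul_self hθ1
  have hθΓ : ∀ b a d, θ * Γ b d * (θ * Γ d a) = 0 := by
    intro b a d
    rw [mul_assoc, ← mul_assoc (Γ b d), M.supercomm V _ _ _ _ (hΓ b d) hθ1, smul_mul_assoc,
      mul_smul_comm, mul_assoc θ, ← mul_assoc θ θ, hθθ, zero_mul, smul_zero]
  set K : c.FnMatrix V := θ • Γ with hK
  have hKK : K * K = 0 := by
    ext b a
    rw [Matrix.mul_apply]
    exact Finset.sum_eq_zero fun d _ => hθΓ b a d
  have hpdδ : ∀ e b a, c.pd hV e ((1 : c.FnMatrix V) b a) = 0 := by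
    intro e b a
    rw [Matrix.one_apply]
    split_ifs
    · simpa using c.pd_algebraMap hV e 1
    · exact c.pd_zero hV e
  -- The ansatz is `Φ = 1 - θ Γ`, with inverse `1 + θ Γ` because `θ * θ = 0`. As `Γ` may depend on
  -- `θ`, differentiation leaves a term `θ ∂Γ`, and the integrability hypothesis `hint` cancels it
  -- against the quadratic term.
  refine ⟨1 - K, 1 + K, ?_, ?_, ?_, ?_, ?_⟩
  · rw [sub_mul, mul_add, mul_add, hKK]; simp
  · rw [mul_sub, add_mul, add_mul, hKK]; simp
  · intro b a
    refine Submodule.sub_mem _ (c.evenMatrix_one b a) ?_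
    have := SetLike.mul_mem_graded hθ1 (hΓ b a)
    rwa [zmod_two_add_cancel] at this
  · intro b a
    have h1 : c.pd hV (.inr (.inr k)) ((1 - K) b a) =
        -(Γ b a - θ * c.pd hV (.inr (.inr k)) (Γ b a)) := by
      change c.pd hV _ ((1 : c.FnMatrix V) b a - θ * Γ b a) = _
      rw [pd_sub, hpdδ, c.pd_mul hV _ hθ1, pd_zf, if_pos rfl]
      change 0 - (1 * _ + koszul 1 1 • _) = _
      rw [koszul_self_one, neg_one_zsmul, one_mul, zero_sub, sub_eq_add_neg]
    have h2 : ∀ d, koszul 1 (cpar b + cpar d) • ((1 - K) b d * Γ d a) =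
        (if b = d then Γ d a else 0) - θ * (koszul 1 (cpar b + cpar d) • (Γ b d * Γ d a)) := by
      intro d
      change koszul 1 (cpar b + cpar d) • (((1 : c.FnMatrix V) b d - θ * Γ b d) * Γ d a) = _
      rw [sub_mul, smul_sub, Matrix.one_apply, mul_assoc, mul_smul_comm]
      congr 1
      split_ifs with h
      · rw [h, CharTwo.add_self_eq_zero, koszul_comm, koszul_zero_left, one_smul, one_mul]
      · rw [zero_mul, smul_zero]
    simp_rw [h2]
    rw [h1, Finset.sum_sub_distrib, ← Finset.mul_sum, ← hint, Finset.sum_ite_eq,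
      if_pos (Finset.mem_univ _)]
    abel
  · intro e he hΓe b a
    change c.pd hV _ ((1 : c.FnMatrix V) b a - θ * Γ b a) = 0
    rw [pd_sub, hpdδ, c.pd_mul hV _ hθ1, hΓe, hθ, pd_zf, if_neg he]
    simp

/-- The sum of the matrices `y_j ^ k G_k`. -/
def ysumMat (j : Fin p) (G : ℕ → c.FnMatrix V) : c.FnMatrix V :=
  Matrix.of fun b a => c.ysumFn hV j fun k => G k b a

theorem ysumMat_apply (j : Fin p) (G : ℕ → c.FnMatrix V) (b a : CoordIdx m p n) :
    c.ysumMat hV j G b a = c.ysumFn hV j fun k => G k b a := rfl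

theorem ysumMat_mul (j : Fin p) (G : ℕ → c.FnMatrix V) (H : c.FnMatrix V) :
    c.ysumMat hV j G * H = c.ysumMat hV j fun k => G k * H := by
  ext b a
  simp only [Matrix.mul_apply, ysumMat_apply, ysumFn_mul]
  exact (c.ysumFn_sum hV _ j _).symm

theorem mul_ysumMat (j : Fin p) (G : ℕ → c.FnMatrix V) (H : c.FnMatrix V) :
    H * c.ysumMat hV j G = c.ysumMat hV j fun k => H * G k := by
  ext b a
  simp only [Matrix.mul_apply, ysumMat_apply, mul_ysumFn]
  exact (c.ysumFn_sum hV _ j _).symm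

theorem ysumMat_eq (j : Fin p) (G : ℕ → c.FnMatrix V) : c.ysumMat hV j G =
    G 0 + c.zf hV (.inr (.inl j)) • c.ysumMat hV j fun k => G (k + 1) := by
  ext b a
  exact c.ysumFn_eq hV j _

/-- A solution of a parallel transport equation in a formal coordinate. -/
theorem exists_gauge_formal (j : Fin p) {Γ : c.FnMatrix V} (hΓ : c.EvenMatrix Γ) :
    ∃ Φ Ψ : c.FnMatrix V, Φ * Ψ = 1 ∧ Ψ * Φ = 1 ∧ c.EvenMatrix Φ ∧
      (∀ b a, c.pd hV (.inr (.inl j)) (Φ b a) + (Φ * Γ) b a = 0) ∧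
      ∀ e ≠ .inr (.inl j), (∀ b a, c.pd hV e (Γ b a) = 0) → ∀ b a, c.pd hV e (Φ b a) = 0 := by
  set y : M.Fn V := c.zf hV (.inr (.inl j)) with hy
  have hy0 : y ∈ M.gr V 0 := c.zf_mem hV (.inr (.inl j))
  have hyc : ∀ G H : c.FnMatrix V, G * (y • H) = y • (G * H) := by
    intro G H
    ext b a
    simp only [Matrix.mul_apply, Matrix.smul_apply, smul_eq_mul, Finset.mul_sum]
    refine Finset.sum_congr rfl fun d _ => ?_
    rw [← mul_assoc, ← M.even_comm V hy0, mul_assoc]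
  -- `Φ` is the sum of the `y ^ k P k`, where `∂ (P k) + (k + 1) P (k + 1) + P k Γ = 0` and `P 0 =
  -- 1`. Since the `P k` may depend on `y`, there is no need to expand `Γ` in powers of `y`.
  let P : ℕ → c.FnMatrix V := fun k => Nat.rec 1
    (fun k Q => (-((k : ℂ) + 1)⁻¹) • (Q.map (c.pd hV (.inr (.inl j))) + Q * Γ)) k
  have hPs : ∀ k, P (k + 1) =
      (-((k : ℂ) + 1)⁻¹) • ((P k).map (c.pd hV (.inr (.inl j))) + P k * Γ) := fun k => rfl
  have hPe : ∀ k, c.EvenMatrix (P k) := by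
    intro k
    induction k with
    | zero => exact c.evenMatrix_one
    | succ k ih =>
      rw [hPs]
      refine EvenMatrix.smul (EvenMatrix.add (fun b a => ?_) (ih.mul hΓ)) _
      have := c.pd_mem hV (.inr (.inl j)) (ih b a)
      change _ ∈ M.gr V (0 + _) at this
      rwa [zero_add] at this
  set Φ := c.ysumMat hV j P with hΦ
  set K := -c.ysumMat hV j fun k => P (k + 1) with hK
  have hΦK : Φ = 1 - y • K := by
    rw [hΦ, ysumMat_eq, hK, smul_neg, sub_neg_eq_add]
    rfl
  -- The inverse of `1 - y K` is its Neumann series, which always converges formally.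
  set Ψ := c.ysumMat hV j fun k => K ^ k with hΨ
  have h1 : Ψ = 1 + y • (K * Ψ) := by
    rw [hΨ, mul_ysumMat]
    simp_rw [← pow_succ']
    conv_lhs => rw [ysumMat_eq, pow_zero]
  have h2 : Ψ = 1 + y • (Ψ * K) := by
    rw [hΨ, ysumMat_mul]
    simp_rw [← pow_succ]
    conv_lhs => rw [ysumMat_eq, pow_zero]
  refine ⟨Φ, Ψ, ?_, ?_, fun b a => ?_, fun b a => ?_, fun e he hΓe b a => ?_⟩
  · rw [hΦK, sub_mul, one_mul, smul_mul_assoc, sub_eq_iff_eq_add]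
    exact h1
  · rw [hΦK, mul_sub, mul_one, hyc, sub_eq_iff_eq_add]
    exact h2
  · exact c.ysumFn_mem hV j fun k => hPe k b a
  · rw [hΦ, ysumMat_mul, ysumMat_apply, ysumMat_apply, pd_ysumFn_same, ← ysumFn_add]
    have h0 : ∀ k, c.pd hV (.inr (.inl j)) (P k b a) + ((k : ℂ) + 1) • P (k + 1) b a +
        (P k * Γ) b a = 0 := by
      intro k
      have hk : (k : ℂ) + 1 ≠ 0 := Nat.cast_add_one_ne_zero k
      rw [hPs, Matrix.smul_apply, Matrix.add_apply, Matrix.map_apply, smul_smul, mul_neg,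
        mul_inv_cancel₀ hk, neg_one_smul]
      abel
    simp_rw [h0]
    exact c.ysumFn_zero hV j
  · have h0 : ∀ k b a, c.pd hV e (P k b a) = 0 := by
      intro k
      induction k with
      | zero =>
        intro b a
        change c.pd hV e ((1 : c.FnMatrix V) b a) = 0
        rw [Matrix.one_apply]
        split_ifs
        · simpa using c.pd_algebraMap hV e 1
        · exact c.pd_zero hV e
      | succ k ih =>
        intro b a
        rw [hPs, Matrix.smul_apply, pd_smul, Matrix.add_apply, pd_add, Matrix.map_apply,
          c.pd_comm_even hV (e := .inr (.inl j)) rfl, ih, pd_zero, Matrix.mul_apply,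
          ← dfn_partialVF, dfn_sum]
        rw [Finset.sum_eq_zero, add_zero, smul_zero]
        intro d _
        rw [dfn_partialVF, c.pd_mul hV e (hPe k b d), ih, hΓe]
        simp
    rw [hΦ, ysumMat_apply, c.pd_ysumFn_ne hV he]
    simp_rw [h0]
    exact c.ysumFn_zero hV j

end Chart

end Superspace

end

/-! ### Parallel transport in an analytic coordinate -/

noncomputable section

namespace Superspace

/-- Even matrices over the exterior algebra which do not depend on the odd coordinates. -/
def gaugeSubalgebra (r m p n : ℕ) :
    Subalgebra ℂ (Matrix (CoordIdx m p n) (CoordIdx m p n) (ModelExterior r n)) where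
  carrier := {A | ∀ b a, A b a ∈ extParity ((Fin r → ℂ) × (Fin n → ℂ)) (cpar b + cpar a) ∧
    ∀ k, thetaDeriv k (A b a) = 0}
  add_mem' {A B} hA hB b a := ⟨Submodule.add_mem _ (hA b a).1 (hB b a).1, fun k => by
    rw [Matrix.add_apply, map_add, (hA b a).2, (hB b a).2, add_zero]⟩
  mul_mem' {A B} hA hB b a := by
    simp only [Matrix.mul_apply, map_sum]
    refine ⟨Submodule.sum_mem _ fun d _ => ?_, fun k => Finset.sum_eq_zero fun d _ => ?_⟩
    · have := SetLike.mul_mem_graded (hA b d).1 (hB d a).1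
      rwa [zmod_two_add_add] at this
    · rw [thetaDeriv_mul k (hA b d).1, (hA b d).2, (hB d a).2, zero_mul, mul_zero, smul_zero,
        add_zero]
  algebraMap_mem' z b a := by
    rw [Matrix.algebraMap_matrix_apply]
    split_ifs with h
    · rw [h, CharTwo.add_self_eq_zero]
      exact ⟨algebraMap_mem_extParity z, fun k => thetaDeriv_algebraMap k z⟩
    · exact ⟨Submodule.zero_mem _, fun k => map_zero _⟩

/-- The algebra of even matrices over the exterior algebra which do not depend on the odd
coordinates. -/
def GaugeAlgebra (r m p n : ℕ) : Type := gaugeSubalgebra r m p n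

namespace GaugeAlgebra

variable {r m p n : ℕ}

instance : Ring (GaugeAlgebra r m p n) := inferInstanceAs (Ring (gaugeSubalgebra r m p n))

instance : Algebra ℂ (GaugeAlgebra r m p n) :=
  inferInstanceAs (Algebra ℂ (gaugeSubalgebra r m p n))

instance : Module.Finite ℂ (GaugeAlgebra r m p n) :=
  inferInstanceAs (Module.Finite ℂ (Subalgebra.toSubmodule (gaugeSubalgebra r m p n)))

instance : NormedRing (GaugeAlgebra r m p n) := finiteNormedRing _

instance : NormedAlgebra ℂ (GaugeAlgebra r m p n) := finiteNormedAlgebra _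

instance : CompleteSpace (GaugeAlgebra r m p n) := FiniteDimensional.complete ℂ _

/-- The entries of a matrix. -/
def entries : GaugeAlgebra r m p n →ₗ[ℂ] (CoordIdx m p n → CoordIdx m p n → ModelExterior r n) :=
  (gaugeSubalgebra r m p n).val.toLinearMap

theorem entries_injective : Function.Injective (entries (r := r) (m := m) (p := p) (n := n)) :=
  Subtype.val_injective

/-- A linear retraction carries holomorphy of the entries over to holomorphy with values in
`GaugeAlgebra`. Solving the differential equation inside this algebra makes the solution even and
independent of odd coordinates automatically. -/
theorem exists_retraction : ∃ L : (CoordIdx m p n → CoordIdx m p n → ModelExterior r n) →ₗ[ℂ]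
    GaugeAlgebra r m p n, ∀ A ∈ gaugeSubalgebra r m p n, entries (L A) = A := by
  obtain ⟨L, hL⟩ := LinearMap.exists_leftInverse_of_injective entries
    (LinearMap.ker_eq_bot.2 (entries_injective (r := r) (m := m) (p := p) (n := n)))
  refine ⟨L, fun A hA => ?_⟩
  have := LinearMap.congr_fun hL (⟨A, hA⟩ : gaugeSubalgebra r m p n)
  exact congrArg entries this

theorem entries_one (b a : CoordIdx m p n) :
    entries (1 : GaugeAlgebra r m p n) b a = if b = a then 1 else 0 := Matrix.one_apply

theorem entries_mul (A B : GaugeAlgebra r m p n) (b a : CoordIdx m p n) :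
    entries (A * B) b a = ∑ d, entries A b d * entries B d a := rfl

theorem entries_mem (A : GaugeAlgebra r m p n) (b a : CoordIdx m p n) :
    entries A b a ∈ extParity ((Fin r → ℂ) × (Fin n → ℂ)) (cpar b + cpar a) := (A.2 b a).1

theorem thetaDeriv_entries (A : GaugeAlgebra r m p n) (b a : CoordIdx m p n) (k : Fin n) :
    thetaDeriv k (entries A b a) = 0 := (A.2 b a).2 k

/-- An entry of a matrix. -/
def entry (b a : CoordIdx m p n) : GaugeAlgebra r m p n →ₗ[ℂ] ModelExterior r n :=
  (LinearMap.proj a).comp ((LinearMap.proj b).comp entries)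

theorem entry_apply (b a : CoordIdx m p n) (A : GaugeAlgebra r m p n) :
    entry b a A = entries A b a := rfl

end GaugeAlgebra

namespace Chart

open MvPowerSeries Metric

variable {r m p n : ℕ} {M : Superspace.{u} r} (c : M.Chart m p n) {V W : Opens M.X}
  (hV : V ≤ c.dom) (hW : W ≤ c.dom)

theorem val_sum {ι : Type*} (s : Finset ι) (f : ι → M.Fn V) {z : Fin m → ℂ}
    (hz : z ∈ c.coord '' V) : c.val hV (∑ i ∈ s, f i) z = ∑ i ∈ s, c.val hV (f i) z :=
  map_sum (AddMonoidHom.mk' (fun g : M.Fn V => c.val hV g z) (c.val_add hV hz)) f s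

/-- The functions with given entries, from a holomorphic function with values in matrices. -/
theorem exists_fnMatrix {G : (Fin m → ℂ) → GaugeAlgebra r m p n}
    (hG : DifferentiableOn ℂ G (c.coord '' V)) : ∃ Φ : c.FnMatrix V, c.EvenMatrix Φ ∧
      ∀ b a, ∀ z ∈ c.coord '' V, c.val hV (Φ b a) z = C (GaugeAlgebra.entry b a (G z)) := by
  classical
  have hd : ∀ (b a : CoordIdx m p n) (d : Fin p →₀ ℕ), DifferentiableOn ℂ (fun z => coeff d
      (C (GaugeAlgebra.entry b a (G z)) : MvPowerSeries (Fin p) (ModelExterior r n)))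
      (c.coord '' V) := by
    intro b a d
    simp only [coeff_C]
    split_ifs
    · exact (LinearMap.toContinuousLinearMap
        (GaugeAlgebra.entry (r := r) b a)).differentiable.comp_differentiableOn hG
    · exact differentiableOn_const _
  refine ⟨Matrix.of fun b a => c.ofVal hV _ (hd b a), fun b a => ?_,
    fun b a z hz => c.val_ofVal hV (hd b a) hz⟩
  rw [c.mem_gr_iff hV]
  intro z hz d
  rw [Matrix.of_apply, c.val_ofVal hV _ hz, coeff_C]
  split_ifs
  · exact GaugeAlgebra.entries_mem _ b a
  · exact Submodule.zero_mem _

/-- A solution of a parallel transport equation in an analytic coordinate. -/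
theorem exists_gauge_analytic {x : M.X} (hx : x ∈ V) {R : ℝ} (hR : 0 < R)
    (hB : c.coord '' V = ball (c.coord x) R) (i : Fin m) {Γ : c.FnMatrix V}
    (hΓ : c.EvenMatrix Γ) (hΓc : ∀ b a q, c.pd hV (.inr q) (Γ b a) = 0) :
    ∃ (W : Opens M.X) (h : W ≤ V), x ∈ W ∧ ∃ R' > 0, c.coord '' W = ball (c.coord x) R' ∧
    ∃ Φ Ψ : c.FnMatrix W, Φ * Ψ = 1 ∧ Ψ * Φ = 1 ∧ c.EvenMatrix Φ ∧
      (∀ b a, c.pd (h.trans hV) (.inl i) (Φ b a) + ∑ d, Φ b d * M.res h (Γ d a) = 0) ∧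
      ∀ e ≠ .inl i, (∀ b a, c.pd hV e (Γ b a) = 0) →
        ∀ b a, c.pd (h.trans hV) e (Φ b a) = 0 := by
  classical
  let γ : (Fin m → ℂ) → CoordIdx m p n → CoordIdx m p n → ModelExterior r n :=
    -- `Γ` does not depend on the formal and odd coordinates, so its values are constant series and
    -- `γ` loses no information.
    fun z b a => coeff 0 (c.val hV (Γ b a) z)
  have hγval : ∀ z ∈ c.coord '' V, ∀ b a, c.val hV (Γ b a) z = C (γ z b a) := by
    intro z hz b a
    refine eq_C_of_yderiv_eq_zero fun j => ?_
    have := c.val_pd hV (.inr (.inl j)) (Γ b a) hz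
    rw [hΓc, val_zero _ _ hz] at this
    exact this.symm
  have hγmem : ∀ z ∈ c.coord '' V, γ z ∈ gaugeSubalgebra r m p n := by
    intro z hz b a
    refine ⟨(c.mem_gr_iff hV).1 (hΓ b a) z hz 0, fun k => ?_⟩
    have := c.val_pd hV (.inr (.inr k)) (Γ b a) hz
    rw [hΓc, val_zero _ _ hz] at this
    have h2 := congrArg (coeff 0) this
    rw [coeff_pdVal_odd, coeff_zero] at h2
    exact h2.symm
  have hγd : DifferentiableOn ℂ γ (ball (c.coord x) R) := by
    rw [← hB, differentiableOn_pi]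
    intro b
    rw [differentiableOn_pi]
    exact fun a => c.differentiableOn_coeff_val hV (Γ b a) 0
  obtain ⟨L, hL⟩ := GaugeAlgebra.exists_retraction (r := r) (m := m) (p := p) (n := n)
  have hG : DifferentiableOn ℂ (fun z => L (γ z)) (ball (c.coord x) R) :=
    (LinearMap.toContinuousLinearMap L).differentiable.comp_differentiableOn hγd
  obtain ⟨R', hR', hR'R, Φ, Ψ, hΦ, hΨ, h1, h2, h3, h4⟩ := exists_linear_ode_solution hR hG i
  have hsub : ball (c.coord x) R' ⊆ c.coord '' V := hB ▸ ball_subset_ball hR'R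
  obtain ⟨W, hWV, hWi, hWm⟩ := c.exists_opens_image_eq hV isOpen_ball hsub
  have hWd := hWV.trans hV
  rw [← hWi] at hΦ hΨ h1 h2 h3 h4 hsub
  obtain ⟨Φf, hΦe, hΦv⟩ := c.exists_fnMatrix hWd hΦ
  obtain ⟨Ψf, -, hΨv⟩ := c.exists_fnMatrix hWd hΨ
  have hΦd : ∀ z ∈ c.coord '' W, DifferentiableAt ℂ Φ z := fun z hz =>
    hΦ.differentiableAt ((c.isOpen_image hWd).mem_nhds hz)
  have hpd : ∀ b a j, ∀ z ∈ c.coord '' W, c.val hWd (c.pd hWd (.inl j) (Φf b a)) z =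
      C (GaugeAlgebra.entry b a (pderivC j Φ z)) := by
    intro b a j z hz
    rw [val_pd _ _ _ _ hz, pdVal_congr _ (c.isOpen_image hWd) (hΦv b a) hz]
    ext d : 1
    rw [coeff_pdVal_inl]
    simp only [coeff_C]
    split_ifs
    · exact pderivC_linear _ (hΦd z hz) j
    · exact pderivC_const _ _ _
  refine ⟨W, hWV, hWm x hx (mem_ball_self hR'), R', hR', hWi, Φf, Ψf, ?_, ?_, hΦe, ?_, ?_⟩
  · ext b a
    refine c.ext_val hWd fun z hz => ?_
    rw [Matrix.mul_apply, val_sum _ _ _ _ hz]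
    simp_rw [val_mul _ _ hz, hΦv _ _ z hz, hΨv _ _ z hz, ← map_mul]
    rw [← map_sum, Matrix.one_apply, apply_ite (fun f : M.Fn W => c.val hWd f z), val_one _ _ hz,
      val_zero _ _ hz]
    have := congrArg (fun A => GaugeAlgebra.entries A b a) (h1 z hz)
    simp only [GaugeAlgebra.entries_mul, GaugeAlgebra.entries_one] at this
    simp only [GaugeAlgebra.entry_apply, this]
    split_ifs <;> simp
  · ext b a
    refine c.ext_val hWd fun z hz => ?_
    rw [Matrix.mul_apply, val_sum _ _ _ _ hz]
    simp_rw [val_mul _ _ hz, hΦv _ _ z hz, hΨv _ _ z hz, ← map_mul]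
    rw [← map_sum, Matrix.one_apply, apply_ite (fun f : M.Fn W => c.val hWd f z), val_one _ _ hz,
      val_zero _ _ hz]
    have := congrArg (fun A => GaugeAlgebra.entries A b a) (h2 z hz)
    simp only [GaugeAlgebra.entries_mul, GaugeAlgebra.entries_one] at this
    simp only [GaugeAlgebra.entry_apply, this]
    split_ifs <;> simp
  · intro b a
    refine c.ext_val hWd fun z hz => ?_
    have hG' : ∀ b a, GaugeAlgebra.entries (L (γ z)) b a = γ z b a := fun b a => by
      rw [hL _ (hγmem z (hsub hz))]
    rw [val_add _ _ hz, hpd b a i z hz, val_sum _ _ _ _ hz, val_zero _ _ hz, h3 z hz, map_neg,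
      GaugeAlgebra.entry_apply, GaugeAlgebra.entries_mul]
    simp_rw [hG', val_mul _ _ hz, hΦv _ _ z hz, c.val_res hV hWd hWV _ hz, hγval z (hsub hz),
      ← map_mul, ← map_sum, GaugeAlgebra.entry_apply]
    rw [← map_add, neg_add_cancel, map_zero]
  · intro e he hΓe b a
    refine c.ext_val hWd fun z hz => ?_
    rw [val_zero _ _ hz]
    match e with
    | .inl j =>
      rw [hpd b a j z hz, h4 j (fun h => he (by rw [h])) ?_ z hz, map_zero, map_zero]
      intro w hw
      have hγw : DifferentiableAt ℂ γ w := hγd.differentiableAt (isOpen_ball.mem_nhds hw)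
      rw [pderivC_linear L hγw]
      have h0 : pderivC j γ w = 0 := by
        funext b a
        have h5 := pderivC_linear (LinearMap.comp
          (LinearMap.proj a : (CoordIdx m p n → ModelExterior r n) →ₗ[ℂ] ModelExterior r n)
          (LinearMap.proj b)) hγw j
        refine Eq.trans h5.symm ?_
        rw [← hB] at hw
        have h6 := c.val_pd hV (.inl j) (Γ b a) hw
        rw [hΓe, val_zero _ _ hw] at h6
        exact (congrArg (coeff 0) h6).symm
      rw [h0, map_zero]
    | .inr (.inl j) =>
      rw [val_pd _ _ _ _ hz]
      exact (congrArg _ (hΦv b a z hz)).trans (yderiv_C j _)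
    | .inr (.inr k) =>
      rw [val_pd _ _ _ _ hz]
      refine (congrArg (mapCoeff (thetaDeriv k)) (hΦv b a z hz)).trans ?_
      rw [mapCoeff_C, GaugeAlgebra.entry_apply, GaugeAlgebra.thetaDeriv_entries, map_zero]

end Chart

end Superspace

end

/-! ### Local frames of flat vector fields -/

noncomputable section

namespace Superspace

variable {r : ℕ} {M : Superspace.{u} r} {U V W : Opens M.X}

theorem VF.eq_zero_of_eq_neg {X : M.VF U} (h : X = -X) : X = 0 := by
  have h1 : (2 : M.Fn U) • X = 0 := by rw [two_smul]; nth_rewrite 1 [h]; exact neg_add_cancel X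
  have h2 : algebraMap ℂ (M.Fn U) (2⁻¹) * 2 = 1 := by
    rw [← map_ofNat (algebraMap ℂ (M.Fn U)) 2, ← map_mul, inv_mul_cancel₀ two_ne_zero, map_one]
  rw [← one_smul (M.Fn U) X, ← h2, mul_smul, h1, smul_zero]

namespace Chart

open Metric

variable {m p n : ℕ} {c : M.Chart m p n} {hV : V ≤ c.dom} (N : M.Connection)

/-- The vector fields `e b` are parallel along the coordinates in `S`. -/
def IsParallel (hV : V ≤ c.dom) (e : CoordIdx m p n → M.VF V) (S : Finset (CoordIdx m p n)) :
    Prop := ∀ a ∈ S, ∀ b, N.nabla (c.partialVF hV a) (e b) = 0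

variable {N} {e : CoordIdx m p n → M.VF V} {S : Finset (CoordIdx m p n)}

theorem IsParallel.restrict (hS : IsParallel N hV e S) (h : W ≤ V) :
    IsParallel N (h.trans hV) (fun b => resVF h (e b)) S := fun a ha b => by
  have := congrArg (resVF h) (hS a ha b)
  rwa [N.nabla_res] at this

theorem nabla_partialVF_smul {i : ZMod 2} {f : M.Fn V} (hf : f ∈ M.gr V i)
    (a : CoordIdx m p n) (X : M.VF V) : N.nabla (c.partialVF hV a) (f • X) =
      c.pd hV a f • X + koszul (cpar a) i • f • N.nabla (c.partialVF hV a) X := by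
  rw [N.nabla_smul (c.isHomog_partialVF hV a) hf, dfn_partialVF]

namespace IsFrame

/-- The connection matrix of a frame, in the direction of a coordinate. -/
theorem exists_connectionMatrix (hF : N.Flat) (he : c.IsFrame hV e) (hS : IsParallel N hV e S)
    (z : CoordIdx m p n) : ∃ Γ : c.FnMatrix V,
      (∀ b, N.nabla (c.partialVF hV z) (e b) = ∑ a, Γ b a • e a) ∧
      (∀ b a, Γ b a ∈ M.gr V (cpar z + (cpar b + cpar a))) ∧
      ∀ d ∈ S, ∀ b a, c.pd hV d (Γ b a) = 0 := by
  choose Γ hΓ using fun b => he.exists_coeff (N.nabla (c.partialVF hV z) (e b))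
  have hmem : ∀ b a, Γ b a ∈ M.gr V (cpar z + (cpar b + cpar a)) := by
    intro b a
    have := N.homog _ _ _ _ (c.isHomog_partialVF hV z) (he.homog b)
    rw [hΓ] at this
    rw [← add_assoc]
    exact he.coeff_mem this a
  refine ⟨Γ, hΓ, hmem, fun d hd b a => ?_⟩
  refine he.eq_zero_of_sum (f := fun a => c.pd hV d (Γ b a)) ?_ a
  -- By flatness the covariant derivatives along `d` and `z` supercommute. As `e b` is parallel
  -- along `d`, so is its derivative along `z`; its coefficients in a frame parallel along `d` are
  -- therefore killed by `∂_d`.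
  have h1 := hF.nabla_comm (c.isHomog_partialVF hV d) (c.isHomog_partialVF hV z)
    (c.bracket_partialVF hV d z) (e b)
  rw [hS d hd b, N.nabla_zero, smul_zero, hΓ, N.nabla_sum] at h1
  rw [← h1]
  refine Finset.sum_congr rfl fun a _ => ?_
  rw [nabla_partialVF_smul (hmem b a), hS d hd a, smul_zero, smul_zero, add_zero]

/-- An odd coordinate field supercommutes with itself, so flatness makes the square of its covariant
derivative equal to its own negative, hence zero. The equation is this vanishing read in the frame.
-/
theorem connectionMatrix_integrable (hF : N.Flat) (he : c.IsFrame hV e) {k : Fin n}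
    {Γ : c.FnMatrix V}
    (hΓ : ∀ b, N.nabla (c.partialVF hV (.inr (.inr k))) (e b) = ∑ a, Γ b a • e a)
    (hmem : ∀ b a, Γ b a ∈ M.gr V (1 + (cpar b + cpar a))) (b a : CoordIdx m p n) :
    c.pd hV (.inr (.inr k)) (Γ b a) = ∑ d, koszul 1 (cpar b + cpar d) • (Γ b d * Γ d a) := by
  have h1 := hF.nabla_comm (c.isHomog_partialVF hV (.inr (.inr k)))
    (c.isHomog_partialVF hV (.inr (.inr k))) (c.bracket_partialVF hV _ _) (e b)
  rw [show koszul (cpar (.inr (.inr k) : CoordIdx m p n)) (cpar (.inr (.inr k) : CoordIdx m p n))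
    = -1 from koszul_self_one, neg_one_zsmul] at h1
  have h2 := VF.eq_zero_of_eq_neg h1
  rw [hΓ, N.nabla_sum] at h2
  have h3 : ∀ d, N.nabla (c.partialVF hV (.inr (.inr k))) (Γ b d • e d) =
      c.pd hV (.inr (.inr k)) (Γ b d) • e d -
        (koszul 1 (cpar b + cpar d) • Γ b d) • ∑ a, Γ d a • e a := by
    intro d
    rw [nabla_partialVF_smul (hmem b d), hΓ]
    change _ + koszul 1 _ • _ = _
    rw [koszul_comm, koszul_add_left, koszul_self_one, neg_one_mul, neg_smul, sub_eq_add_neg,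
      koszul_comm, smul_assoc]
  simp_rw [h3] at h2
  rw [Finset.sum_sub_distrib, sum_mul_smul _ Γ, sub_eq_zero] at h2
  rw [he.ext h2 a]
  exact Finset.sum_congr rfl fun d _ => smul_mul_assoc _ _ _

/-- A change of frame which solves the parallel transport equation in a further coordinate. -/
theorem isParallel_transform (hS : IsParallel N hV e S) {z : CoordIdx m p n} (hz : z ∉ S)
    {Γ Φ : c.FnMatrix V} (hΓ : ∀ b, N.nabla (c.partialVF hV z) (e b) = ∑ a, Γ b a • e a)
    (hΦ : c.EvenMatrix Φ) (hΦz : ∀ b a, c.pd hV z (Φ b a) +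
      ∑ d, koszul (cpar z) (cpar b + cpar d) • (Φ b d * Γ d a) = 0)
    (hΦS : ∀ d ∈ S, d ≠ z → ∀ b a, c.pd hV d (Φ b a) = 0) :
    IsParallel N hV (fun b => ∑ a, Φ b a • e a) (insert z S) := by
  intro d hd b
  rw [N.nabla_sum]
  rcases Finset.mem_insert.1 hd with rfl | hd
  · have h3 : ∀ q, N.nabla (c.partialVF hV d) (Φ b q • e q) = c.pd hV d (Φ b q) • e q +
        (koszul (cpar d) (cpar b + cpar q) • Φ b q) • ∑ a, Γ q a • e a := fun q => by
      rw [nabla_partialVF_smul (hΦ b q), hΓ, smul_assoc]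
    simp_rw [h3]
    rw [Finset.sum_add_distrib, sum_mul_smul _ Γ, ← Finset.sum_add_distrib]
    refine Finset.sum_eq_zero fun a _ => ?_
    rw [← add_smul]
    simp_rw [smul_mul_assoc]
    rw [hΦz, zero_smul]
  · have hdz : d ≠ z := fun h => hz (h ▸ hd)
    refine Finset.sum_eq_zero fun a _ => ?_
    rw [nabla_partialVF_smul (hΦ b a), hΦS d hd hdz, hS d hd, zero_smul, smul_zero, smul_zero,
      add_zero]

/-- Formal and odd transport is algebraic, so the neighbourhood is not shrunk. -/
theorem exists_parallel_insert_inr (hF : N.Flat) (he : c.IsFrame hV e) (hS : IsParallel N hV e S)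
    {q : Fin p ⊕ Fin n} (hq : .inr q ∉ S) :
    ∃ e', c.IsFrame hV e' ∧ IsParallel N hV e' (insert (.inr q) S) := by
  obtain ⟨Γ, hΓ, hmem, hΓS⟩ := he.exists_connectionMatrix hF hS (.inr q)
  match q with
  | .inl j =>
    have hΓe : c.EvenMatrix Γ := fun b a => by
      have := hmem b a
      change _ ∈ M.gr V (0 + _) at this
      rwa [zero_add] at this
    obtain ⟨Φ, Ψ, h1, h2, h3, h4, h5⟩ := c.exists_gauge_formal hV j hΓe
    refine ⟨_, he.transform h1 h2 h3, isParallel_transform hS hq hΓ h3 (fun b a => ?_)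
      fun d hd hdz => h5 d hdz (hΓS d hd)⟩
    rw [← h4 b a, Matrix.mul_apply]
    congr 1
    refine Finset.sum_congr rfl fun d _ => ?_
    change koszul 0 _ • _ = _
    rw [koszul_zero_left, one_smul]
  | .inr k =>
    obtain ⟨Φ, Ψ, h1, h2, h3, h4, h5⟩ := c.exists_gauge_odd hV k hmem
      (he.connectionMatrix_integrable hF hΓ hmem)
    exact ⟨_, he.transform h1 h2 h3, isParallel_transform hS hq hΓ h3 h4
      fun d hd hdz => h5 d hdz (hΓS d hd)⟩

/-- The condition `hSq` makes the connection matrix independent of formal and odd coordinates, as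
the analytic equation requires. -/
theorem exists_parallel_insert_inl (hF : N.Flat) (he : c.IsFrame hV e) (hS : IsParallel N hV e S)
    {x : M.X} (hx : x ∈ V) {R : ℝ} (hR : 0 < R) (hB : c.coord '' V = ball (c.coord x) R)
    {i : Fin m} (hi : .inl i ∉ S) (hSq : ∀ q, .inr q ∈ S) :
    ∃ (W : Opens M.X) (h : W ≤ V), x ∈ W ∧ ∃ R' > 0, c.coord '' W = ball (c.coord x) R' ∧
      ∃ e', c.IsFrame (h.trans hV) e' ∧ IsParallel N (h.trans hV) e' (insert (.inl i) S) := by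
  obtain ⟨Γ, hΓ, hmem, hΓS⟩ := he.exists_connectionMatrix hF hS (.inl i)
  have hΓe : c.EvenMatrix Γ := fun b a => by
    have := hmem b a
    change _ ∈ M.gr V (0 + _) at this
    rwa [zero_add] at this
  obtain ⟨W, h, hxW, R', hR', hWB, Φ, Ψ, h1, h2, h3, h4, h5⟩ :=
    c.exists_gauge_analytic hV hx hR hB i hΓe fun b a q => hΓS _ (hSq q) b a
  refine ⟨W, h, hxW, R', hR', hWB, _, (he.restrict h).transform h1 h2 h3,
    isParallel_transform (Γ := Γ.map (M.res h)) (hS.restrict h) hi (fun b => ?_) h3 (fun b a => ?_)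
      fun d hd hdz => h5 d hdz (hΓS d hd)⟩
  · have := congrArg (resVF h) (hΓ b)
    rw [N.nabla_res, resVF_sum] at this
    simp_rw [resVF_smul] at this
    exact this
  · rw [← h4 b a]
    congr 1
    refine Finset.sum_congr rfl fun d _ => ?_
    change koszul 0 _ • _ = _
    rw [koszul_zero_left, one_smul]
    rfl

end IsFrame

/-- A flat connection has local frames of flat vector fields. -/
theorem exists_parallel_frame (hF : N.Flat) (c : M.Chart m p n) {x : M.X} (hx : x ∈ c.dom) :
    ∃ (W : Opens M.X) (hW : W ≤ c.dom), x ∈ W ∧ ∃ R > 0, c.coord '' W = ball (c.coord x) R ∧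
      ∃ e, c.IsFrame hW e ∧ IsParallel N hW e Finset.univ := by
  classical
  obtain ⟨R, hR, V, hV, hxV, hB⟩ := c.exists_ball le_rfl hx
  -- Formal and odd coordinates are treated before the analytic ones, whose transport relies on
  -- them.
  have h1 : ∀ s : Finset (Fin p ⊕ Fin n), ∃ e, c.IsFrame hV e ∧
      IsParallel N hV e (s.map ⟨Sum.inr, Sum.inr_injective⟩) := by
    intro s
    induction s using Finset.induction_on with
    | empty => exact ⟨_, c.isFrame_partialVF hV, by simp [IsParallel]⟩
    | insert q s hq ih =>
      obtain ⟨e, he, hS⟩ := ih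
      rw [Finset.map_insert]
      exact he.exists_parallel_insert_inr hF hS (by simpa using hq)
  have h2 : ∀ s : Finset (Fin m), ∃ (W : Opens M.X) (hW : W ≤ c.dom), x ∈ W ∧
      ∃ R > 0, c.coord '' W = ball (c.coord x) R ∧ ∃ e, c.IsFrame hW e ∧
        IsParallel N hW e (s.disjSum Finset.univ) := by
    intro s
    induction s using Finset.induction_on with
    | empty =>
      obtain ⟨e, he, hS⟩ := h1 Finset.univ
      refine ⟨V, hV, hxV, R, hR, hB, e, he, ?_⟩
      rw [Finset.empty_disjSum]
      exact hS
    | insert i s hi ih =>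
      obtain ⟨W, hW, hxW, R, hR, hB, e, he, hS⟩ := ih
      obtain ⟨W', h, hxW', R', hR', hB', e', he', hS'⟩ :=
        he.exists_parallel_insert_inl hF hS hxW hR hB (i := i) (by simpa using hi) (by simp)
      refine ⟨W', h.trans hW, hxW', R', hR', hB', e', he', ?_⟩
      have h3 : (insert i s).disjSum (Finset.univ : Finset (Fin p ⊕ Fin n)) =
          insert (.inl i) (s.disjSum Finset.univ) := by
        ext q; rcases q with q | q <;> simp
      rw [h3]
      exact hS'
  obtain ⟨W, hW, hxW, R, hR, hB, e, he, hS⟩ := h2 Finset.univ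
  exact ⟨W, hW, hxW, R, hR, hB, e, he, fun a _ b => hS a (by rcases a with a | a <;> simp) b⟩

end Chart

end Superspace

end

/-! ### The Poincaré lemma -/

noncomputable section

namespace Superspace

variable {r : ℕ} {M : Superspace.{u} r} {U V W : Opens M.X} {N : M.Connection}

/-- The sign in the Leibniz rule sits on the term that vanishes, so `f` need not be homogeneous. -/
theorem Connection.nabla_smul_of_nabla_eq_zero {k : ZMod 2} {X Y : M.VF U} (hX : IsHomog k X)
    (hY : N.nabla X Y = 0) (f : M.Fn U) : N.nabla X (f • Y) = dfn X f • Y := by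
  rw [← M.sum_part U f, Finset.sum_smul, N.nabla_sum, dfn_sum, Finset.sum_smul]
  refine Finset.sum_congr rfl fun i _ => ?_
  rw [N.nabla_smul hX (M.part_mem U i f), hY, smul_zero, smul_zero, add_zero]

namespace Chart

open Metric

variable {m p n : ℕ} {c : M.Chart m p n} {hV : V ≤ c.dom}

theorem pd_sq_odd {z : CoordIdx m p n} (hz : cpar z = 1) {g : M.Fn V}
    (h : c.pd hV z g = koszul (cpar z) (cpar z) • c.pd hV z g) : c.pd hV z g = 0 := by
  rw [hz, koszul_self_one, neg_one_zsmul] at h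
  have h2 : (2 : ℂ) • c.pd hV z g = 0 := by
    rw [two_smul]; nth_rewrite 1 [h]; exact neg_add_cancel _
  exact (smul_eq_zero_iff_right two_ne_zero).1 h2

/-- The Poincaré lemma for `1`-forms on a polydisc. -/
theorem exists_primitive {a : Fin m → ℂ} {R : ℝ} (hB : c.coord '' V = ball a R)
    {ω : CoordIdx m p n → M.Fn V}
    (hω : ∀ d b, c.pd hV d (ω b) = koszul (cpar d) (cpar b) • c.pd hV b (ω d)) :
    ∃ f : M.Fn V, ∀ b, c.pd hV b f = ω b := by
  classical
  have key : ∀ S : Finset (CoordIdx m p n), ∃ f : M.Fn V, ∀ b ∈ S, c.pd hV b f = ω b := by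
    intro S
    induction S using Finset.induction_on with
    | empty => exact ⟨0, by simp⟩
    | insert z S hz ih =>
      obtain ⟨f, hf⟩ := ih
      -- The defect along the new coordinate. Closedness makes it independent of the coordinates in
      -- `S`, so a primitive of it along `z` can be chosen independent of them too.
      set g := ω z - c.pd hV z f with hg
      have hgS : ∀ b ∈ S, c.pd hV b g = 0 := by
        intro b hb
        rw [hg, pd_sub, hω b z, c.pd_comm hV b z, hf b hb, sub_self]
      have hh : ∃ h, c.pd hV z h = g ∧ ∀ b ∈ S, c.pd hV b h = 0 := by
        rcases zmod_two_cases (cpar z) with hz0 | hz1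
        · obtain ⟨h, h1, h2⟩ := c.exists_primitive_even hV hB hz0 g
          exact ⟨_, h1, fun b hb => h2 b (fun hbz => hz (hbz ▸ hb)) (hgS b hb)⟩
        -- For odd `z`, closedness for the pair `(z, z)` gives `∂_z g = 0`, and then `θ g` is a
        -- primitive.
        · have hgz : c.pd hV z g = 0 := by
            refine pd_sq_odd hz1 ?_
            rw [hg, pd_sub, smul_sub, ← hω z z, ← c.pd_comm hV z z]
          have hbz : ∀ b ∈ S, b ≠ z := fun b hb h => hz (h ▸ hb)
          refine ⟨c.zf hV z * g, ?_, fun b hb => ?_⟩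
          · rw [c.pd_mul hV z (c.zf_mem hV z), hgz, pd_zf, if_pos rfl]
            simp
          · rw [c.pd_mul hV b (c.zf_mem hV z), hgS b hb, pd_zf,
              if_neg (hbz b hb)]
            simp
      obtain ⟨h, h1, h2⟩ := hh
      refine ⟨f + h, fun b hb => ?_⟩
      rw [pd_add]
      rcases Finset.mem_insert.1 hb with rfl | hb
      · rw [h1, hg, add_sub_cancel]
      · rw [hf b hb, h2 b hb, add_zero]
  obtain ⟨f, hf⟩ := key Finset.univ
  exact ⟨f, fun b => hf b (Finset.mem_univ b)⟩

/-- The Poincaré lemma for `1`-forms with values in a flat bundle. -/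
theorem IsFrame.exists_primitive {e : CoordIdx m p n → M.VF V} (he : c.IsFrame hV e)
    (hp : IsParallel N hV e Finset.univ) {a : Fin m → ℂ} {R : ℝ} (hB : c.coord '' V = ball a R)
    {ω : CoordIdx m p n → M.VF V}
    (hω : ∀ d b, N.nabla (c.partialVF hV d) (ω b) =
      koszul (cpar d) (cpar b) • N.nabla (c.partialVF hV b) (ω d)) :
    ∃ C : M.VF V, ∀ b, N.nabla (c.partialVF hV b) C = ω b := by
  have hn : ∀ d (f : CoordIdx m p n → M.Fn V), N.nabla (c.partialVF hV d) (∑ i, f i • e i) =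
      ∑ i, c.pd hV d (f i) • e i := by
    intro d f
    rw [N.nabla_sum]
    refine Finset.sum_congr rfl fun i _ => ?_
    rw [Connection.nabla_smul_of_nabla_eq_zero (c.isHomog_partialVF hV d)
      (hp d (Finset.mem_univ d) i), dfn_partialVF]
  choose w hw using fun b => he.exists_coeff (ω b)
  have hcl : ∀ i d b, c.pd hV d (w b i) = koszul (cpar d) (cpar b) • c.pd hV b (w d i) := by
    intro i d b
    have h1 := hω d b
    rw [hw b, hw d, hn, hn, Finset.smul_sum] at h1
    simp_rw [← smul_assoc] at h1
    exact he.ext h1 i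
  choose f hf using fun i => Chart.exists_primitive hB (ω := fun b => w b i) (hcl i)
  refine ⟨∑ i, f i • e i, fun b => ?_⟩
  rw [hn, hw b]
  simp_rw [hf]

end Chart

end Superspace

end

/-! ### Flat vector fields and linearity of the multiplication -/

noncomputable section

namespace Superspace

variable {r : ℕ} {M : Superspace.{u} r} {U V W : Opens M.X} {N : M.Connection} {A : M.HiggsField}

theorem VF.smul_zsmul (a : ℤ) (f : M.Fn U) (X : M.VF U) : f • a • X = a • f • X :=
  fsmul_zsmul a f X

theorem VF.sum_part_pair (X : M.VF U) : X.part 0 + X.part 1 = X := by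
  conv_rhs => rw [← sum_part_VF X, show (Finset.univ : Finset (ZMod 2)) = {0, 0 + 1} from
    zmod_two_univ 0, Finset.sum_pair (zmod_two_ne 0)]
  rfl

theorem IsHomog.eq_zero_of_add {k l : ZMod 2} (hkl : k ≠ l) {X Y : M.VF U} (hX : IsHomog k X)
    (hY : IsHomog l Y) (h : X + Y = 0) : X = 0 ∧ Y = 0 := by
  have hXl : IsHomog l X := by
    intro j hj
    have h1 := congrArg (fun Z : M.VF U => Z.comp j) h
    simpa [hY j hj] using h1
  have hX0 := hX.eq_zero hkl hXl
  exact ⟨hX0, by rwa [hX0, zero_add] at h⟩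

theorem dfn_cst (X : M.VF U) (a : OddConstants r) : dfn X (M.cst U a) = 0 := by
  rw [dfn, act_apply]
  exact Finset.sum_eq_zero fun k _ => (X.comp k).2.2.1 U le_rfl a

namespace Connection

/-- The homogeneous components of a flat vector field are flat. -/
theorem FlatField.part {Y : M.VF U} (hY : N.FlatField Y) (k : ZMod 2) : N.FlatField (Y.part k) := by
  intro V h X
  induction X using VF.induction_homog with
  | hadd X X' h1 h2 => rw [N.add_left, h1, h2, add_zero]
  | h j X hX =>
    have h1 := hY V h X
    rw [← VF.sum_part_pair Y, resVF_add, N.add_right] at h1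
    have h2 := IsHomog.eq_zero_of_add (by simp)
      (N.homog j 0 X _ hX ((isHomog_part 0 Y).resVF h))
      (N.homog j 1 X _ hX ((isHomog_part 1 Y).resVF h)) h1
    rcases zmod_two_cases k with rfl | rfl
    · exact h2.1
    · exact h2.2

theorem FlatField.nabla_eq_zero {Y : M.VF U} (hY : N.FlatField Y) (X : M.VF U) :
    N.nabla X Y = 0 := hY U le_rfl X

theorem FlatField.resVF {Y : M.VF U} (hY : N.FlatField Y) (h : V ≤ U) :
    N.FlatField (resVF h Y) := fun W hW X => hY W (hW.trans h) X

/-- For a torsionless connection, the bracket with a flat vector field is a covariant derivative. -/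
theorem FlatField.bracket_eq (hT : N.Torsionless) {Y : M.VF U} (hY : N.FlatField Y)
    (C : M.VF U) : bracket Y C = N.nabla Y C := by
  have h1 : ∀ k, bracket (Y.part k) C = N.nabla (Y.part k) C := by
    intro k
    induction C using VF.induction_homog with
    | hadd X X' h1 h2 => rw [bracket_add_right, N.add_right, h1, h2]
    | h j X hX =>
      rw [hT.bracket_eq (isHomog_part k Y) hX, (hY.part k).nabla_eq_zero, smul_zero, sub_zero]
  rw [← VF.sum_part_pair Y, bracket_add_left, N.add_left, h1, h1]

end Connection

namespace HiggsField

variable (A)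

/-- Left multiplication by a vector field. -/
def mulLeft (X : M.VF U) : M.VF U →+ M.VF U := AddMonoidHom.mk' (A.ins X) (A.add_right X)

/-- Right multiplication by a vector field. -/
def mulRight (Y : M.VF U) : M.VF U →+ M.VF U :=
  AddMonoidHom.mk' (fun X => A.ins X Y) fun X X' => A.add_left X X' Y

theorem ins_zero (X : M.VF U) : A.ins X 0 = 0 := map_zero (A.mulLeft X)

theorem ins_sum {ι : Type*} (s : Finset ι) (X : M.VF U) (Y : ι → M.VF U) :
    A.ins X (∑ i ∈ s, Y i) = ∑ i ∈ s, A.ins X (Y i) := map_sum (A.mulLeft X) Y s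

theorem sum_ins {ι : Type*} (s : Finset ι) (X : ι → M.VF U) (Y : M.VF U) :
    A.ins (∑ i ∈ s, X i) Y = ∑ i ∈ s, A.ins (X i) Y := map_sum (A.mulRight Y) X s

theorem zero_ins (Y : M.VF U) : A.ins 0 Y = 0 := map_zero (A.mulRight Y)

theorem ins_zsmul (a : ℤ) (X Y : M.VF U) : A.ins X (a • Y) = a • A.ins X Y :=
  map_zsmul (A.mulLeft X) a Y

theorem zsmul_ins (a : ℤ) (X Y : M.VF U) : A.ins (a • X) Y = a • A.ins X Y :=
  map_zsmul (A.mulRight Y) a X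

theorem smul_ins (f : M.Fn U) (X Y : M.VF U) : A.ins (f • X) Y = f • A.ins X Y :=
  A.fsmul_left f X Y

theorem ins_smul {k i : ZMod 2} {X : M.VF U} (hX : IsHomog k X) {f : M.Fn U} (hf : f ∈ M.gr U i)
    (Y : M.VF U) : A.ins X (f • Y) = koszul k i • f • A.ins X Y :=
  A.fsmul_right k i X Y f hX hf

end HiggsField

/-! ### The linear coefficient of the curvature -/

theorem curvOne_add (k l : ZMod 2) (X Y Z Z' : M.VF U) :
    N.curvOne A k l X Y (Z + Z') = N.curvOne A k l X Y Z + N.curvOne A k l X Y Z' := by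
  simp only [Connection.curvOne, A.add_right, N.add_right, smul_add]
  abel

theorem curvOne_sum {ι : Type*} (s : Finset ι) (k l : ZMod 2) (X Y : M.VF U) (Z : ι → M.VF U) :
    N.curvOne A k l X Y (∑ i ∈ s, Z i) = ∑ i ∈ s, N.curvOne A k l X Y (Z i) :=
  map_sum (AddMonoidHom.mk' (N.curvOne A k l X Y) (curvOne_add k l X Y)) Z s

/-- The derivatives `X f` in `∇_X (Y ∘ f Z)` and in `Y ∘ ∇_X (f Z)` occur with opposite total signs
and cancel, and likewise for `Y f`. Hence `R₁` only needs to be evaluated on a frame. -/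
theorem curvOne_smul {k l i : ZMod 2} {X Y : M.VF U} (hX : IsHomog k X) (hY : IsHomog l Y)
    {f : M.Fn U} (hf : f ∈ M.gr U i) (Z : M.VF U) :
    N.curvOne A k l X Y (f • Z) = koszul (k + l) i • f • N.curvOne A k l X Y Z := by
  have hXf := hX.dfn_mem hf
  have hYf := hY.dfn_mem hf
  simp only [Connection.curvOne, A.ins_smul hX hf, A.ins_smul hY hf, N.nabla_zsmul,
    N.nabla_smul hX hf, N.nabla_smul hY hf, A.add_right, A.ins_zsmul, A.ins_smul hX hYf,
    A.ins_smul hY hXf, A.ins_smul (isHomog_bracket hX hY) hf, smul_add, smul_sub, smul_smul]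
  simp only [VF.smul_zsmul, smul_smul]
  have h00 : koszul 0 0 = 1 := rfl
  have h01 : koszul 0 1 = 1 := rfl
  have h10 : koszul 1 0 = 1 := rfl
  rcases zmod_two_cases k with rfl | rfl <;> rcases zmod_two_cases l with rfl | rfl <;>
    rcases zmod_two_cases i with rfl | rfl <;>
    simp only [add_zero, zero_add, CharTwo.add_self_eq_zero, h00, h01, h10, koszul_self_one,
      mul_one, mul_neg, neg_neg, one_smul, neg_smul] <;> abel

end Superspace

end

/-! ### Vector potentials and the linear coefficient of the curvature -/

noncomputable section

namespace Superspace

variable {r : ℕ} {M : Superspace.{u} r} {U V W : Opens M.X} {N : M.Connection} {A : M.HiggsField}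

namespace Chart

open Metric

variable {m p n : ℕ} {c : M.Chart m p n} {hV : V ≤ c.dom} {e : CoordIdx m p n → M.VF V}

theorem IsParallel.flatField (hp : IsParallel N hV e Finset.univ) (b : CoordIdx m p n) :
    N.FlatField (e b) := by
  intro W h X
  rw [c.eq_sum_partialVF (h.trans hV) X, N.sum_nabla]
  refine Finset.sum_eq_zero fun a _ => ?_
  rw [N.smul_nabla, hp.restrict h a (Finset.mem_univ a) b, smul_zero]

theorem nabla_eq_ins {B Y : M.VF V}
    (hB : ∀ a, N.nabla (c.partialVF hV a) B = A.ins (c.partialVF hV a) Y) (h : W ≤ V)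
    (X : M.VF W) : N.nabla X (resVF h B) = A.ins X (resVF h Y) := by
  rw [c.eq_sum_partialVF (h.trans hV) X, N.sum_nabla, A.sum_ins]
  refine Finset.sum_congr rfl fun a _ => ?_
  have h1 := congrArg (resVF h) (hB a)
  rw [N.nabla_res, A.ins_res] at h1
  rw [N.smul_nabla, A.smul_ins]
  exact congrArg _ h1

/-- If the linear coefficient of the curvature vanishes, then the multiplication has potentials on
polydiscs with a flat frame. -/
theorem IsFrame.exists_potential (hT : N.Torsionless) (hA : A.Supercommutative)
    (hR : ∀ (U : Opens M.X) (k l : ZMod 2) (X Y Z : M.VF U), IsHomog k X → IsHomog l Y →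
      N.curvOne A k l X Y Z = 0) (he : c.IsFrame hV e) (hp : IsParallel N hV e Finset.univ)
    {x : Fin m → ℂ} {R : ℝ} (hB : c.coord '' V = ball x R) :
    ∃ C : M.VF V, ∀ (W : Opens M.X) (h : W ≤ V) (X Y : M.VF W), N.FlatField X → N.FlatField Y →
      A.mul X Y = bracket X (bracket Y (resVF h C)) := by
  have hflat := fun b => hp.flatField b
  -- As `e i` is flat, `R₁ = 0` on `e i` says that the 1-form `X ↦ X ∘ e i` is closed; `B i` is a
  -- primitive.
  have hBi : ∀ i, ∃ B : M.VF V, ∀ a, N.nabla (c.partialVF hV a) B =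
      A.ins (c.partialVF hV a) (e i) := by
    intro i
    refine he.exists_primitive hp hB fun d b => ?_
    have h1 := hR V _ _ _ _ (e i) (c.isHomog_partialVF hV d) (c.isHomog_partialVF hV b)
    rw [Connection.curvOne, c.bracket_partialVF, A.zero_ins, (hflat i).nabla_eq_zero,
      (hflat i).nabla_eq_zero, A.ins_zero, A.ins_zero, add_zero, add_zero, sub_zero] at h1
    exact sub_eq_zero.1 h1
  choose B hBn using hBi
  choose f hf using fun a => he.exists_coeff (c.partialVF hV a)
  have hfm : ∀ a i, f a i ∈ M.gr V (cpar a + cpar i) := by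
    intro a i
    refine he.coeff_mem ?_ i
    rw [← hf]
    exact c.isHomog_partialVF hV a
  -- The functions `f b i` are the components of the coframe dual to `e`. It is closed because the
  -- torsion and the brackets of coordinate fields vanish.
  have hcl : ∀ i d b, c.pd hV d (f b i) = koszul (cpar d) (cpar b) • c.pd hV b (f d i) := by
    intro i d b
    have h1 := hT.bracket_eq (c.isHomog_partialVF hV d) (c.isHomog_partialVF hV b)
    rw [c.bracket_partialVF, eq_comm, sub_eq_zero] at h1
    have hn : ∀ d b, N.nabla (c.partialVF hV d) (c.partialVF hV b) =
        ∑ i, c.pd hV d (f b i) • e i := by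
      intro d b
      rw [hf b, N.nabla_sum]
      refine Finset.sum_congr rfl fun i _ => ?_
      rw [Connection.nabla_smul_of_nabla_eq_zero (c.isHomog_partialVF hV d)
        ((hflat i).nabla_eq_zero _), dfn_partialVF]
    rw [hn, hn, Finset.smul_sum] at h1
    simp_rw [← smul_assoc] at h1
    exact he.ext h1 i
  have hω : ∀ d b, N.nabla (c.partialVF hV d) (∑ i, f b i • B i) =
      ∑ i, c.pd hV d (f b i) • B i + A.ins (c.partialVF hV d) (c.partialVF hV b) := by
    intro d b
    conv_rhs => rw [hf b, A.ins_sum, ← Finset.sum_add_distrib]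
    rw [N.nabla_sum]
    refine Finset.sum_congr rfl fun i _ => ?_
    rw [nabla_partialVF_smul (hfm b i), hBn, A.ins_smul (c.isHomog_partialVF hV d) (hfm b i)]
  -- The form sending `e i` to `B i`. By `hω` its closedness splits into that of the coframe and the
  -- supercommutativity of `∘`.
  obtain ⟨C, hC⟩ := he.exists_primitive hp hB (ω := fun b => ∑ i, f b i • B i) fun d b => by
    have h1 : A.ins (c.partialVF hV d) (c.partialVF hV b) = _ :=
      hA V _ _ _ _ (c.isHomog_partialVF hV d) (c.isHomog_partialVF hV b)
    rw [hω, hω, h1, smul_add, Finset.smul_sum]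
    simp_rw [hcl _ d b, smul_assoc]
    rfl
  refine ⟨C, fun W h X Y hX hY => ?_⟩
  rw [hY.bracket_eq hT, hX.bracket_eq hT]
  have heW := he.restrict h
  -- Returning from coordinate fields to the frame: `Φ` inverts the matrix `f` by uniqueness of
  -- coefficients, so the derivative of `C` along `e i` is `B i`.
  have hCY : ∀ g : CoordIdx m p n → M.Fn W, N.nabla (∑ i, g i • resVF h (e i)) (resVF h C) =
      ∑ i, g i • resVF h (B i) := by
    intro g
    obtain ⟨Φ, Ψ, h1, h2, h3⟩ := he.exists_matrix
    rw [N.sum_nabla]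
    refine Finset.sum_congr rfl fun i _ => ?_
    rw [N.smul_nabla, ← N.nabla_res]
    congr 2
    have hs : ∀ X' : CoordIdx m p n → M.VF V, ∑ a, Φ i a • ∑ j, f a j • X' j =
        ∑ j, (∑ a, Φ i a * f a j) • X' j := fun X' => sum_mul_smul (Φ i) (Matrix.of f) X'
    have h4 : ∀ j, ∑ a, Φ i a * f a j = if i = j then 1 else 0 := by
      intro j
      refine he.ext (f := fun j => ∑ a, Φ i a * f a j) (g := fun j => if i = j then 1 else 0) ?_ j
      rw [← hs]
      simp only [← hf, ← h3]
      simp [ite_smul]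
    rw [h3, N.sum_nabla]
    simp_rw [N.smul_nabla, hC]
    rw [hs]
    simp only [h4]
    simp [ite_smul]
  -- The coefficients of a flat `Y` in the flat frame are killed by `X`, so both sides pull them out
  -- with the same sign.
  have key : ∀ (k l : ZMod 2) (X Y : M.VF W), IsHomog k X → IsHomog l Y → N.FlatField Y →
      A.mul X Y = N.nabla X (N.nabla Y (resVF h C)) := by
    intro k l X Y hXk hYl hY
    obtain ⟨g, hg⟩ := heW.exists_coeff Y
    have hgm : ∀ i, g i ∈ M.gr W (l + cpar i) := heW.coeff_mem (hg ▸ hYl)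
    have hgX : ∀ i, dfn X (g i) = 0 := by
      refine heW.eq_zero_of_sum (f := fun i => dfn X (g i)) ?_
      rw [← hY.nabla_eq_zero X, hg, N.nabla_sum]
      refine Finset.sum_congr rfl fun i _ => ?_
      rw [Connection.nabla_smul_of_nabla_eq_zero hXk ((hflat i) W h X)]
    rw [hg, hCY, N.nabla_sum]
    change A.ins _ _ = _
    rw [A.ins_sum]
    refine Finset.sum_congr rfl fun i _ => ?_
    rw [A.ins_smul hXk (hgm i), N.nabla_smul hXk (hgm i), hgX, zero_smul, zero_add,
      nabla_eq_ins (hBn i) h]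
  have key2 : ∀ (l : ZMod 2) (Y : M.VF W), IsHomog l Y → N.FlatField Y →
      A.mul X Y = N.nabla X (N.nabla Y (resVF h C)) := by
    intro l Y hYl hY
    clear hX
    induction X using VF.induction_homog with
    | hadd X X' h1 h2 =>
      unfold HiggsField.mul at *
      rw [A.add_left, N.add_left, h1, h2]
    | h j X hX => exact key j l X Y hX hYl hY
  rw [← VF.sum_part_pair Y, N.add_left, N.add_right, ← key2 0 _ (isHomog_part 0 Y) (hY.part 0),
    ← key2 1 _ (isHomog_part 1 Y) (hY.part 1)]
  exact A.add_right X _ _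

/-- A potential forces the linear coefficient of the curvature to vanish, on the domain of a flat
frame. -/
theorem IsFrame.curvOne_eq_zero (hT : N.Torsionless) (hF : N.Flat) (he : c.IsFrame hV e)
    (hflat : ∀ b, N.FlatField (e b)) {C : M.VF V}
    (hC : ∀ X Y : M.VF V, N.FlatField X → N.FlatField Y → A.mul X Y = bracket X (bracket Y C))
    {k l : ZMod 2} {X Y : M.VF V} (hX : IsHomog k X) (hY : IsHomog l Y) (Z : M.VF V) :
    N.curvOne A k l X Y Z = 0 := by
  -- Both sides are linear over functions in `X`, so the relation for flat `X` extends to all `X`.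
  -- Then `R₁` on `e i` is the curvature of `N` on the derivative of `C` along `e i`.
  have hB : ∀ i (X : M.VF V), A.ins X (e i) = N.nabla X (N.nabla (e i) C) := by
    intro i X
    obtain ⟨f, hf⟩ := he.exists_coeff X
    rw [hf, A.sum_ins, N.sum_nabla]
    refine Finset.sum_congr rfl fun j _ => ?_
    have h1 : A.ins (e j) (e i) = _ := hC (e j) (e i) (hflat j) (hflat i)
    rw [A.smul_ins, N.smul_nabla, h1, (hflat i).bracket_eq hT, (hflat j).bracket_eq hT]
  have h0 : ∀ i, N.curvOne A k l X Y (e i) = 0 := by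
    intro i
    rw [Connection.curvOne, (hflat i).nabla_eq_zero, (hflat i).nabla_eq_zero, A.ins_zero,
      A.ins_zero, add_zero, add_zero, hB, hB, hB]
    exact hF V k l X Y _ hX hY
  obtain ⟨f, hf⟩ := he.exists_coeff Z
  rw [hf, curvOne_sum]
  refine Finset.sum_eq_zero fun i _ => ?_
  rw [← M.sum_part V (f i), Finset.sum_smul, curvOne_sum]
  refine Finset.sum_eq_zero fun j _ => ?_
  rw [curvOne_smul hX hY (M.part_mem V j _), h0, smul_zero, smul_zero]

end Chart

theorem resVF_curvOne (h : V ≤ U) (k l : ZMod 2) (X Y Z : M.VF U) :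
    resVF h (N.curvOne A k l X Y Z) =
      N.curvOne A k l (resVF h X) (resVF h Y) (resVF h Z) := by
  have hsub : ∀ X Y : M.VF U, resVF h (X - Y) = resVF h X - resVF h Y := fun _ _ => rfl
  simp only [Connection.curvOne, hsub, resVF_add, resVF_zsmul, N.nabla_res, A.ins_res,
    resVF_bracket]

/-! ### The pencil of connections -/

theorem curvature_pencil (A : M.HiggsField) {a : OddConstants r}
    (ha : a ∈ extParity (Fin r → ℂ) 0) {k l : ZMod 2} {X Y : M.VF U} (hX : IsHomog k X)
    (hY : IsHomog l Y) (Z : M.VF U) : (N.pencil A a ha).curvature k l X Y Z =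
      N.curvature k l X Y Z + M.cst U a • N.curvOne A k l X Y Z +
        M.cst U (a ^ 2) • A.curvTwo k l X Y Z := by
  have hg := M.cst_gr U ha
  have h1 : ∀ {k : ZMod 2} {X : M.VF U}, IsHomog k X → ∀ Y,
      N.nabla X (M.cst U a • Y) = M.cst U a • N.nabla X Y := by
    intro k X hX Y
    rw [N.nabla_smul hX hg, dfn_cst, zero_smul, zero_add, koszul_comm, koszul_zero_left, one_smul]
  have h2 : ∀ {k : ZMod 2} {X : M.VF U}, IsHomog k X → ∀ Y,
      A.ins X (M.cst U a • Y) = M.cst U a • A.ins X Y := by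
    intro k X hX Y
    rw [A.ins_smul hX hg, koszul_comm, koszul_zero_left, one_smul]
  simp only [Connection.curvature, Connection.pencil, Connection.curvOne, HiggsField.curvTwo,
    fsmul_eq_smul, N.add_right, A.add_right, h1 hX, h1 hY, h2 hX, h2 hY, pow_two, map_mul, mul_smul,
    smul_sub, smul_add, VF.smul_zsmul]
  abel

theorem torsion_pencil (hT : N.Torsionless) (A : M.HiggsField) {a : OddConstants r}
    (ha : a ∈ extParity (Fin r → ℂ) 0) {k l : ZMod 2} {X Y : M.VF U} (hX : IsHomog k X)
    (hY : IsHomog l Y) : (N.pencil A a ha).torsion k l X Y =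
      M.cst U a • (A.mul X Y - koszul k l • A.mul Y X) := by
  have h := hT U k l X Y hX hY
  simp only [Connection.torsion, Connection.pencil, HiggsField.mul, fsmul_eq_smul, smul_sub,
    smul_add, VF.smul_zsmul] at h ⊢
  rw [← zero_add (M.cst U a • A.ins X Y - _), ← h]
  abel

/-- From `R₂ = 0`: X∘(Y∘Z) is ±X∘(Z∘Y), then ±Z∘(X∘Y) since left multiplications supercommute, then
±(X∘Y)∘Z; the three signs cancel. -/
theorem HiggsField.Supercommutative.associative_iff (hA : A.Supercommutative) :
    A.Associative ↔ ∀ (U : Opens M.X) (k l : ZMod 2) (X Y Z : M.VF U), IsHomog k X →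
      IsHomog l Y → A.curvTwo k l X Y Z = 0 := by
  constructor
  · intro h U k l X Y Z hX hY
    have h1 := h U X Y Z
    have h2 := h U Y X Z
    have h3 := hA U k l X Y hX hY
    unfold HiggsField.mul at h1 h2 h3
    rw [HiggsField.curvTwo, ← h1, ← h2, h3, A.zsmul_ins, sub_self]
  · intro h U X Y Z
    induction X using VF.induction_homog with
    | hadd X X' h1 h2 =>
      unfold HiggsField.mul at *
      rw [A.add_left, A.add_left, A.add_left, h1, h2]
    | h k X hX =>
    induction Y using VF.induction_homog with
    | hadd Y Y' h1 h2 =>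
      unfold HiggsField.mul at *
      rw [A.add_left, A.add_right, A.add_right, A.add_left, h1, h2]
    | h l Y hY =>
    induction Z using VF.induction_homog with
    | hadd Z Z' h1 h2 =>
      unfold HiggsField.mul at *
      rw [A.add_right, A.add_right, A.add_right, h1, h2]
    | h q Z hZ =>
      have h1 := hA U l q Y Z hY hZ
      have h2 := sub_eq_zero.1 (h U k q X Z Y hX hZ)
      have h3 := hA U q (k + l) Z (A.ins X Y) hZ (A.homog k l X Y hX hY)
      unfold HiggsField.mul at *
      have h4 : ∀ k l q, koszul l q * koszul k q * koszul q (k + l) = 1 := by decide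
      rw [h1, A.ins_zsmul, h2, h3, smul_smul, smul_smul, h4, one_smul]

end Superspace

end

/-! ### The pencil of connections and the three equivalences -/

theorem proposition2p6 {r m p n : ℕ} (M : Supermanifold.{u} r m p n)
    (N : M.toSuperspace.Connection) (hTorsion : N.Torsionless) (hFlat : N.Flat)
    (A : M.toSuperspace.HiggsField) :
    -- the curvature of the pencil is `c R₁ + c² R₂`
    (∀ (c : OddConstants r) (hc : c ∈ extParity (Fin r → ℂ) 0) (U : Opens M.X) (k l : ZMod 2)
      (X Y Z : M.VF U), Superspace.IsHomog k X → Superspace.IsHomog l Y →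
        (N.pencil A c hc).curvature k l X Y Z =
          Superspace.fsmul (M.cst U c) (N.curvOne A k l X Y Z)
            + Superspace.fsmul (M.cst U (c ^ 2)) (A.curvTwo k l X Y Z)) ∧
    -- (a)
    (A.Supercommutative ↔
      ∀ (c : OddConstants r) (hc : c ∈ extParity (Fin r → ℂ) 0), (N.pencil A c hc).Torsionless) ∧
    -- (b)
    (A.Supercommutative →
      (A.HasLocalPotentials N ↔
        ∀ (U : Opens M.X) (k l : ZMod 2) (X Y Z : M.VF U), Superspace.IsHomog k X →
          Superspace.IsHomog l Y → N.curvOne A k l X Y Z = 0)) ∧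
    -- (c)
    (A.Supercommutative →
      (A.Associative ↔
        ∀ (U : Opens M.X) (k l : ZMod 2) (X Y Z : M.VF U), Superspace.IsHomog k X →
          Superspace.IsHomog l Y → A.curvTwo k l X Y Z = 0)) := by
  refine ⟨fun c hc U k l X Y Z hX hY => ?_, ⟨fun hA c hc U k l X Y hX hY => ?_,
    fun h U k l X Y hX hY => ?_⟩, fun hA => ⟨fun hC U k l X Y Z hX hY => ?_, fun hR x => ?_⟩,
    fun hA => hA.associative_iff⟩
  · rw [Superspace.curvature_pencil A hc hX hY, hFlat U k l X Y Z hX hY, zero_add]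
    rfl
  · rw [Superspace.torsion_pencil hTorsion A hc hX hY, hA U k l X Y hX hY, sub_self, smul_zero]
  -- The single value 1 of the parameter already recovers supercommutativity.
  · have h1 : (1 : OddConstants r) ∈ extParity (Fin r → ℂ) 0 := one_mem_extParity _
    have h2 := h 1 h1 U k l X Y hX hY
    rw [Superspace.torsion_pencil hTorsion A h1 hX hY, map_one, one_smul] at h2
    exact sub_eq_zero.1 h2
  -- Vanishing of a vector field is local, so one may pass to the intersection of `U` with the
  -- domains of a potential and of a flat frame.
  · refine Superspace.eq_zero_of_locally_eq_zero fun x hx => ?_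
    obtain ⟨W, hxW, C, hC⟩ := hC x
    obtain ⟨c, hc⟩ := M.exists_chart x
    obtain ⟨W', hW', hxW', -, -, -, e, he, hp⟩ :=
      Superspace.Chart.exists_parallel_frame hFlat c (x := x) hc
    have hVU : W' ⊓ W ⊓ U ≤ U := inf_le_right
    have hVW : W' ⊓ W ⊓ U ≤ W := inf_le_left.trans inf_le_right
    have hVW' : W' ⊓ W ⊓ U ≤ W' := inf_le_left.trans inf_le_left
    refine ⟨W' ⊓ W ⊓ U, hVU, ⟨⟨hxW', hxW⟩, hx⟩, ?_⟩
    rw [Superspace.resVF_curvOne]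
    exact (he.restrict hVW').curvOne_eq_zero hTorsion hFlat (fun b => (hp.flatField b).resVF hVW')
      (hC _ hVW) (hX.resVF hVU) (hY.resVF hVU) _
  · obtain ⟨c, hc⟩ := M.exists_chart x
    obtain ⟨W, hW, hxW, R, -, hB, e, he, hp⟩ :=
      Superspace.Chart.exists_parallel_frame hFlat c (x := x) hc
    obtain ⟨C, hC⟩ := he.exists_potential hTorsion hA hR hp hB
    exact ⟨W, hxW, C, hC⟩
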